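/- \textbf{Conventions.} Let $(M,g)$ be an oriented smooth four-dimensional Lorentzian manifold of signature $(-,+,+,+)$, with alternating tensor $\eta^{abcd}$, $\eta^{0123}=(-\det g)^{-1/2}$ in oriented charts. Let $u^a$ be a smooth unit timelike vector field, $n^a$ a smooth unit spacelike vector field with $u^an_a=0$, $H>0$ a smooth function, and $H^a=Hn^a$ (the magnetic field). Put $h_{ab}=g_{ab}+u_au_b$, $p_{ab}=h_{ab}-n_an_b$, and for any tensor $s$ put $\dot s=s_{;a}u^a$, $\overset{*}{s}=s_{;a}n^a$. Put $\theta=u^a{}_{;a}$, $\sigma_{ab}=h_a^ch_b^du_{(c;d)}-\frac13\theta h_{ab}$, $\omega^a=\frac12\eta^{abcd}u_{b;c}u_d$, $\mathcal S_{ab}=(p_a^cp_b^d-\frac12p^{cd}p_{ab})n_{(c;d)}$, $\mathcal R_{ab}=p_a^cp_b^dn_{[c;d]}$, $\mathcal R^a=\frac12\eta^{abcd}\mathcal R_{bc}u_d$, $\mathcal E=p^{cd}n_{c;d}$, $N_a=p_{ac}(\dot n^c-\overset{*}{u}{}^c)$. The manifold is an \emph{electromagnetic string fluid (EMSF) spacetime},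 with smooth matter energy density $\mu$, smooth pressure $p_\perp$ normal to the magnetic field, and real constants $\lambda,\Lambda$, if the field $F^{ab}=\eta^{abcd}H_cu_d$ satisfies $F_{[ab;c]}=0$, and $R_{ab}=T_{ab}+(\Lambda-\frac12T)g_{ab}$, where $T=T^a{}_a$ and $$T_{ab}=\Big(\mu+\tfrac12\lambda H^2\Big)(u_au_b-n_an_b)+\Big(p_\perp+\tfrac12\lambda H^2\Big)p_{ab}.$$ The current is $J^a=F^{ab}{}_{;b}$, the charge density is $e=-u_aJ^a$ and the conduction current is $j^a=h^a_bJ^b$. For a smooth function $\xi>0$, the vector $\xi^a=\xi n^a$ is a \emph{proper special conformal Killing vector (CKV)} if $L_{\xi}g_{ab}=2\psi g_{ab}$ for a smooth non-constant function $\psi$ with $\psi_{;ab}=0$. \textbf{Proposition.} Let $\xi^a=\xi n^a$ be a proper special CKV in an EMSF spacetime, and suppose that $\mu+\frac12\lambda H^2+\Lambda\neq0$ and $\overset{*}{H}\neq0$ at every point. Then: (a) $R_{ab}=\frac R2\,p_{ab}$, where $R$ is the Ricci scalar. (b) $R/H$ is constant along the magnetic field lines (the integral curves of $n^a$) and along the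 fluid flow lines (the integral curves of $u^a$). (c) The following equations hold: $$\overset{*}{\mu}-\Big(\mu-\tfrac12\lambda H^2+\Lambda\Big)(\ln H)^{*}=0,\qquad \dot\mu-(\mu+p_\perp)(\ln H)^{\cdot}=0,$$ $$\mathcal S_{ab}=0,\qquad \mathcal E=-(\ln H)^{*},\qquad \dot n^a=-\tfrac12(\ln H)^{*}u^a+p^a_b\,\sigma^b_c\,n^c,$$ $$\overset{*}{n}{}^a=(\ln\xi)^{*}n^a-(\ln\xi)^{,a},\qquad N_a=0,\qquad \sigma_{ab}n^an^b-\tfrac23\theta=(\ln H)^{\cdot},$$ $$e=2\omega^aH_a,\qquad \mathcal R^a=-\frac{j^bH_b}{2H^3}H^a.$$ -/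

import Mathlib

open scoped Manifold ContDiff Topology

noncomputable section

/-! ## Tensor calculus in one coordinate patch of a four-dimensional spacetime

Tensor fields are given by their components, functions on `ℝ⁴`.  The signature is `(-,+,+,+)`.
A semicolon index, written last, is the index of differentiation. -/

namespace Coord

/-- The coordinate space `ℝ⁴`. -/
abbrev Pt : Type := EuclideanSpace ℝ (Fin 4)

/-- Components of a vector field, or of a covector field. -/
abbrev Vec : Type := Pt → Fin 4 → ℝ

/-- Components of a tensor field with two indices. -/
abbrev Ten : Type := Pt → Matrix (Fin 4) (Fin 4) ℝ

/-- The partial derivative `∂_a f`. -/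
def pd (a : Fin 4) (f : Pt → ℝ) (z : Pt) : ℝ :=
  fderiv ℝ f z (EuclideanSpace.single a 1)

/-- The directional derivative `V^a ∂_a f` of a scalar. -/
def along (V : Vec) (f : Pt → ℝ) (z : Pt) : ℝ := ∑ a, V z a * pd a f z

/-- The inverse metric `g^{ab}`. -/
def ginv (g : Ten) (z : Pt) : Matrix (Fin 4) (Fin 4) ℝ := (g z)⁻¹

/-- The Christoffel symbol `Γ^a_{bc} = ½ g^{ad} (∂_b g_{dc} + ∂_c g_{db} - ∂_d g_{bc})`. -/
def Gam (g : Ten) (a b c : Fin 4) (z : Pt) : ℝ :=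
  (1 / 2) * ∑ d, ginv g z a d *
    (pd b (fun y => g y d c) z + pd c (fun y => g y d b) z - pd d (fun y => g y b c) z)

/-- The Ricci tensor
`R_{ab} = ∂_c Γ^c_{ab} - ∂_b Γ^c_{ac} + Γ^c_{cd} Γ^d_{ab} - Γ^c_{bd} Γ^d_{ac}`. -/
def ricci (g : Ten) (z : Pt) (a b : Fin 4) : ℝ :=
  (∑ c, pd c (Gam g c a b) z) - (∑ c, pd b (Gam g c a c) z)
    + (∑ c, ∑ d, Gam g c c d z * Gam g d a b z)
    - ∑ c, ∑ d, Gam g c b d z * Gam g d a c z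

/-- The Ricci scalar `R = g^{ab} R_{ab}`. -/
def ricciScalar (g : Ten) (z : Pt) : ℝ := ∑ a, ∑ b, ginv g z a b * ricci g z a b

/-- Lowering an index: `V_a = g_{ab} V^b`. -/
def lower (g : Ten) (V : Vec) (z : Pt) (a : Fin 4) : ℝ := ∑ b, g z a b * V z b

/-- The covariant derivative of a vector: `V^a_{;b} = ∂_b V^a + Γ^a_{bc} V^c`. -/
def dVec (g : Ten) (V : Vec) (z : Pt) (a b : Fin 4) : ℝ :=
  pd b (fun y => V y a) z + ∑ c, Gam g a b c z * V z c

/-- The covariant derivative of a covector: `w_{a;b} = ∂_b w_a - Γ^c_{ab} w_c`. -/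
def dCov (g : Ten) (w : Vec) (z : Pt) (a b : Fin 4) : ℝ :=
  pd b (fun y => w y a) z - ∑ c, Gam g c a b z * w z c

/-- The second covariant derivative `f_{;ab}` of a scalar. -/
def hess (g : Ten) (f : Pt → ℝ) (z : Pt) (a b : Fin 4) : ℝ :=
  dCov g (fun y c => pd c f y) z a b

/-- The covariant derivative `F_{ab;c} = ∂_c F_{ab} - Γ^d_{ac} F_{db} - Γ^d_{bc} F_{ad}`. -/
def dTen (g F : Ten) (z : Pt) (a b c : Fin 4) : ℝ :=
  pd c (fun y => F y a b) z - (∑ d, Gam g d a c z * F z d b) - ∑ d, Gam g d b c z * F z a d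

/-- The divergence `F^{ab}_{;b} = ∂_b F^{ab} + Γ^a_{bc} F^{cb} + Γ^b_{bc} F^{ac}` of a tensor with
two upper indices. -/
def divTen (g F : Ten) (z : Pt) (a : Fin 4) : ℝ :=
  (∑ b, pd b (fun y => F y a b) z) + (∑ b, ∑ c, Gam g a b c z * F z c b)
    + ∑ b, ∑ c, Gam g b b c z * F z a c

/-- The Lie derivative `(L_X g)_{ab} = X^c ∂_c g_{ab} + g_{cb} ∂_a X^c + g_{ac} ∂_b X^c`. -/
def lieMetric (g : Ten) (X : Vec) (z : Pt) (a b : Fin 4) : ℝ :=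
  (∑ c, X z c * pd c (fun y => g y a b) z) + (∑ c, g z c b * pd a (fun y => X y c) z)
    + ∑ c, g z a c * pd b (fun y => X y c) z

/-- The Levi-Civita symbol, with value `1` at `(0,1,2,3)`: the determinant of the matrix whose rows
are the standard basis vectors number `a, b, c, d`. -/
def levi (a b c d : Fin 4) : ℝ :=
  Matrix.det (Matrix.of fun i j : Fin 4 => if ![a, b, c, d] i = j then (1 : ℝ) else 0)

/-- The alternating tensor `η^{abcd}`, normalised by `η^{0123} = (-det g)^{-1/2}`. -/
def eta (g : Ten) (z : Pt) (a b c d : Fin 4) : ℝ := (√(-(g z).det))⁻¹ * levi a b c d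

/-- The components, in one coordinate patch, of the fields that describe a magnetofluid: the metric
`g_{ab}`, the four-velocity `u^a`, the direction `n^a` of the magnetic field, the magnetic field
strength `H`, the matter energy density `mu` and the pressure `pp` normal to the magnetic field. -/
structure Fields where
  g : Ten
  u : Vec
  n : Vec
  H : Pt → ℝ
  mu : Pt → ℝ
  pp : Pt → ℝ

namespace Fields

variable (S : Fields)

/-- `u_a`. -/
def ul : Vec := lower S.g S.u

/-- `n_a`. -/
def nl : Vec := lower S.g S.n

/-- The magnetic field `H^a = H n^a`. -/
def Hv : Vec := fun z a => S.H z * S.n z a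

/-- `h_{ab} = g_{ab} + u_a u_b`. -/
def h (z : Pt) (a b : Fin 4) : ℝ := S.g z a b + S.ul z a * S.ul z b

/-- `h_a^b = δ_a^b + u_a u^b`. -/
def hMix (z : Pt) (a b : Fin 4) : ℝ := (if a = b then 1 else 0) + S.ul z a * S.u z b

/-- `h^{ab} = g^{ab} + u^a u^b`. -/
def hUp (z : Pt) (a b : Fin 4) : ℝ := ginv S.g z a b + S.u z a * S.u z b

/-- The screen projector `p_{ab} = h_{ab} - n_a n_b`. -/
def p (z : Pt) (a b : Fin 4) : ℝ := S.h z a b - S.nl z a * S.nl z b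

/-- `p_a^b = h_a^b - n_a n^b`. -/
def pMix (z : Pt) (a b : Fin 4) : ℝ := S.hMix z a b - S.nl z a * S.n z b

/-- `p^{ab} = h^{ab} - n^a n^b`. -/
def pUp (z : Pt) (a b : Fin 4) : ℝ := S.hUp z a b - S.n z a * S.n z b

/-- `(ln H)˙ = u^a ∂_a ln H`. -/
def lnHdot (z : Pt) : ℝ := along S.u (fun y => Real.log (S.H y)) z

/-- `(ln H)* = n^a ∂_a ln H`. -/
def lnHstar (z : Pt) : ℝ := along S.n (fun y => Real.log (S.H y)) z

/-- `u_{a;b}`. -/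
def du (z : Pt) (a b : Fin 4) : ℝ := dCov S.g S.ul z a b

/-- `n_{a;b}`. -/
def dn (z : Pt) (a b : Fin 4) : ℝ := dCov S.g S.nl z a b

/-- The expansion `θ = u^a_{;a}`. -/
def theta (z : Pt) : ℝ := ∑ a, dVec S.g S.u z a a

/-- The shear `σ_{ab} = h_a^c h_b^d u_{(c;d)} - ⅓ θ h_{ab}`. -/
def sigma (z : Pt) (a b : Fin 4) : ℝ :=
  (∑ c, ∑ d, S.hMix z a c * S.hMix z b d * ((S.du z c d + S.du z d c) / 2))
    - (1 / 3) * S.theta z * S.h z a b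

/-- `σ_{ab} n^a n^b`. -/
def sigmaNN (z : Pt) : ℝ := ∑ a, ∑ b, S.sigma z a b * S.n z a * S.n z b

/-- The vorticity vector `ω^a = ½ η^{abcd} u_{b;c} u_d`. -/
def omega (z : Pt) (a : Fin 4) : ℝ :=
  (1 / 2) * ∑ b, ∑ c, ∑ d, eta S.g z a b c d * S.du z b c * S.ul z d

/-- `n^a_{;b} u^b`. -/
def nDot (z : Pt) (a : Fin 4) : ℝ := ∑ b, dVec S.g S.n z a b * S.u z b

/-- `n^a_{;b} n^b`. -/
def nStar (z : Pt) (a : Fin 4) : ℝ := ∑ b, dVec S.g S.n z a b * S.n z b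

/-- `u^a_{;b} n^b`. -/
def uStar (z : Pt) (a : Fin 4) : ℝ := ∑ b, dVec S.g S.u z a b * S.n z b

/-- The screen shear `𝒮_{ab} = (p_a^c p_b^d - ½ p^{cd} p_{ab}) n_{(c;d)}`. -/
def screenShear (z : Pt) (a b : Fin 4) : ℝ :=
  ∑ c, ∑ d, (S.pMix z a c * S.pMix z b d - (1 / 2) * S.pUp z c d * S.p z a b)
    * ((S.dn z c d + S.dn z d c) / 2)

/-- The screen rotation `ℛ_{ab} = p_a^c p_b^d n_{[c;d]}`. -/
def screenRot (z : Pt) (a b : Fin 4) : ℝ :=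
  ∑ c, ∑ d, S.pMix z a c * S.pMix z b d * ((S.dn z c d - S.dn z d c) / 2)

/-- The screen rotation vector `ℛ^a = ½ η^{abcd} ℛ_{bc} u_d`. -/
def screenRotVec (z : Pt) (a : Fin 4) : ℝ :=
  (1 / 2) * ∑ b, ∑ c, ∑ d, eta S.g z a b c d * S.screenRot z b c * S.ul z d

/-- The screen expansion `ℰ = p^{cd} n_{c;d}`. -/
def screenExp (z : Pt) : ℝ := ∑ c, ∑ d, S.pUp z c d * S.dn z c d

/-- The Greenberg vector `N_a = p_{ac} (n^c_{;b} u^b - u^c_{;b} n^b)`. -/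
def greenberg (z : Pt) (a : Fin 4) : ℝ := ∑ c, S.p z a c * (S.nDot z c - S.uStar z c)

/-- The electromagnetic field tensor with vanishing electric field,
`F^{ab} = η^{abcd} H_c u_d`. -/
def emUp : Ten := fun z => Matrix.of fun a b =>
  ∑ c, ∑ d, eta S.g z a b c d * lower S.g S.Hv z c * S.ul z d

/-- `F_{ab} = g_{ac} g_{bd} F^{cd}`. -/
def emLow : Ten := fun z => Matrix.of fun a b =>
  ∑ c, ∑ d, S.g z a c * S.g z b d * S.emUp z c d

/-- The four-current `J^a = F^{ab}_{;b}`. -/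
def current (z : Pt) (a : Fin 4) : ℝ := divTen S.g S.emUp z a

/-- The charge density `e = -u_a J^a`. -/
def charge (z : Pt) : ℝ := -∑ a, S.ul z a * S.current z a

/-- The conduction current `j^a = h^a_b J^b`. -/
def conduction (z : Pt) (a : Fin 4) : ℝ := ∑ b, S.hMix z b a * S.current z b

/-- The homogeneous Maxwell equation `F_{[ab;c]} = 0` at a point, the tensor `F_{ab}` being
antisymmetric. -/
def MaxwellAt (z : Pt) : Prop :=
  ∀ a b c, dTen S.g S.emLow z a b c + dTen S.g S.emLow z b c a + dTen S.g S.emLow z c a b = 0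

/-- The energy momentum tensor
`T_{ab} = (μ + ½λH²)(u_a u_b - n_a n_b) + (p_⊥ + ½λH²) p_{ab}`. -/
def stress (lam : ℝ) (z : Pt) (a b : Fin 4) : ℝ :=
  (S.mu z + (1 / 2) * lam * S.H z ^ 2) * (S.ul z a * S.ul z b - S.nl z a * S.nl z b)
    + (S.pp z + (1 / 2) * lam * S.H z ^ 2) * S.p z a b

/-- Its trace `T = g^{ab} T_{ab}`. -/
def stressTrace (lam : ℝ) (z : Pt) : ℝ := ∑ a, ∑ b, ginv S.g z a b * S.stress lam z a b

/-- Einstein's equations `R_{ab} = T_{ab} + (Λ - ½ T) g_{ab}` at a point. -/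
def EinsteinAt (lam Lam : ℝ) (z : Pt) : Prop :=
  ∀ a b, ricci S.g z a b =
    S.stress lam z a b + (Lam - (1 / 2) * S.stressTrace lam z) * S.g z a b

end Fields

end Coord

/-! ## Fields on a spacetime manifold and their components in a chart -/

section Spacetime

variable (M : Type*) [TopologicalSpace M] [ChartedSpace Coord.Pt M]

/-- The charts of `M` form an oriented atlas: all coordinate changes have positive Jacobian. -/
def OrientedAtlas : Prop :=
  ∀ e ∈ atlas Coord.Pt M, ∀ e' ∈ atlas Coord.Pt M, ∀ z ∈ (e.symm.trans e').source,
    0 < (fderiv ℝ (e' ∘ e.symm) z).det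

variable {M}

/-- The component `V^a` of a vector field in the chart `e`, as a function of the coordinates. -/
def vecComp (V : (x : M) → TangentSpace (𝓡 4) x) (e : OpenPartialHomeomorph M Coord.Pt) :
    Coord.Vec :=
  fun z a => (show Coord.Pt from mfderiv (𝓡 4) (𝓡 4) e (e.symm z) (V (e.symm z))) a

/-- The coordinate vector field `∂_a` of the chart `e`, at the point with coordinates `z`. -/
def frame (e : OpenPartialHomeomorph M Coord.Pt) (a : Fin 4) (z : Coord.Pt) :
    TangentSpace (𝓡 4) (e.symm z) :=
  mfderiv (𝓡 4) (𝓡 4) e.symm z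
    (show TangentSpace (𝓡 4) z from EuclideanSpace.single a (1 : ℝ))

/-- The components `g_{ab} = g(∂_a, ∂_b)` of a field of bilinear forms in the chart `e`. -/
def metricComp (g : (x : M) → LinearMap.BilinForm ℝ (TangentSpace (𝓡 4) x))
    (e : OpenPartialHomeomorph M Coord.Pt) : Coord.Ten :=
  fun z => Matrix.of fun a b => g (e.symm z) (frame e a z) (frame e b z)

/-- A function on the manifold is smooth. -/
def SmoothScalar (f : M → ℝ) : Prop := ContMDiff (𝓡 4) 𝓘(ℝ) ∞ f

/-- The components of a vector field are smooth in every chart. -/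
def SmoothVec (V : (x : M) → TangentSpace (𝓡 4) x) : Prop :=
  ∀ e ∈ atlas Coord.Pt M, ∀ a, ContDiffOn ℝ ∞ (fun z => vecComp V e z a) e.target

variable (M)

/-- A smooth Lorentzian metric of signature `(-,+,+,+)`. -/
structure LorentzMetric where
  val : (x : M) → LinearMap.BilinForm ℝ (TangentSpace (𝓡 4) x)
  symm : ∀ x v w, val x v w = val x w v
  signature : ∀ x, ∃ b : Module.Basis (Fin 4) ℝ (TangentSpace (𝓡 4) x), ∀ i j,
    val x (b i) (b j) = if i = j then (if i = 0 then -1 else 1) else 0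
  smooth : ∀ e ∈ atlas Coord.Pt M, ∀ a b,
    ContDiffOn ℝ ∞ (fun z => metricComp val e z a b) e.target

/-- The fields of a magnetofluid on a spacetime: the metric, the unit timelike four-velocity `u`,
the unit spacelike direction `n` of the magnetic field, orthogonal to `u`, the magnetic field
strength `H > 0`, the matter energy density `mu` and the pressure `pp` normal to the magnetic field,
with the constant `lam` of the electromagnetic energy momentum tensor and the cosmological
constant `Lam`. -/
structure Magnetofluid where
  g : LorentzMetric M
  u : (x : M) → TangentSpace (𝓡 4) x
  n : (x : M) → TangentSpace (𝓡 4) x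
  H : M → ℝ
  mu : M → ℝ
  pp : M → ℝ
  lam : ℝ
  Lam : ℝ
  u_smooth : SmoothVec u
  n_smooth : SmoothVec n
  H_smooth : SmoothScalar H
  mu_smooth : SmoothScalar mu
  pp_smooth : SmoothScalar pp
  u_unit : ∀ x, g.val x (u x) (u x) = -1
  n_unit : ∀ x, g.val x (n x) (n x) = 1
  u_orth_n : ∀ x, g.val x (u x) (n x) = 0
  H_pos : ∀ x, 0 < H x

variable {M}

/-- A function is constant along the curves tangent to the vector field `V`. -/
def ConstAlong (V : (x : M) → TangentSpace (𝓡 4) x) (f : M → ℝ) : Prop :=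
  ∀ (γ : ℝ → M) (a b : ℝ), IsMIntegralCurveOn (I := 𝓡 4) γ V (Set.Ioo a b) →
    ∀ s ∈ Set.Ioo a b, ∀ t ∈ Set.Ioo a b, f (γ s) = f (γ t)

namespace Magnetofluid

variable (S : Magnetofluid M)

/-- The components of the fields in the chart `e`. -/
def inChart (e : OpenPartialHomeomorph M Coord.Pt) : Coord.Fields where
  g := metricComp S.g.val e
  u := vecComp S.u e
  n := vecComp S.n e
  H := S.H ∘ e.symm
  mu := S.mu ∘ e.symm
  pp := S.pp ∘ e.symm

/-- The Ricci scalar, a function on the manifold. -/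
def R (x : M) : ℝ :=
  Coord.ricciScalar (metricComp S.g.val (chartAt Coord.Pt x)) (chartAt Coord.Pt x x)

/-- The derivative of a scalar along the magnetic field lines. -/
def star (f : M → ℝ) (x : M) : ℝ :=
  (show ℝ from mfderiv (𝓡 4) 𝓘(ℝ) f x (S.n x))

/-- The magnetofluid is an electromagnetic string fluid: Maxwell's equations (the inhomogeneous one
being the definition of the current) and Einstein's equations hold. -/
def IsEMSF : Prop :=
  ∀ e ∈ atlas Coord.Pt M, ∀ z ∈ e.target,
    (S.inChart e).MaxwellAt z ∧ (S.inChart e).EinsteinAt S.lam S.Lam z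

/-- `ξ n` is a conformal Killing vector with conformal factor `ψ`: `L_{ξn} g = 2ψ g`, where
`ξ > 0`. -/
structure IsCKV (ξ ψ : M → ℝ) : Prop where
  smooth : SmoothScalar ξ
  pos : ∀ x, 0 < ξ x
  factor_smooth : SmoothScalar ψ
  lie_eq : ∀ e ∈ atlas Coord.Pt M, ∀ z ∈ e.target, ∀ a b,
    Coord.lieMetric (S.inChart e).g (fun y c => ξ (e.symm y) * (S.inChart e).n y c) z a b
      = 2 * ψ (e.symm z) * (S.inChart e).g z a b

/-- `ξ n` is a proper special conformal Killing vector: `ψ_{;ab} = 0`, and `ψ` is not constant. -/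
structure IsProperSpecialCKV (ξ ψ : M → ℝ) : Prop extends S.IsCKV ξ ψ where
  special : ∀ e ∈ atlas Coord.Pt M, ∀ z ∈ e.target, ∀ a b,
    Coord.hess (S.inChart e).g (ψ ∘ e.symm) z a b = 0
  proper : ¬ ∃ c, ∀ x, ψ x = c

end Magnetofluid

end Spacetime

end

/-! The vector V = ξn is a conformal Killing vector with parallel dψ. The Lie derivative of the
Levi-Civita connection along a conformal Killing vector is δ^c_a ψ_b + δ^c_b ψ_a - g_ab ψ^c; when
ψ_;ab = 0 its covariant curl vanishes, so the Lie derivatives of the curvature and of the Ricci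
tensor vanish too (`lie_ric_special`).

Put E = μ + ½λH² + Λ and β = p_⊥ + ½λH² - Λ. Einstein's equations say R_ab = (β + E)(u_a u_b - n_a
n_b) + E g_ab: the mixed Ricci tensor is -β on the span of u and n, and E on the screen. Since u is
an eigenvector, invariance of R_ab gives ξβ* = -2ψβ (`lie_uu`); since the trace is 2E - 2β, it also
gives ξ(E - β)* = -2ψ(E - β) (`lie_scalar`). Hence ξE* = -2ψE. On the other hand, the contracted
Bianchi identity along n, with the values ξn^a_;a = 3ψ and ξn_{a;b}u^a u^b = -ψ read off from the
conformal Killing equation, gives ξE* = -2ψ(E + β) (`string_bianchi`). Therefore ψβ = 0.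

Maxwell's equation F_[ab;c] = 0 states that the bivector H(n^k u^l - n^l u^k) is divergence free.
Its u component is ξH* = -2ψH, so H* ≠ 0 forces ψ ≠ 0 and then β = 0. This is (a), with R = 2E. The
quotient E/H is constant along n because E and H satisfy the same equation there. It is constant
along u because the Bianchi identity along u and the n component of Maxwell's equation give E and H
the same logarithmic derivative (`conservation`).

The first two equations in (c) restate these two laws. The others are first-order identities at a
point: projections of the conformal Killing equation and of Maxwell's equation, and, for e and ℛ^a,
contractions of the alternating symbol in which repeated vectors cancel (`charge_eq`,
`conduction_H`, `screenRotVec_eq`).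

All differential geometry is done algebraically. Smooth functions on the image of a chart form a
commutative ℝ-algebra with four commuting derivations, tensors are matrices over it, and covariant
differentiation becomes matrix algebra. Evaluation at a point, an algebra homomorphism, returns to
components. -/

open scoped Matrix

set_option linter.unusedSectionVars false

noncomputable section

/-! ## The Levi-Civita connection over a ring with commuting derivations -/

namespace DiffRing

variable {ι A : Type*} [Fintype ι] [DecidableEq ι] [CommRing A] [Algebra ℝ A]

section MapDeriv

variable (d : Derivation ℝ A A)

theorem map_mul (M N : Matrix ι ι A) : (M * N).map d = M.map d * N + M * N.map d := by
  ext i j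
  simp only [Matrix.map_apply, Matrix.mul_apply, map_sum, Derivation.leibniz, Matrix.add_apply,
    smul_eq_mul, ← Finset.sum_add_distrib]
  exact Finset.sum_congr rfl fun k _ => by ring

theorem map_add (M N : Matrix ι ι A) : (M + N).map d = M.map d + N.map d := by
  ext i j; simp

theorem map_sub (M N : Matrix ι ι A) : (M - N).map d = M.map d - N.map d := by
  ext i j; simp

theorem map_smul (f : A) (M : Matrix ι ι A) : (f • M).map d = d f • M + f • M.map d := by
  ext i j
  simp only [Matrix.map_apply, Matrix.smul_apply, smul_eq_mul, Derivation.leibniz,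
    Matrix.add_apply]
  ring

theorem map_sum (s : Finset ι) (M : ι → Matrix ι ι A) :
    (∑ k ∈ s, M k).map d = ∑ k ∈ s, (M k).map d := by
  ext i j
  simp [Matrix.sum_apply]

theorem map_transpose (M : Matrix ι ι A) : Mᵀ.map d = (M.map d)ᵀ := rfl

end MapDeriv

/-- Commuting partial derivatives. -/
def Commuting (D : ι → Derivation ℝ A A) : Prop := ∀ a b f, D a (D b f) = D b (D a f)

theorem Commuting.map {D : ι → Derivation ℝ A A} (hD : Commuting D) (a b : ι)
    (M : Matrix ι ι A) : (M.map (D a)).map (D b) = (M.map (D b)).map (D a) := by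
  ext i j; exact hD b a _

variable (D : ι → Derivation ℝ A A)

/-- The connection with matrices `(Γ_b)^c_a` is the Levi-Civita connection of the metric `G` with
inverse `Gi`. -/
structure LeviCivita (G Gi : Matrix ι ι A) (Γ : ι → Matrix ι ι A) : Prop where
  symm : Gᵀ = G
  inv : G * Gi = 1
  torsion : ∀ a b c, Γ b c a = Γ a c b
  compat : ∀ b, G.map (D b) = (Γ b)ᵀ * G + G * Γ b

/-- The curvature `∂_b Γ_c - ∂_c Γ_b + [Γ_b, Γ_c]`. -/
def curv (Γ : ι → Matrix ι ι A) (b c : ι) : Matrix ι ι A :=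
  (Γ c).map (D b) - (Γ b).map (D c) + Γ b * Γ c - Γ c * Γ b

/-- The covariant derivative of a field of endomorphisms. -/
def covEnd (Γ : ι → Matrix ι ι A) (b : ι) (M : Matrix ι ι A) : Matrix ι ι A :=
  M.map (D b) + Γ b * M - M * Γ b

/-- The Ricci tensor. -/
def ric (Γ : ι → Matrix ι ι A) : Matrix ι ι A :=
  Matrix.of fun a c => ∑ b, curv D Γ b c b a

/-- The covariant derivative `V^a_{;b}`. -/
def nabla (Γ : ι → Matrix ι ι A) (V : ι → A) : Matrix ι ι A :=
  Matrix.of fun a b => D b (V a) + ∑ c, Γ b a c * V c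

/-- The Jacobian matrix `∂_b V^a`. -/
def jac (V : ι → A) : Matrix ι ι A := Matrix.of fun a b => D b (V a)

variable {D} {G Gi : Matrix ι ι A} {Γ : ι → Matrix ι ι A}

/-- The Jacobi identity for the operators ∂_b + Γ_b. It needs neither a metric nor vanishing
torsion: once the second derivatives commute, the rest is an identity between noncommuting matrices.
-/
theorem bianchi (hD : Commuting D) (e b c : ι) :
    covEnd D Γ e (curv D Γ b c) + covEnd D Γ b (curv D Γ c e) + covEnd D Γ c (curv D Γ e b) = 0 := by
  simp only [covEnd, curv, map_add, map_sub, map_mul]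
  rw [hD.map e b, hD.map e c, hD.map b c]
  noncomm_ring

theorem curv_swap (b c : ι) : curv D Γ b c = -curv D Γ c b := by
  simp only [curv]; noncomm_ring

theorem LeviCivita.inv' (h : LeviCivita D G Gi Γ) : Gi * G = 1 :=
  mul_eq_one_comm.mp h.inv

theorem LeviCivita.inv_symm (h : LeviCivita D G Gi Γ) : Giᵀ = Gi := by
  have h1 : Giᵀ * G = 1 := by
    have := congrArg Matrix.transpose h.inv
    rwa [Matrix.transpose_mul, h.symm, Matrix.transpose_one] at this
  calc Giᵀ = Giᵀ * (G * Gi) := by rw [h.inv, mul_one]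
    _ = Gi := by rw [← mul_assoc, h1, one_mul]

/-- The compatibility equation is differentiated a second time. Second derivatives of `G` commute,
and the difference of the two orders is exactly the symmetric part of the lowered curvature. -/
theorem LeviCivita.curv_antisymm (hD : Commuting D) (h : LeviCivita D G Gi Γ) (b c : ι) :
    G * curv D Γ b c + (curv D Γ b c)ᵀ * G = 0 := by
  have h1 : (G.map (D b)).map (D c) = (G.map (D c)).map (D b) := hD.map b c G
  rw [h.compat b, h.compat c] at h1
  simp only [map_add, map_mul, map_transpose, h.compat] at h1
  simp only [curv, Matrix.transpose_add, Matrix.transpose_sub, Matrix.transpose_mul]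
  rw [← sub_eq_zero] at h1
  rw [← neg_eq_zero, ← h1]
  noncomm_ring

theorem LeviCivita.compat_inv (h : LeviCivita D G Gi Γ) (b : ι) :
    Gi.map (D b) = -(Γ b * Gi) - Gi * (Γ b)ᵀ := by
  have h1 : (G * Gi).map (D b) = 0 := by
    rw [h.inv]; ext i j; simp [Matrix.one_apply, apply_ite]
  rw [map_mul, h.compat] at h1
  have h2 : Gi * (((Γ b)ᵀ * G + G * Γ b) * Gi + G * Gi.map (D b)) = 0 := by rw [h1, mul_zero]
  have h3 : Gi * (((Γ b)ᵀ * G + G * Γ b) * Gi + G * Gi.map (D b))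
      = Gi * (Γ b)ᵀ * (G * Gi) + (Gi * G) * (Γ b * Gi) + (Gi * G) * Gi.map (D b) := by
    noncomm_ring
  rw [h3, h.inv, h.inv', mul_one, one_mul, one_mul] at h2
  rw [← sub_eq_zero, ← h2]; noncomm_ring

/-- The curvature with the second index raised. -/
theorem LeviCivita.curv_raised_antisymm (hD : Commuting D) (h : LeviCivita D G Gi Γ) (b c : ι) :
    (curv D Γ b c * Gi)ᵀ = -(curv D Γ b c * Gi) := by
  have h1 := h.curv_antisymm hD b c
  have h2 : Gi * (G * curv D Γ b c + (curv D Γ b c)ᵀ * G) * Gi = 0 := by rw [h1]; simp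
  have h3 : Gi * (G * curv D Γ b c + (curv D Γ b c)ᵀ * G) * Gi
      = (Gi * G) * curv D Γ b c * Gi + Gi * (curv D Γ b c)ᵀ * (G * Gi) := by noncomm_ring
  rw [h3, h.inv, h.inv', mul_one, one_mul] at h2
  rw [Matrix.transpose_mul, h.inv_symm]
  exact eq_neg_of_add_eq_zero_right h2

/-- Raising an index commutes with covariant differentiation, the inverse metric being parallel. The
Bianchi identity can thus be used for the raised curvature, where the antisymmetry is that of a
matrix. -/
theorem LeviCivita.covEnd_raised (h : LeviCivita D G Gi Γ) (b : ι) (M : Matrix ι ι A) :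
    covEnd D Γ b M * Gi = (M * Gi).map (D b) + Γ b * (M * Gi) + M * Gi * (Γ b)ᵀ := by
  rw [map_mul, h.compat_inv, covEnd]; noncomm_ring

/-- The contracted second Bianchi identity `2 ∇_b R^b_e = ∂_e R`. -/
theorem LeviCivita.contracted_bianchi (hD : Commuting D) (h : LeviCivita D G Gi Γ) (e : ι) :
    D e (∑ c, ∑ a, Gi c a * ric D Γ a c) + 2 * ∑ c, ∑ f, Γ e c f * (Gi * ric D Γ) f c
      = 2 * (∑ b, D b ((Gi * ric D Γ) b e) + ∑ b, ∑ f, Γ b b f * (Gi * ric D Γ) f e) := by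
  -- The raised curvature is antisymmetric in its form indices (`hs`) and as a matrix (`ha`). The
  -- contraction uses these two symmetries; the pair symmetry of the Riemann tensor is not needed.
  set S : ι → ι → Matrix ι ι A := fun b c => curv D Γ b c * Gi with hS
  have hQ : ∀ a c, (Gi * ric D Γ) a c = ∑ b, S b c b a := by
    intro a c
    simp only [hS, Matrix.mul_apply, ric, Matrix.of_apply, Finset.mul_sum]
    rw [Finset.sum_comm]
    refine Finset.sum_congr rfl fun b _ => Finset.sum_congr rfl fun f _ => ?_
    rw [mul_comm, ← congrFun (congrFun h.inv_symm f) a, Matrix.transpose_apply]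
  have hs : ∀ b c i j, S b c i j = -S c b i j := by
    intro b c i j
    simp only [hS]; rw [curv_swap b c, neg_mul, Matrix.neg_apply]
  have ha : ∀ b c i j, S b c i j = -S b c j i := by
    intro b c i j
    have := congrFun (congrFun (h.curv_raised_antisymm hD b c) j) i
    rwa [Matrix.transpose_apply, Matrix.neg_apply] at this
  have hB : ∀ b c, (S b c).map (D e) + Γ e * S b c + S b c * (Γ e)ᵀ
      + ((S c e).map (D b) + Γ b * S c e + S c e * (Γ b)ᵀ)
      + ((S e b).map (D c) + Γ c * S e b + S e b * (Γ c)ᵀ) = 0 := by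
    intro b c
    have := congrArg (· * Gi) (bianchi (Γ := Γ) hD e b c)
    simpa only [add_mul, zero_mul, h.covEnd_raised] using this
  have hR : ∑ c, ∑ a, Gi c a * ric D Γ a c = ∑ c, ∑ b, S b c b c := by
    refine Finset.sum_congr rfl fun c _ => ?_
    rw [← hQ, Matrix.mul_apply]
  -- The Bianchi identity contracted twice, b with the row and c with the column, gives nine sums.
  -- `t1` is the derivative of the scalar, `t4` and `t7` are each minus the divergence, `t2`, `t3`,
  -- `t5`, `t9` are its Christoffel terms, and `t6`, `t8` vanish as an antisymmetric factor meets a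
  -- torsion-free one.
  have key : ∑ c, ∑ b, (((S b c).map (D e) + Γ e * S b c + S b c * (Γ e)ᵀ
      + ((S c e).map (D b) + Γ b * S c e + S c e * (Γ b)ᵀ)
      + ((S e b).map (D c) + Γ c * S e b + S e b * (Γ c)ᵀ)) b c) = 0 := by
    refine Finset.sum_eq_zero fun c _ => Finset.sum_eq_zero fun b _ => ?_
    exact congrFun (congrFun (hB b c) b) c
  simp only [Matrix.add_apply, Matrix.map_apply, Matrix.mul_apply, Matrix.transpose_apply,
    Finset.sum_add_distrib] at key
  have t1 : ∑ c, ∑ b, D e (S b c b c) = D e (∑ c, ∑ a, Gi c a * ric D Γ a c) := by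
    rw [hR]; simp only [_root_.map_sum]
  have t2 : ∑ c, ∑ b, ∑ f, Γ e b f * S b c f c = ∑ c, ∑ f, Γ e c f * (Gi * ric D Γ) f c := by
    simp only [hQ, Finset.mul_sum]
    rw [Finset.sum_comm]
    refine Finset.sum_congr rfl fun b _ => ?_
    rw [Finset.sum_comm]
    refine Finset.sum_congr rfl fun f _ => Finset.sum_congr rfl fun c _ => ?_
    rw [hs b c, ha c b, neg_neg]
  have t3 : ∑ c, ∑ b, ∑ f, S b c b f * Γ e c f = ∑ c, ∑ f, Γ e c f * (Gi * ric D Γ) f c := by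
    simp only [hQ, Finset.mul_sum]
    refine Finset.sum_congr rfl fun c _ => ?_
    rw [Finset.sum_comm]
    exact Finset.sum_congr rfl fun f _ => Finset.sum_congr rfl fun b _ => mul_comm _ _
  have t4 : ∑ c, ∑ b, D b (S c e b c) = -∑ b, D b ((Gi * ric D Γ) b e) := by
    simp only [hQ, _root_.map_sum]
    rw [Finset.sum_comm]
    simp only [← Finset.sum_neg_distrib]
    refine Finset.sum_congr rfl fun b _ => Finset.sum_congr rfl fun c _ => ?_
    rw [ha, map_neg]
  have t5 : ∑ c, ∑ b, ∑ f, Γ b b f * S c e f c = -∑ b, ∑ f, Γ b b f * (Gi * ric D Γ) f e := by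
    simp only [hQ, Finset.mul_sum, ← Finset.sum_neg_distrib]
    rw [Finset.sum_comm]
    refine Finset.sum_congr rfl fun b _ => ?_
    rw [Finset.sum_comm]
    refine Finset.sum_congr rfl fun f _ => Finset.sum_congr rfl fun c _ => ?_
    rw [ha, mul_neg]
  have antizero : ∀ (F T : ι → ι → A), (∀ i j, F i j = -F j i) → (∀ i j, T i j = T j i) →
      ∑ i, ∑ j, F i j * T i j = 0 := by
    intro F T hF hT
    have h1 : ∑ i, ∑ j, F i j * T i j = -∑ i, ∑ j, F i j * T i j := by
      conv_lhs => rw [Finset.sum_comm]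
      simp only [← Finset.sum_neg_distrib]
      refine Finset.sum_congr rfl fun i _ => Finset.sum_congr rfl fun j _ => ?_
      rw [hF, hT, neg_mul]
    have h2 : (2 : ℝ) • ∑ i, ∑ j, F i j * T i j = 0 := by
      rw [two_smul]; nth_rewrite 1 [h1]; exact neg_add_cancel _
    have h3 := congrArg (fun x => (1 / 2 : ℝ) • x) h2
    simpa [smul_smul] using h3
  have t6 : ∑ c, ∑ b, ∑ f, S c e b f * Γ b c f = 0 := by
    refine Finset.sum_eq_zero fun c _ => ?_
    exact antizero (fun b f => S c e b f) (fun b f => Γ b c f) (fun b f => ha _ _ _ _)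
      (fun b f => h.torsion _ _ _)
  have t7 : ∑ c, ∑ b, D c (S e b b c) = -∑ b, D b ((Gi * ric D Γ) b e) := by
    simp only [hQ, _root_.map_sum, ← Finset.sum_neg_distrib]
    refine Finset.sum_congr rfl fun b _ => Finset.sum_congr rfl fun c _ => ?_
    rw [hs, map_neg]
  have t8 : ∑ c, ∑ b, ∑ f, Γ c b f * S e b f c = 0 := by
    rw [Finset.sum_comm]
    refine Finset.sum_eq_zero fun b _ => ?_
    have := antizero (fun c f => S e b f c) (fun c f => Γ c b f) (fun b f => ha _ _ _ _)
      (fun b f => h.torsion _ _ _)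
    simpa only [mul_comm] using this
  have t9 : ∑ c, ∑ b, ∑ f, S e b b f * Γ c c f = -∑ b, ∑ f, Γ b b f * (Gi * ric D Γ) f e := by
    simp only [hQ, Finset.mul_sum, ← Finset.sum_neg_distrib]
    refine Finset.sum_congr rfl fun c _ => ?_
    rw [Finset.sum_comm]
    refine Finset.sum_congr rfl fun f _ => Finset.sum_congr rfl fun b _ => ?_
    rw [hs, neg_mul, mul_comm]
  rw [t1, t2, t3, t4, t5, t6, t7, t8, t9] at key
  linear_combination key

end DiffRing

/-! ### Lie derivatives of the connection, the curvature and the Ricci tensor -/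

namespace DiffRing

variable {ι A : Type*} [Fintype ι] [DecidableEq ι] [CommRing A] [Algebra ℝ A]
variable {D : ι → Derivation ℝ A A} {G Gi : Matrix ι ι A} {Γ : ι → Matrix ι ι A}

theorem covEnd_add (b : ι) (M N : Matrix ι ι A) :
    covEnd D Γ b (M + N) = covEnd D Γ b M + covEnd D Γ b N := by
  simp only [covEnd, map_add]; noncomm_ring

theorem covEnd_sum_smul (b : ι) (f : ι → A) (M : ι → Matrix ι ι A) :
    covEnd D Γ b (∑ d, f d • M d) = ∑ d, D b (f d) • M d + ∑ d, f d • covEnd D Γ b (M d) := by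
  simp only [covEnd, map_sum, map_smul, Finset.mul_sum, Finset.sum_mul, smul_sub, smul_add,
    Finset.sum_add_distrib, Finset.sum_sub_distrib, Matrix.mul_smul, Matrix.smul_mul]
  abel

/-- The Ricci identity: the partial derivatives of `M` cancel and only the commutator with the
curvature is left. -/
theorem covEnd_comm (hD : Commuting D) (b c : ι) (M : Matrix ι ι A) :
    covEnd D Γ b (covEnd D Γ c M) - covEnd D Γ c (covEnd D Γ b M)
      = curv D Γ b c * M - M * curv D Γ b c := by
  simp only [covEnd, curv, map_add, map_sub, map_mul]
  rw [hD.map c b M]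
  noncomm_ring

variable (D) in
/-- The Lie derivative of the connection along `V`. -/
def lieConn (Γ : ι → Matrix ι ι A) (V : ι → A) (b : ι) : Matrix ι ι A :=
  covEnd D Γ b (nabla D Γ V) + ∑ d, V d • curv D Γ d b

/-- Absence of torsion lets `V` be contracted with the form index of the connection. This is what
turns Lie derivatives written with partial derivatives into covariant ones and back. -/
theorem LeviCivita.nabla_eq (h : LeviCivita D G Gi Γ) (V : ι → A) :
    nabla D Γ V = jac D V + ∑ d, V d • Γ d := by
  ext a b
  simp only [nabla, jac, Matrix.add_apply, Matrix.of_apply, Matrix.sum_apply, Matrix.smul_apply,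
    smul_eq_mul]
  congr 1
  exact Finset.sum_congr rfl fun d _ => by rw [h.torsion b d a, mul_comm]

/-- The covariant definition hides this symmetry. Expanded in partial derivatives, the terms are
symmetric in a and b by commutation of derivatives and vanishing torsion. -/
theorem LeviCivita.lieConn_symm (hD : Commuting D) (h : LeviCivita D G Gi Γ) (V : ι → A)
    (a b c : ι) : lieConn D Γ V b c a = lieConn D Γ V a c b := by
  have key : ∀ a b, lieConn D Γ V b c a
      = D b (D a (V c)) + ∑ d, (V d * D d (Γ b c a))
        + (∑ d, D b (V d) * Γ a c d + ∑ d, D a (V d) * Γ b c d)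
        - ∑ d, D d (V c) * Γ b d a := by
    intro a b
    have h0 : lieConn D Γ V b = (jac D V).map (D b) + Γ b * jac D V - jac D V * Γ b
        + ∑ d, D b (V d) • Γ d + ∑ d, V d • (Γ b).map (D d) := by
      have h1 : ∑ d, V d • (Γ b).map (D d)
          = ∑ d, V d • covEnd D Γ b (Γ d) + ∑ d, V d • curv D Γ d b := by
        rw [← Finset.sum_add_distrib]
        refine Finset.sum_congr rfl fun d _ => ?_
        rw [← smul_add, covEnd, curv]
        congr 1
        noncomm_ring
      rw [lieConn, h.nabla_eq, covEnd_add, covEnd_sum_smul, h1, covEnd]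
      abel
    rw [h0]
    simp only [jac, Matrix.add_apply, Matrix.sub_apply, Matrix.map_apply, Matrix.of_apply,
      Matrix.mul_apply, Matrix.sum_apply, Matrix.smul_apply, smul_eq_mul]
    have e1 : ∑ d, D b (V d) * Γ d c a = ∑ d, D b (V d) * Γ a c d :=
      Finset.sum_congr rfl fun d _ => by rw [h.torsion a d c]
    have e2 : ∑ d, Γ b c d * D a (V d) = ∑ d, D a (V d) * Γ b c d :=
      Finset.sum_congr rfl fun d _ => mul_comm _ _
    rw [e1, e2]; ring
  rw [key a b, key b a, hD b a]
  simp only [h.torsion a b]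
  ring

/-- The Lie derivative of the curvature, expressed by that of the connection. -/
theorem covEnd_lieConn (hD : Commuting D) (V : ι → A) (b c : ι) :
    covEnd D Γ b (lieConn D Γ V c) - covEnd D Γ c (lieConn D Γ V b)
      = ∑ d, V d • covEnd D Γ d (curv D Γ b c)
        + (curv D Γ b c * nabla D Γ V - nabla D Γ V * curv D Γ b c)
        + ∑ d, D b (V d) • curv D Γ d c + ∑ d, D c (V d) • curv D Γ b d := by
  simp only [lieConn, covEnd_add, covEnd_sum_smul]
  -- The second Bianchi identity trades the derivative of the curvature along `V` for derivatives in
  -- the directions b and c, which the left side produces.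
  have hb : ∀ d, covEnd D Γ d (curv D Γ b c)
      = covEnd D Γ b (curv D Γ d c) - covEnd D Γ c (curv D Γ d b) := by
    intro d
    have h1 := bianchi (Γ := Γ) hD d b c
    have h2 : covEnd D Γ b (curv D Γ c d) = -covEnd D Γ b (curv D Γ d c) := by
      rw [curv_swap c d]; simp only [covEnd]
      ext i j; simp; abel
    rw [h2] at h1
    rw [← sub_eq_zero, ← h1]; abel
  have hs : ∑ d, D c (V d) • curv D Γ b d = -∑ d, D c (V d) • curv D Γ d b := by
    rw [← Finset.sum_neg_distrib]
    exact Finset.sum_congr rfl fun d _ => by rw [curv_swap b d, smul_neg]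
  simp only [hb, smul_sub, Finset.sum_sub_distrib]
  rw [hs, ← covEnd_comm hD]
  abel

/-- If the Lie derivative of the curvature vanishes, so does that of the Ricci tensor. -/
theorem LeviCivita.lie_ric (h : LeviCivita D G Gi Γ) (V : ι → A)
    (hV : ∀ b c, ∑ d, V d • covEnd D Γ d (curv D Γ b c)
        + (curv D Γ b c * nabla D Γ V - nabla D Γ V * curv D Γ b c)
        + ∑ d, D b (V d) • curv D Γ d c + ∑ d, D c (V d) • curv D Γ b d = 0) :
    ∑ d, V d • (ric D Γ).map (D d) + (ric D Γ * jac D V + (jac D V)ᵀ * ric D Γ) = 0 := by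
  -- The Christoffel terms of the derivative along `V` cancel against those in the commutator with
  -- `nabla`, so the covariant expression is the Lie derivative with partial derivatives.
  have h0 : ∀ b c, ∑ d, V d • (curv D Γ b c).map (D d)
        + (curv D Γ b c * jac D V - jac D V * curv D Γ b c)
        + ∑ d, D b (V d) • curv D Γ d c + ∑ d, D c (V d) • curv D Γ b d = 0 := by
    intro b c
    rw [← hV b c, h.nabla_eq]
    simp only [covEnd, smul_add, smul_sub, Finset.sum_add_distrib, Finset.sum_sub_distrib, mul_add,
      add_mul, Finset.mul_sum, Finset.sum_mul, Matrix.mul_smul, Matrix.smul_mul]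
    abel
  ext a c
  have key : ∑ b, (∑ d, V d • (curv D Γ b c).map (D d)
        + (curv D Γ b c * jac D V - jac D V * curv D Γ b c)
        + ∑ d, D b (V d) • curv D Γ d c + ∑ d, D c (V d) • curv D Γ b d) b a = 0 :=
    Finset.sum_eq_zero fun b _ => by rw [h0]; rfl
  simp only [jac, Matrix.add_apply, Matrix.sub_apply, Matrix.map_apply, Matrix.of_apply,
    Matrix.mul_apply, Matrix.sum_apply, Matrix.smul_apply, smul_eq_mul, Finset.sum_add_distrib,
    Finset.sum_sub_distrib] at key
  -- In the contraction, the Jacobian acting on the upper index cancels the Jacobian acting on the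
  -- form index contracted with it.
  have e1 : ∑ b, ∑ d, D d (V b) * curv D Γ b c d a = ∑ b, ∑ d, D b (V d) * curv D Γ d c b a :=
    Finset.sum_comm
  simp only [ric, jac, Matrix.add_apply, Matrix.map_apply, Matrix.of_apply, Matrix.transpose_apply,
    Matrix.mul_apply, Matrix.sum_apply, Matrix.smul_apply, smul_eq_mul, Matrix.zero_apply,
    Finset.mul_sum, Finset.sum_mul, _root_.map_sum]
  have e2 : ∑ d, ∑ b, V d * D d (curv D Γ b c b a) = ∑ b, ∑ d, V d * D d (curv D Γ b c b a) :=
    Finset.sum_comm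
  have e3 : ∑ d, ∑ b, curv D Γ b d b a * D c (V d) = ∑ b, ∑ d, D c (V d) * curv D Γ b d b a := by
    rw [Finset.sum_comm]
    exact Finset.sum_congr rfl fun b _ => Finset.sum_congr rfl fun d _ => mul_comm _ _
  have e4 : ∑ d, ∑ b, D a (V d) * curv D Γ b c b d = ∑ b, ∑ d, curv D Γ b c b d * D a (V d) := by
    rw [Finset.sum_comm]
    exact Finset.sum_congr rfl fun b _ => Finset.sum_congr rfl fun d _ => mul_comm _ _
  rw [e2, e3, e4]
  linear_combination key + e1

/-- The Lie derivative of the metric, with the covariant derivative. -/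
theorem LeviCivita.lie_metric (h : LeviCivita D G Gi Γ) (V : ι → A) :
    ∑ d, V d • G.map (D d) + (G * jac D V + (jac D V)ᵀ * G)
      = G * nabla D Γ V + (nabla D Γ V)ᵀ * G := by
  rw [h.nabla_eq]
  simp only [h.compat, Matrix.transpose_add, Matrix.transpose_sum, Matrix.transpose_smul, smul_add,
    Finset.sum_add_distrib, mul_add, add_mul, Finset.mul_sum, Finset.sum_mul, Matrix.mul_smul,
    Matrix.smul_mul]
  abel

/-- The element 2 is invertible in any ℝ-algebra. -/
theorem two_cancel {x y : A} (h : 2 * x = 2 * y) : x = y := by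
  have h2 : (2 : ℝ) • x = (2 : ℝ) • y := by simpa only [two_smul, two_mul] using h
  simpa [smul_smul] using congrArg (fun x => (1 / 2 : ℝ) • x) h2

/-- The Lie derivative of the connection along a conformal Killing vector, lowered. -/
theorem LeviCivita.lieConn_ckv (hD : Commuting D) (h : LeviCivita D G Gi Γ) {V : ι → A} {ψ : A}
    (hV : G * nabla D Γ V + (nabla D Γ V)ᵀ * G = (2 * ψ) • G) (b d a : ι) :
    (G * lieConn D Γ V b) d a = D b ψ * G d a + D a ψ * G d b - D d ψ * G b a := by
  have hGs : ∀ i j, G i j = G j i := fun i j => by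
    conv_lhs => rw [← h.symm, Matrix.transpose_apply]
  have sym : ∀ b d a, (G * lieConn D Γ V b) d a = (G * lieConn D Γ V a) d b := by
    intro b d a
    simp only [Matrix.mul_apply]
    exact Finset.sum_congr rfl fun c _ => by rw [h.lieConn_symm hD]
  -- The covariant derivative of the conformal Killing equation. The curvature part of `lieConn`
  -- does not contribute, because the lowered curvature is antisymmetric.
  have met : ∀ b, G * lieConn D Γ V b + (lieConn D Γ V b)ᵀ * G = (2 * D b ψ) • G := by
    intro b
    have h1 := congrArg (fun M => M.map (D b)) hV
    simp only [map_add, map_mul, map_smul, map_transpose, h.compat] at h1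
    have h2 : G * lieConn D Γ V b + (lieConn D Γ V b)ᵀ * G
        = (G * covEnd D Γ b (nabla D Γ V) + (covEnd D Γ b (nabla D Γ V))ᵀ * G)
          + ∑ d, V d • (G * curv D Γ d b + (curv D Γ d b)ᵀ * G) := by
      simp only [lieConn, Matrix.transpose_add, Matrix.transpose_sum, Matrix.transpose_smul,
        mul_add, add_mul, Finset.mul_sum, Finset.sum_mul, Matrix.mul_smul, Matrix.smul_mul,
        smul_add, Finset.sum_add_distrib]
      abel
    rw [h2]
    simp only [h.curv_antisymm hD, smul_zero, Finset.sum_const_zero, add_zero]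
    have h3 : D b (2 * ψ) = 2 * D b ψ := by rw [two_mul, two_mul, _root_.map_add]
    rw [h3] at h1
    have h4 : (2 * D b ψ) • G = (2 * D b ψ) • G + (2 * ψ) • ((Γ b)ᵀ * G + G * Γ b)
        - (Γ b)ᵀ * ((2 * ψ) • G) - ((2 * ψ) • G) * Γ b := by
      simp only [smul_add, Matrix.mul_smul, Matrix.smul_mul]; abel
    rw [h4, ← h1, ← hV]
    simp only [covEnd, Matrix.transpose_add, Matrix.transpose_sub, Matrix.transpose_mul]
    noncomm_ring
  have met' : ∀ b d a, (G * lieConn D Γ V b) d a + (G * lieConn D Γ V b) a d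
      = 2 * D b ψ * G d a := by
    intro b d a
    have h1 := congrFun (congrFun (met b) d) a
    have h2 : ((lieConn D Γ V b)ᵀ * G) d a = (G * lieConn D Γ V b) a d := by
      rw [← Matrix.transpose_apply (G * lieConn D Γ V b), Matrix.transpose_mul, h.symm]
    rw [Matrix.add_apply, h2, Matrix.smul_apply, smul_eq_mul] at h1
    exact h1
  -- Koszul's argument: a quantity symmetric in one pair of indices, with known symmetrisation in
  -- another pair, is determined by adding two index permutations and subtracting the third.
  apply two_cancel
  have a1 := met' b d a
  have a2 := met' a d b
  have a3 := met' d b a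
  rw [sym b a d] at a1
  rw [sym a b d, sym a d b] at a2
  rw [hGs d b] at *
  linear_combination a1 + a2 - a3

/-- Along a special conformal Killing vector the Lie derivative of the curvature vanishes. -/
theorem LeviCivita.lie_curv_special (hD : Commuting D) (h : LeviCivita D G Gi Γ) {V : ι → A}
    {ψ : A} (hV : G * nabla D Γ V + (nabla D Γ V)ᵀ * G = (2 * ψ) • G)
    (hψ : ∀ a b, D b (D a ψ) = ∑ c, Γ b c a * D c ψ) (b c : ι) :
    covEnd D Γ b (lieConn D Γ V c) - covEnd D Γ c (lieConn D Γ V b) = 0 := by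
  have hmul : ∀ b M, G * covEnd D Γ b M = (G * M).map (D b) - (Γ b)ᵀ * (G * M) - G * M * Γ b := by
    intro b M; rw [map_mul, h.compat, covEnd]; noncomm_ring
  have hGs : ∀ i j, G i j = G j i := fun i j => by
    conv_lhs => rw [← h.symm, Matrix.transpose_apply]
  have hG : ∀ b i j, D b (G i j) = ∑ f, Γ b f i * G f j + ∑ f, G i f * Γ b f j := by
    intro b i j
    exact congrFun (congrFun (h.compat b) i) j
  -- `covEnd` does not act on the form index c. As g and dψ are parallel, all that is left is the
  -- Christoffel term of that index, which is symmetric in b and c because the torsion vanishes.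
  have key : ∀ b c d a, (G * covEnd D Γ b (lieConn D Γ V c)) d a
      = (∑ e, Γ b e c * D e ψ) * G d a + D a ψ * (∑ f, Γ b f c * G d f)
        - D d ψ * ∑ f, Γ b f c * G f a := by
    intro b c d a
    rw [hmul]
    have m1 : ∀ M : Matrix ι ι A, ((Γ b)ᵀ * M) d a = ∑ x, Γ b x d * M x a :=
      fun _ => Matrix.mul_apply
    have m2 : ∀ M : Matrix ι ι A, (M * Γ b) d a = ∑ x, M d x * Γ b x a :=
      fun _ => Matrix.mul_apply
    simp only [Matrix.sub_apply, Matrix.map_apply, m1, m2, h.lieConn_ckv hD hV, _root_.map_sub,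
      _root_.map_add, Derivation.leibniz, smul_eq_mul, hψ, hG]
    simp only [mul_add, mul_sub, sub_mul, add_mul, Finset.sum_add_distrib, Finset.sum_sub_distrib]
    have s1 : ∑ x, G d x * Γ b x c = ∑ x, Γ b x c * G d x :=
      Finset.sum_congr rfl fun _ _ => mul_comm _ _
    have q1 : ∑ x, Γ b x d * (D c ψ * G x a) = D c ψ * ∑ x, Γ b x d * G x a := by
      rw [Finset.mul_sum]; exact Finset.sum_congr rfl fun _ _ => by ring
    have q2 : ∑ x, Γ b x d * (D a ψ * G x c) = D a ψ * ∑ x, Γ b x d * G x c := by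
      rw [Finset.mul_sum]; exact Finset.sum_congr rfl fun _ _ => by ring
    have q3 : ∑ x, Γ b x d * (D x ψ * G c a) = G c a * ∑ x, Γ b x d * D x ψ := by
      rw [Finset.mul_sum]; exact Finset.sum_congr rfl fun _ _ => by ring
    have q4 : ∑ x, D c ψ * G d x * Γ b x a = D c ψ * ∑ x, G d x * Γ b x a := by
      rw [Finset.mul_sum]; exact Finset.sum_congr rfl fun _ _ => by ring
    have q5 : ∑ x, D x ψ * G d c * Γ b x a = G d c * ∑ x, Γ b x a * D x ψ := by
      rw [Finset.mul_sum]; exact Finset.sum_congr rfl fun _ _ => by ring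
    have q6 : ∑ x, D d ψ * G c x * Γ b x a = D d ψ * ∑ x, G c x * Γ b x a := by
      rw [Finset.mul_sum]; exact Finset.sum_congr rfl fun _ _ => by ring
    rw [q1, q2, q3, q4, q5, q6, s1]
    ring
  have h0 : G * (covEnd D Γ b (lieConn D Γ V c) - covEnd D Γ c (lieConn D Γ V b)) = 0 := by
    ext d a
    rw [mul_sub, Matrix.sub_apply, key, key]
    simp only [h.torsion c b, sub_self, Matrix.zero_apply]
  calc _ = (Gi * G) * (covEnd D Γ b (lieConn D Γ V c) - covEnd D Γ c (lieConn D Γ V b)) := by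
        rw [h.inv', one_mul]
    _ = 0 := by rw [mul_assoc, h0, mul_zero]

/-- Along a special conformal Killing vector the Lie derivative of the Ricci tensor vanishes. -/
theorem LeviCivita.lie_ric_special (hD : Commuting D) (h : LeviCivita D G Gi Γ) {V : ι → A}
    {ψ : A} (hV : G * nabla D Γ V + (nabla D Γ V)ᵀ * G = (2 * ψ) • G)
    (hψ : ∀ a b, D b (D a ψ) = ∑ c, Γ b c a * D c ψ) :
    ∑ d, V d • (ric D Γ).map (D d) + (ric D Γ * jac D V + (jac D V)ᵀ * ric D Γ) = 0 :=
  h.lie_ric V fun b c => by rw [← covEnd_lieConn hD, h.lie_curv_special hD hV hψ]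

end DiffRing

/-! ### Contractions of Lie derivatives and of the Bianchi identity -/

namespace DiffRing

variable {ι A : Type*} [Fintype ι] [DecidableEq ι] [CommRing A] [Algebra ℝ A]
variable {D : ι → Derivation ℝ A A} {G Gi : Matrix ι ι A} {Γ : ι → Matrix ι ι A}

theorem deriv_dotProduct (d : Derivation ℝ A A) (x y : ι → A) :
    d (x ⬝ᵥ y) = (fun i => d (x i)) ⬝ᵥ y + x ⬝ᵥ fun i => d (y i) := by
  simp only [dotProduct, _root_.map_sum, Derivation.leibniz, smul_eq_mul, ← Finset.sum_add_distrib]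
  exact Finset.sum_congr rfl fun i _ => by ring

theorem deriv_mulVec (d : Derivation ℝ A A) (M : Matrix ι ι A) (x : ι → A) :
    (fun i => d ((M *ᵥ x) i)) = M.map d *ᵥ x + M *ᵥ fun i => d (x i) := by
  ext i
  exact deriv_dotProduct d (M i) x

theorem dot_mulVec_symm {M : Matrix ι ι A} (hM : Mᵀ = M) (x y : ι → A) :
    x ⬝ᵥ M *ᵥ y = y ⬝ᵥ M *ᵥ x := by
  rw [Matrix.dotProduct_mulVec, ← Matrix.mulVec_transpose, hM, dotProduct_comm]

theorem deriv_quadratic (d : Derivation ℝ A A) {M : Matrix ι ι A} (hM : Mᵀ = M) (x : ι → A) :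
    d (x ⬝ᵥ M *ᵥ x) = 2 * ((fun i => d (x i)) ⬝ᵥ M *ᵥ x) + x ⬝ᵥ M.map d *ᵥ x := by
  rw [deriv_dotProduct, deriv_mulVec, dotProduct_add, dot_mulVec_symm hM x]
  ring

/-- Contraction of the Lie derivative of a symmetric tensor twice with the same vector. -/
theorem lie_quadratic (V x : ι → A) {T L : Matrix ι ι A} (hT : Tᵀ = T)
    (hL : ∑ d, V d • T.map (D d) + (T * jac D V + (jac D V)ᵀ * T) = L) :
    ∑ d, V d * D d (x ⬝ᵥ T *ᵥ x) = x ⬝ᵥ L *ᵥ x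
      + 2 * ((fun i => ∑ d, V d * D d (x i) - (jac D V *ᵥ x) i) ⬝ᵥ T *ᵥ x) := by
  have e1 : x ⬝ᵥ (T * jac D V) *ᵥ x = (jac D V *ᵥ x) ⬝ᵥ T *ᵥ x := by
    rw [← Matrix.mulVec_mulVec, dot_mulVec_symm hT]
  have e2 : x ⬝ᵥ ((jac D V)ᵀ * T) *ᵥ x = (jac D V *ᵥ x) ⬝ᵥ T *ᵥ x := by
    rw [← Matrix.mulVec_mulVec, Matrix.dotProduct_mulVec, Matrix.vecMul_transpose]
  have e3 : x ⬝ᵥ (∑ d, V d • T.map (D d)) *ᵥ x = ∑ d, V d * (x ⬝ᵥ T.map (D d) *ᵥ x) := by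
    rw [Matrix.sum_mulVec, dotProduct_sum]
    simp only [Matrix.smul_mulVec, dotProduct_smul, smul_eq_mul]
  -- The vector on the left is the Lie bracket of `V` and `x`.
  have e4 : (fun i => ∑ d, V d * D d (x i) - (jac D V *ᵥ x) i) ⬝ᵥ T *ᵥ x
      = ∑ d, V d * ((fun i => D d (x i)) ⬝ᵥ T *ᵥ x) - (jac D V *ᵥ x) ⬝ᵥ T *ᵥ x := by
    simp only [dotProduct, sub_mul, Finset.sum_sub_distrib, Finset.sum_mul, Finset.mul_sum]
    rw [Finset.sum_comm]
    simp only [mul_assoc]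
  simp only [deriv_quadratic _ hT, mul_add, Finset.sum_add_distrib]
  rw [← hL, Matrix.add_mulVec, Matrix.add_mulVec, dotProduct_add, dotProduct_add, e1, e2, e3, e4,
    mul_sub, Finset.mul_sum]
  simp only [mul_left_comm _ (2 : A)]
  ring

/-- If the Lie derivative of `T` vanishes along a conformal Killing vector, its trace has weight
`-2`. -/
theorem LeviCivita.lie_trace (h : LeviCivita D G Gi Γ) {V : ι → A} {T : Matrix ι ι A} {ψ : A}
    (hG : ∑ d, V d • G.map (D d) + (G * jac D V + (jac D V)ᵀ * G) = (2 * ψ) • G)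
    (hT : ∑ d, V d • T.map (D d) + (T * jac D V + (jac D V)ᵀ * T) = 0) :
    ∑ d, V d * D d (Gi * T).trace = -(2 * ψ) * (Gi * T).trace := by
  have e0 : ∀ d, D d (Gi * T).trace = (Gi.map (D d) * T).trace + (Gi * T.map (D d)).trace := by
    intro d
    rw [← Matrix.trace_add, ← map_mul, Matrix.trace, _root_.map_sum]; rfl
  have e1 : ∀ d, Gi.map (D d) = -(Gi * G.map (D d) * Gi) := by
    intro d
    have h1 : Gi * (G * Gi).map (D d) = 0 := by
      rw [h.inv]
      have : (1 : Matrix ι ι A).map (D d) = 0 := by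
        ext i j; simp [Matrix.one_apply, apply_ite]
      rw [this, mul_zero]
    rw [map_mul, mul_add, ← mul_assoc, ← mul_assoc, h.inv', one_mul] at h1
    exact eq_neg_of_add_eq_zero_right h1
  -- Since the Lie derivative of the inverse is minus its product with that of `G` on both sides,
  -- the inverse metric has weight -2ψ.
  have e2 : ∑ d, V d • Gi.map (D d)
      = -((2 * ψ) • Gi) + jac D V * Gi + Gi * (jac D V)ᵀ := by
    have h1 : ∑ d, V d • Gi.map (D d) = -(Gi * (∑ d, V d • G.map (D d)) * Gi) := by
      simp only [e1, smul_neg, Finset.sum_neg_distrib, Finset.mul_sum, Finset.sum_mul,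
        Matrix.mul_smul, Matrix.smul_mul]
    rw [h1, eq_sub_of_add_eq hG]
    have h2 : Gi * ((2 * ψ) • G - (G * jac D V + (jac D V)ᵀ * G)) * Gi
        = (2 * ψ) • (Gi * G * Gi) - ((Gi * G) * jac D V * Gi
          + Gi * (jac D V)ᵀ * (G * Gi)) := by
      simp only [mul_sub, sub_mul, Matrix.mul_smul, Matrix.smul_mul, mul_add, add_mul, mul_assoc]
    rw [h2, h.inv', h.inv, one_mul, one_mul, mul_one]
    abel
  have e3 : ∑ d, V d * D d (Gi * T).trace
      = ((∑ d, V d • Gi.map (D d)) * T).trace + (Gi * ∑ d, V d • T.map (D d)).trace := by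
    simp only [e0, mul_add, Finset.sum_add_distrib, Finset.sum_mul, Finset.mul_sum,
      Matrix.trace_sum, Matrix.smul_mul, Matrix.mul_smul, Matrix.trace_smul, smul_eq_mul]
  rw [e3, e2, eq_neg_of_add_eq_zero_left hT]
  simp only [mul_neg, add_mul, neg_mul, mul_add, Matrix.trace_add, Matrix.trace_neg,
    Matrix.smul_mul, Matrix.trace_smul, smul_eq_mul]
  -- By cyclicity of the trace the Jacobian terms coming from `Gi` and from `T` cancel, leaving only
  -- the weight.
  have c1 : (jac D V * Gi * T).trace = (Gi * (T * jac D V)).trace := by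
    rw [mul_assoc, Matrix.trace_mul_comm, mul_assoc]
  rw [c1, mul_assoc Gi]
  ring

theorem trace_nabla_smul (f : A) (V : ι → A) :
    (nabla D Γ (f • V)).trace = ∑ d, V d * D d f + f * (nabla D Γ V).trace := by
  simp only [Matrix.trace, Matrix.diag, nabla, Matrix.of_apply, Pi.smul_apply, smul_eq_mul,
    Derivation.leibniz, Finset.sum_add_distrib, mul_add, Finset.mul_sum]
  have : ∑ x, ∑ c, Γ x x c * (f * V c) = ∑ x, ∑ c, f * (Γ x x c * V c) :=
    Finset.sum_congr rfl fun _ _ => Finset.sum_congr rfl fun _ _ => by ring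
  rw [this]
  ring

/-- The contracted second Bianchi identity, contracted with a vector field. -/
theorem LeviCivita.bianchi_vector (hD : Commuting D) (h : LeviCivita D G Gi Γ) (V : ι → A) :
    ∑ e, V e * D e (Gi * ric D Γ).trace
      = 2 * (nabla D Γ ((Gi * ric D Γ) *ᵥ V)).trace
        - 2 * (Gi * ric D Γ * nabla D Γ V).trace := by
  set Q := Gi * ric D Γ with hQ
  have hR : ∑ c, ∑ a, Gi c a * ric D Γ a c = Q.trace := by
    simp only [hQ, Matrix.trace, Matrix.diag, Matrix.mul_apply]
  have hb := fun e => h.contracted_bianchi hD e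
  rw [hR] at hb
  have h1 : ∑ e, V e * D e Q.trace = 2 * ∑ e, V e * (∑ b, D b (Q b e) + ∑ b, ∑ f, Γ b b f * Q f e)
      - 2 * ∑ e, V e * ∑ c, ∑ f, Γ e c f * Q f c := by
    rw [Finset.mul_sum, Finset.mul_sum, ← Finset.sum_sub_distrib]
    exact Finset.sum_congr rfl fun e _ => by linear_combination V e * hb e
  rw [h1]
  simp only [Matrix.trace, Matrix.diag, nabla, Matrix.of_apply, Matrix.mul_apply, Matrix.mulVec,
    dotProduct, _root_.map_sum, Derivation.leibniz, smul_eq_mul, Finset.sum_add_distrib, mul_add,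
    Finset.mul_sum]
  have q1 : ∑ e, ∑ b, 2 * (V e * D b (Q b e)) = ∑ b, ∑ e, 2 * (V e * D b (Q b e)) :=
    Finset.sum_comm
  have q2 : ∑ e, ∑ b, ∑ f, 2 * (V e * (Γ b b f * Q f e))
      = ∑ b, ∑ f, ∑ e, 2 * (Γ b b f * (Q f e * V e)) := by
    rw [Finset.sum_comm]
    refine Finset.sum_congr rfl fun b _ => ?_
    rw [Finset.sum_comm]
    exact Finset.sum_congr rfl fun f _ => Finset.sum_congr rfl fun e _ => by ring
  have q3 : ∑ e, ∑ c, ∑ f, 2 * (V e * (Γ e c f * Q f c))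
      = ∑ f, ∑ c, ∑ e, 2 * (Q f c * (Γ f c e * V e)) := by
    rw [Finset.sum_comm]
    conv_lhs => enter [2, c]; rw [Finset.sum_comm]
    rw [Finset.sum_comm]
    refine Finset.sum_congr rfl fun f _ => Finset.sum_congr rfl fun c _ =>
      Finset.sum_congr rfl fun e _ => ?_
    rw [h.torsion e f c]; ring
  rw [q1, q2, q3]
  ring

/-! ### The Ricci tensor of a string fluid -/

section StringFluid

/-- The Ricci tensor of a string fluid. -/
def stringRic (G : Matrix ι ι A) (u n : ι → A) (β E : A) : Matrix ι ι A :=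
  (β + E) • (Matrix.vecMulVec (G *ᵥ u) (G *ᵥ u) - Matrix.vecMulVec (G *ᵥ n) (G *ᵥ n)) + E • G

variable {u n : ι → A} {β E : A}

theorem stringRic_symm (hG : Gᵀ = G) : (stringRic G u n β E)ᵀ = stringRic G u n β E := by
  simp only [stringRic, Matrix.transpose_add, Matrix.transpose_smul, Matrix.transpose_sub,
    Matrix.transpose_vecMulVec, hG]

theorem stringRic_mulVec (x : ι → A) :
    stringRic G u n β E *ᵥ x = ((β + E) * ((G *ᵥ u) ⬝ᵥ x)) • (G *ᵥ u)
      - ((β + E) * ((G *ᵥ n) ⬝ᵥ x)) • (G *ᵥ n) + E • (G *ᵥ x) := by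
  ext i
  simp only [stringRic, Matrix.add_mulVec, Matrix.smul_mulVec, Matrix.sub_mulVec,
    Matrix.vecMulVec_mulVec, Pi.add_apply, Pi.sub_apply, Pi.smul_apply, smul_eq_mul,
    MulOpposite.smul_eq_mul_unop, MulOpposite.unop_op]
  ring

/-- For orthogonal unit vectors this exhibits the eigenvalues of the mixed Ricci tensor: -β on the
span of u and n, and E on its orthogonal complement. -/
theorem LeviCivita.inv_mul_stringRic (h : LeviCivita D G Gi Γ) :
    Gi * stringRic G u n β E
      = (β + E) • (Matrix.vecMulVec u (G *ᵥ u) - Matrix.vecMulVec n (G *ᵥ n))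
        + E • (1 : Matrix ι ι A) := by
  simp only [stringRic, mul_add, mul_sub, Matrix.mul_smul, Matrix.mul_vecMulVec,
    Matrix.mulVec_mulVec, h.inv', Matrix.one_mulVec]

theorem stringRic_mulVec_u (huu : u ⬝ᵥ G *ᵥ u = -1) (hun : u ⬝ᵥ G *ᵥ n = 0) :
    stringRic G u n β E *ᵥ u = -β • (G *ᵥ u) := by
  rw [stringRic_mulVec, dotProduct_comm, huu, dotProduct_comm, hun]
  ext i; simp; ring

theorem LeviCivita.trace_stringRic (h : LeviCivita D G Gi Γ) :
    (Gi * stringRic G u n β E).trace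
      = (β + E) * (u ⬝ᵥ G *ᵥ u - n ⬝ᵥ G *ᵥ n) + Fintype.card ι * E := by
  rw [h.inv_mul_stringRic]
  simp only [Matrix.trace_add, Matrix.trace_smul, Matrix.trace_sub, Matrix.trace_vecMulVec,
    Matrix.trace_one, smul_eq_mul]
  ring

theorem LeviCivita.trace_stringRic_four {u n : Fin 4 → A} {D : Fin 4 → Derivation ℝ A A}
    {G Gi : Matrix (Fin 4) (Fin 4) A} {Γ : Fin 4 → Matrix (Fin 4) (Fin 4) A}
    (h : LeviCivita D G Gi Γ) (huu : u ⬝ᵥ G *ᵥ u = -1) (hnn : n ⬝ᵥ G *ᵥ n = 1) :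
    (Gi * stringRic G u n β E).trace = 2 * E - 2 * β := by
  rw [h.trace_stringRic, huu, hnn, Fintype.card_fin]
  push_cast; ring

/-- The Lie derivative of `R_{ab} u^a u^b` along a special conformal Killing vector. -/
theorem LeviCivita.lie_uu (hD : Commuting D) (h : LeviCivita D G Gi Γ) {V : ι → A} {ψ : A}
    (hV : ∑ d, V d • G.map (D d) + (G * jac D V + (jac D V)ᵀ * G) = (2 * ψ) • G)
    (hψ : ∀ a b, D b (D a ψ) = ∑ c, Γ b c a * D c ψ)
    (hric : ric D Γ = stringRic G u n β E)
    (huu : u ⬝ᵥ G *ᵥ u = -1) (hun : u ⬝ᵥ G *ᵥ n = 0) :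
    ∑ d, V d * D d β = -(2 * ψ) * β := by
  have hV' := hV
  rw [h.lie_metric] at hV'
  have hL := h.lie_ric_special hD hV' hψ
  rw [hric] at hL
  -- The bracket of `V` and u is unknown. Because u is an eigenvector with eigenvalue -β, the
  -- bracket enters `q1` only through its product with u, and `q2`, the same identity for the
  -- metric, supplies that product.
  have q1 := lie_quadratic V u (stringRic_symm h.symm) hL
  have q2 := lie_quadratic V u h.symm hV
  rw [stringRic_mulVec_u huu hun] at q1
  simp only [dotProduct_smul, huu, smul_eq_mul, Matrix.zero_mulVec, dotProduct_zero, mul_neg,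
    mul_one, neg_mul, neg_neg, Matrix.smul_mulVec] at q1 q2
  have z : ∑ d, V d * D d (-1) = 0 := by simp
  rw [z] at q2
  linear_combination q1 + β * q2

/-- The Lie derivative of the Ricci scalar along a special conformal Killing vector. -/
theorem LeviCivita.lie_scalar (hD : Commuting D) (h : LeviCivita D G Gi Γ) {V : ι → A} {ψ : A}
    (hV : ∑ d, V d • G.map (D d) + (G * jac D V + (jac D V)ᵀ * G) = (2 * ψ) • G)
    (hψ : ∀ a b, D b (D a ψ) = ∑ c, Γ b c a * D c ψ) :
    ∑ d, V d * D d (Gi * ric D Γ).trace = -(2 * ψ) * (Gi * ric D Γ).trace := by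
  have hV' := hV
  rw [h.lie_metric] at hV'
  exact h.lie_trace hV (h.lie_ric_special hD hV' hψ)

/-- The contracted Bianchi identity of a string fluid along a vector field in the span of `u` and
`n`. -/
theorem LeviCivita.string_bianchi {u n V : Fin 4 → A} {D : Fin 4 → Derivation ℝ A A}
    {G Gi : Matrix (Fin 4) (Fin 4) A} {Γ : Fin 4 → Matrix (Fin 4) (Fin 4) A}
    (hD : Commuting D) (h : LeviCivita D G Gi Γ)
    (hric : ric D Γ = stringRic G u n β E)
    (huu : u ⬝ᵥ G *ᵥ u = -1) (hnn : n ⬝ᵥ G *ᵥ n = 1)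
    (hV : (u ⬝ᵥ G *ᵥ V) • u - (n ⬝ᵥ G *ᵥ V) • n = -V) :
    ∑ e, V e * D e E = -(β + E) * ((nabla D Γ V).trace + (G *ᵥ u) ⬝ᵥ nabla D Γ V *ᵥ u
      - (G *ᵥ n) ⬝ᵥ nabla D Γ V *ᵥ n) := by
  have hb := h.bianchi_vector hD V
  -- The span of u and n is an eigenspace for -β, so the divergence of the Ricci flux of `V` is that
  -- of -βV.
  have hQV : (Gi * stringRic G u n β E) *ᵥ V = (-β) • V := by
    rw [h.inv_mul_stringRic]
    have e1 : (G *ᵥ u) ⬝ᵥ V = u ⬝ᵥ G *ᵥ V := by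
      rw [dotProduct_comm, dot_mulVec_symm h.symm]
    have e2 : (G *ᵥ n) ⬝ᵥ V = n ⬝ᵥ G *ᵥ V := by
      rw [dotProduct_comm, dot_mulVec_symm h.symm]
    ext i
    have hi := congrFun hV i
    simp only [Pi.sub_apply, Pi.smul_apply, smul_eq_mul, Pi.neg_apply] at hi
    simp only [Matrix.add_mulVec, Matrix.smul_mulVec, Matrix.sub_mulVec,
      Matrix.vecMulVec_mulVec, Pi.add_apply, Pi.sub_apply, Pi.smul_apply, smul_eq_mul,
      MulOpposite.smul_eq_mul_unop, MulOpposite.unop_op, e1, e2, Matrix.one_mulVec]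
    linear_combination (β + E) * hi
  have htr : (Gi * stringRic G u n β E * nabla D Γ V).trace
      = (β + E) * ((G *ᵥ u) ⬝ᵥ nabla D Γ V *ᵥ u - (G *ᵥ n) ⬝ᵥ nabla D Γ V *ᵥ n)
        + E * (nabla D Γ V).trace := by
    rw [h.inv_mul_stringRic]
    simp only [add_mul, sub_mul, Matrix.smul_mul, Matrix.trace_add, Matrix.trace_smul,
      Matrix.trace_sub, one_mul, smul_eq_mul, Matrix.vecMulVec_mul, Matrix.trace_vecMulVec]
    rw [dotProduct_comm u, dotProduct_comm n, ← Matrix.dotProduct_mulVec,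
      ← Matrix.dotProduct_mulVec]
  rw [hric, hQV, trace_nabla_smul, htr, h.trace_stringRic_four huu hnn] at hb
  have e3 : ∑ e, V e * D e (2 * E - 2 * β)
      = 2 * ∑ e, V e * D e E - 2 * ∑ e, V e * D e β := by
    rw [Finset.mul_sum, Finset.mul_sum, ← Finset.sum_sub_distrib]
    refine Finset.sum_congr rfl fun e _ => ?_
    rw [two_mul, two_mul, _root_.map_sub, _root_.map_add, _root_.map_add]; ring
  have e4 : ∑ d, V d * D d (-β) = -∑ d, V d * D d β := by
    simp
  rw [e3, e4] at hb
  -- The derivative of β appears on both sides, from the scalar 2E - 2β and from the divergence of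
  -- -βV, and cancels. An equation for E alone is left.
  apply two_cancel
  linear_combination hb

end StringFluid

end DiffRing

/-! ## Kinematics at a point -/

namespace Coord

namespace Fields

/-- The first-order identities that the fields of a string fluid satisfy at the point `z`; here
`xi`, `psi` are the values of the norm and of the conformal factor of the conformal Killing vector,
`dxi` and `dH` the gradients of `xi` and of the field strength. -/
structure FirstOrder (S : Fields) (z : Pt) (xi psi : ℝ) (dxi dH : Fin 4 → ℝ) : Prop where
  symm : ∀ a b, S.g z a b = S.g z b a
  det_neg : (S.g z).det < 0
  uu : ∑ a, S.ul z a * S.u z a = -1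
  nn : ∑ a, S.nl z a * S.n z a = 1
  un : ∑ a, S.ul z a * S.n z a = 0
  nu : ∑ a, S.nl z a * S.u z a = 0
  H_pos : 0 < S.H z
  xi_pos : 0 < xi
  du_eq : ∀ a b, S.du z a b = ∑ c, S.g z a c * dVec S.g S.u z c b
  dn_eq : ∀ a b, S.dn z a b = ∑ c, S.g z a c * dVec S.g S.n z c b
  u_du : ∀ b, ∑ a, S.u z a * S.du z a b = 0
  n_dn : ∀ b, ∑ a, S.n z a * S.dn z a b = 0
  n_du : ∀ b, ∑ a, S.n z a * S.du z a b = -∑ a, S.u z a * S.dn z a b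
  ckv : ∀ a b, S.nl z a * dxi b + S.nl z b * dxi a + xi * (S.dn z a b + S.dn z b a)
    = 2 * psi * S.g z a b
  maxwell : ∀ k, (∑ l, dH l * S.u z l) * S.n z k + S.H z * S.nDot z k + S.H z * S.theta z * S.n z k
    - S.H z * S.uStar z k - (∑ l, dH l * S.n z l + S.H z * ∑ l, dVec S.g S.n z l l) * S.u z k = 0

namespace FirstOrder

variable {S : Fields} {z : Pt} {xi psi : ℝ} {dxi dH : Fin 4 → ℝ}

theorem sum_pMix (S : Fields) (z : Pt) (a : Fin 4) (x : Fin 4 → ℝ) :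
    ∑ c, S.pMix z a c * x c
      = x a + S.ul z a * (∑ c, S.u z c * x c) - S.nl z a * ∑ c, S.n z c * x c := by
  simp [pMix, hMix, add_mul, sub_mul, Finset.sum_add_distrib, Finset.sum_sub_distrib,
    Finset.mul_sum, mul_assoc]

theorem sum_hMix (S : Fields) (z : Pt) (a : Fin 4) (x : Fin 4 → ℝ) :
    ∑ c, S.hMix z a c * x c = x a + S.ul z a * (∑ c, S.u z c * x c) := by
  simp [hMix, add_mul, Finset.sum_add_distrib, Finset.mul_sum, mul_assoc]

theorem sum_pUp (S : Fields) (z : Pt) (a : Fin 4) (x : Fin 4 → ℝ) :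
    ∑ c, S.pUp z a c * x c = (∑ c, ginv S.g z a c * x c)
      + S.u z a * (∑ c, S.u z c * x c) - S.n z a * ∑ c, S.n z c * x c := by
  simp [pUp, hUp, add_mul, sub_mul, Finset.sum_add_distrib, Finset.sum_sub_distrib,
    Finset.mul_sum, mul_assoc]

theorem sum_p (S : Fields) (z : Pt) (a : Fin 4) (x : Fin 4 → ℝ) :
    ∑ c, S.p z a c * x c = (∑ c, S.g z a c * x c)
      + S.ul z a * (∑ c, S.ul z c * x c) - S.nl z a * ∑ c, S.nl z c * x c := by
  simp [p, h, add_mul, sub_mul, Finset.sum_add_distrib, Finset.sum_sub_distrib,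
    Finset.mul_sum, mul_assoc]

theorem g_u (F : S.FirstOrder z xi psi dxi dH) (b : Fin 4) :
    ∑ a, S.u z a * S.g z a b = S.ul z b := by
  simp only [ul, lower]
  exact Finset.sum_congr rfl fun a _ => by rw [F.symm, mul_comm]

theorem g_n (F : S.FirstOrder z xi psi dxi dH) (b : Fin 4) :
    ∑ a, S.n z a * S.g z a b = S.nl z b := by
  simp only [nl, lower]
  exact Finset.sum_congr rfl fun a _ => by rw [F.symm, mul_comm]

theorem ginv_g (F : S.FirstOrder z xi psi dxi dH) (a b : Fin 4) :
    ∑ c, ginv S.g z a c * S.g z c b = if a = b then 1 else 0 := by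
  have := Matrix.nonsing_inv_mul (S.g z) (isUnit_iff_ne_zero.mpr F.det_neg.ne)
  rw [← Matrix.one_apply, ← this, Matrix.mul_apply]; rfl

theorem ginv_lower (F : S.FirstOrder z xi psi dxi dH) (x : Fin 4 → ℝ) (a : Fin 4) :
    ∑ c, ginv S.g z a c * ∑ d, S.g z c d * x d = x a := by
  have h1 : (∑ c, ginv S.g z a c * ∑ d, S.g z c d * x d)
      = ∑ d, (∑ c, ginv S.g z a c * S.g z c d) * x d := by
    simp only [Finset.mul_sum, Finset.sum_mul, mul_assoc]
    exact Finset.sum_comm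
  rw [h1]; simp [F.ginv_g]

theorem u_u (F : S.FirstOrder z xi psi dxi dH) : ∑ a, S.u z a * S.ul z a = -1 := by
  rw [← F.uu]; exact Finset.sum_congr rfl fun _ _ => mul_comm _ _

theorem n_n (F : S.FirstOrder z xi psi dxi dH) : ∑ a, S.n z a * S.nl z a = 1 := by
  rw [← F.nn]; exact Finset.sum_congr rfl fun _ _ => mul_comm _ _

theorem n_u (F : S.FirstOrder z xi psi dxi dH) : ∑ a, S.n z a * S.ul z a = 0 := by
  rw [← F.un]; exact Finset.sum_congr rfl fun _ _ => mul_comm _ _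

theorem u_n (F : S.FirstOrder z xi psi dxi dH) : ∑ a, S.u z a * S.nl z a = 0 := by
  rw [← F.nu]; exact Finset.sum_congr rfl fun _ _ => mul_comm _ _

/-- The conformal Killing equation contracted with a vector. -/
theorem ckv_contract (F : S.FirstOrder z xi psi dxi dH) (x : Fin 4 → ℝ) (b : Fin 4) :
    (∑ a, x a * S.nl z a) * dxi b + S.nl z b * (∑ a, x a * dxi a)
      + xi * (∑ a, x a * S.dn z a b + ∑ a, S.dn z b a * x a) = 2 * psi * ∑ a, x a * S.g z a b := by
  have h1 : ∑ a, x a * (S.nl z a * dxi b + S.nl z b * dxi a + xi * (S.dn z a b + S.dn z b a))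
      = ∑ a, x a * (2 * psi * S.g z a b) := Finset.sum_congr rfl fun a _ => by rw [F.ckv]
  rw [Finset.mul_sum, ← Finset.sum_add_distrib, Finset.mul_sum, Finset.mul_sum, Finset.sum_mul,
    ← Finset.sum_add_distrib, ← Finset.sum_add_distrib]
  refine Eq.trans (Finset.sum_congr rfl fun a _ => ?_)
    (h1.trans (Finset.sum_congr rfl fun a _ => ?_)) <;> ring

theorem lower_nStar (F : S.FirstOrder z xi psi dxi dH) (b : Fin 4) :
    ∑ c, S.g z b c * S.nStar z c = ∑ a, S.dn z b a * S.n z a := by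
  simp only [nStar, F.dn_eq, Finset.mul_sum, Finset.sum_mul, mul_assoc]
  exact Finset.sum_comm

theorem lower_nDot (F : S.FirstOrder z xi psi dxi dH) (b : Fin 4) :
    ∑ c, S.g z b c * S.nDot z c = ∑ a, S.dn z b a * S.u z a := by
  simp only [nDot, F.dn_eq, Finset.mul_sum, Finset.sum_mul, mul_assoc]
  exact Finset.sum_comm

theorem lower_uStar (F : S.FirstOrder z xi psi dxi dH) (b : Fin 4) :
    ∑ c, S.g z b c * S.uStar z c = ∑ a, S.du z b a * S.n z a := by
  simp only [uStar, F.du_eq, Finset.mul_sum, Finset.sum_mul, mul_assoc]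
  exact Finset.sum_comm

theorem lower_contract (F : S.FirstOrder z xi psi dxi dH) (x y : Fin 4 → ℝ) :
    ∑ a, (∑ b, S.g z a b * x b) * y a = ∑ b, x b * ∑ a, S.g z b a * y a := by
  simp only [Finset.mul_sum, Finset.sum_mul]
  rw [Finset.sum_comm]
  exact Finset.sum_congr rfl fun a _ => Finset.sum_congr rfl fun b _ => by
    rw [F.symm]; ring

theorem sum_sum_swap (x y : Fin 4 → ℝ) (M : Fin 4 → Fin 4 → ℝ) :
    ∑ a, x a * ∑ b, M a b * y b = ∑ b, (∑ a, x a * M a b) * y b := by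
  simp only [Finset.mul_sum, Finset.sum_mul, mul_assoc]
  exact Finset.sum_comm

/-- `ψ = ξ*`. -/
theorem dxi_n (F : S.FirstOrder z xi psi dxi dH) : ∑ a, S.n z a * dxi a = psi := by
  have h1 : ∑ b, S.n z b * ((∑ a, S.n z a * S.nl z a) * dxi b + S.nl z b * (∑ a, S.n z a * dxi a)
      + xi * (∑ a, S.n z a * S.dn z a b + ∑ a, S.dn z b a * S.n z a))
      = ∑ b, S.n z b * (2 * psi * ∑ a, S.n z a * S.g z a b) :=
    Finset.sum_congr rfl fun b _ => by rw [F.ckv_contract]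
  have h2 : ∑ b, S.n z b * ∑ a, S.dn z b a * S.n z a = 0 := by
    rw [sum_sum_swap]; simp [F.n_dn]
  simp only [F.n_n, F.n_dn, F.g_n, one_mul, zero_add] at h1
  have h3 : ∑ b, S.n z b * (dxi b + S.nl z b * (∑ a, S.n z a * dxi a)
      + xi * ∑ a, S.dn z b a * S.n z a)
      = ∑ b, S.n z b * dxi b + (∑ b, S.n z b * S.nl z b) * (∑ a, S.n z a * dxi a)
        + xi * ∑ b, S.n z b * ∑ a, S.dn z b a * S.n z a := by
    rw [Finset.sum_mul, Finset.mul_sum, ← Finset.sum_add_distrib, ← Finset.sum_add_distrib]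
    exact Finset.sum_congr rfl fun b _ => by ring
  have h4 : ∑ b, S.n z b * (2 * psi * S.nl z b) = 2 * psi * ∑ b, S.n z b * S.nl z b := by
    rw [Finset.mul_sum]; exact Finset.sum_congr rfl fun b _ => by ring
  rw [h3, h4, h2, F.n_n] at h1
  linarith

/-- `ξ n*_b = ψ n_b - ξ_{,b}`. -/
theorem dn_n (F : S.FirstOrder z xi psi dxi dH) (b : Fin 4) :
    xi * ∑ a, S.dn z b a * S.n z a = psi * S.nl z b - dxi b := by
  have h := F.ckv_contract (S.n z) b
  rw [F.n_n, F.dxi_n, F.n_dn, F.g_n] at h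
  linarith

theorem dn_u (F : S.FirstOrder z xi psi dxi dH) (b : Fin 4) :
    xi * ∑ a, S.dn z b a * S.u z a
      = 2 * psi * S.ul z b - S.nl z b * (∑ a, S.u z a * dxi a) - xi * ∑ a, S.u z a * S.dn z a b := by
  have h := F.ckv_contract (S.u z) b
  rw [F.u_n, F.g_u] at h
  linarith

/-- `ξ n_{a;b} u^a u^b = -ψ`. -/
theorem u_dn_u (F : S.FirstOrder z xi psi dxi dH) :
    xi * ∑ b, (∑ a, S.u z a * S.dn z a b) * S.u z b = -psi := by
  have h1 : xi * ∑ b, S.u z b * ∑ a, S.dn z b a * S.u z a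
      = ∑ b, S.u z b * (xi * ∑ a, S.dn z b a * S.u z a) := by
    rw [Finset.mul_sum]; exact Finset.sum_congr rfl fun b _ => by ring
  have h2 : ∑ b, S.u z b * (xi * ∑ a, S.dn z b a * S.u z a)
      = 2 * psi * (∑ b, S.u z b * S.ul z b) - (∑ b, S.u z b * S.nl z b) * (∑ a, S.u z a * dxi a)
        - xi * ∑ b, (∑ a, S.u z a * S.dn z a b) * S.u z b := by
    have h3 : ∀ b, S.u z b * (xi * ∑ a, S.dn z b a * S.u z a)
        = 2 * psi * (S.u z b * S.ul z b) - (S.u z b * S.nl z b) * (∑ a, S.u z a * dxi a)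
          - xi * ((∑ a, S.u z a * S.dn z a b) * S.u z b) := fun b => by rw [F.dn_u]; ring
    simp only [h3]
    rw [Finset.sum_sub_distrib, Finset.sum_sub_distrib, ← Finset.mul_sum, ← Finset.sum_mul,
      ← Finset.mul_sum]
  rw [h2, sum_sum_swap, F.u_u, F.u_n] at h1
  linarith

/-- `ξ n^a_{;a} = 3ψ`. -/
theorem div_n (F : S.FirstOrder z xi psi dxi dH) :
    xi * ∑ l, dVec S.g S.n z l l = 3 * psi := by
  -- The trace of the conformal Killing equation in dimension four reads 2ψ + 2ξ n^a_;a = 8ψ.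
  have h0 : ∑ a, ∑ b, ginv S.g z a b * (S.nl z a * dxi b + S.nl z b * dxi a
      + xi * (S.dn z a b + S.dn z b a)) = ∑ a, ∑ b, ginv S.g z a b * (2 * psi * S.g z a b) :=
    Finset.sum_congr rfl fun a _ => Finset.sum_congr rfl fun b _ => by rw [F.ckv]
  have gis : ∀ a b, ginv S.g z a b = ginv S.g z b a := by
    intro a b
    have h1 : (S.g z)ᵀ = S.g z := by ext i j; exact F.symm j i
    have h2 : ((S.g z)⁻¹)ᵀ = (S.g z)⁻¹ := by rw [Matrix.transpose_nonsing_inv, h1]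
    exact congrFun (congrFun h2 b) a
  have e1 : ∑ a, ∑ b, ginv S.g z a b * (S.nl z b * dxi a) = psi := by
    rw [← F.dxi_n]
    refine Finset.sum_congr rfl fun a _ => ?_
    have := F.ginv_lower (S.n z) a
    calc _ = (∑ c, ginv S.g z a c * ∑ d, S.g z c d * S.n z d) * dxi a := by
          rw [Finset.sum_mul]; exact Finset.sum_congr rfl fun b _ => by simp only [nl, lower]; ring
      _ = _ := by rw [this]
  have e2 : ∑ a, ∑ b, ginv S.g z a b * (S.nl z a * dxi b) = psi := by
    rw [← e1, Finset.sum_comm]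
    exact Finset.sum_congr rfl fun a _ => Finset.sum_congr rfl fun b _ => by rw [gis b a]
  have e3 : ∑ a, ∑ b, ginv S.g z a b * S.dn z b a = ∑ l, dVec S.g S.n z l l := by
    refine Finset.sum_congr rfl fun a _ => ?_
    rw [← F.ginv_lower (fun c => dVec S.g S.n z c a) a]
    exact Finset.sum_congr rfl fun b _ => by rw [F.dn_eq]
  have e4 : ∑ a, ∑ b, ginv S.g z a b * S.dn z a b = ∑ l, dVec S.g S.n z l l := by
    rw [← e3, Finset.sum_comm]
    exact Finset.sum_congr rfl fun a _ => Finset.sum_congr rfl fun b _ => by rw [gis b a]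
  have e5 : ∑ a, ∑ b, ginv S.g z a b * S.g z a b = 4 := by
    have : ∀ a, ∑ b, ginv S.g z a b * S.g z a b = 1 := fun a => by
      have := F.ginv_g a a
      rw [if_pos rfl] at this
      rw [← this]; exact Finset.sum_congr rfl fun b _ => by rw [F.symm]
    simp [this]
  have e6 : ∑ a, ∑ b, ginv S.g z a b * (S.nl z a * dxi b + S.nl z b * dxi a
      + xi * (S.dn z a b + S.dn z b a))
      = ∑ a, ∑ b, ginv S.g z a b * (S.nl z a * dxi b)
        + ∑ a, ∑ b, ginv S.g z a b * (S.nl z b * dxi a)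
        + xi * (∑ a, ∑ b, ginv S.g z a b * S.dn z a b
          + ∑ a, ∑ b, ginv S.g z a b * S.dn z b a) := by
    simp only [Finset.mul_sum, ← Finset.sum_add_distrib]
    exact Finset.sum_congr rfl fun a _ => Finset.sum_congr rfl fun b _ => by ring
  have e7 : ∑ a, ∑ b, ginv S.g z a b * (2 * psi * S.g z a b)
      = 2 * psi * ∑ a, ∑ b, ginv S.g z a b * S.g z a b := by
    simp only [Finset.mul_sum]
    exact Finset.sum_congr rfl fun a _ => Finset.sum_congr rfl fun b _ => by ring
  rw [e6, e7, e1, e2, e3, e4, e5] at h0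
  linarith

/-- Maxwell's equation contracted with a covector. -/
theorem maxwell_contract (F : S.FirstOrder z xi psi dxi dH) (w : Fin 4 → ℝ) :
    (∑ l, dH l * S.u z l + S.H z * S.theta z) * (∑ k, w k * S.n z k)
      + S.H z * (∑ k, w k * S.nDot z k) - S.H z * (∑ k, w k * S.uStar z k)
      - (∑ l, dH l * S.n z l + S.H z * ∑ l, dVec S.g S.n z l l) * (∑ k, w k * S.u z k) = 0 := by
  have h1 : ∑ k, w k * ((∑ l, dH l * S.u z l) * S.n z k + S.H z * S.nDot z k
      + S.H z * S.theta z * S.n z k - S.H z * S.uStar z k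
      - (∑ l, dH l * S.n z l + S.H z * ∑ l, dVec S.g S.n z l l) * S.u z k) = 0 :=
    Finset.sum_eq_zero fun k _ => by rw [F.maxwell, mul_zero]
  rw [← h1, Finset.mul_sum, Finset.mul_sum, Finset.mul_sum, Finset.mul_sum,
    ← Finset.sum_add_distrib, ← Finset.sum_sub_distrib, ← Finset.sum_sub_distrib]
  exact Finset.sum_congr rfl fun k _ => by ring

theorem ul_nDot (F : S.FirstOrder z xi psi dxi dH) :
    ∑ k, S.ul z k * S.nDot z k = ∑ b, (∑ a, S.u z a * S.dn z a b) * S.u z b := by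
  rw [← sum_sum_swap]
  have := F.lower_contract (S.u z) (S.nDot z)
  simp only [F.lower_nDot] at this
  exact this

theorem ul_uStar (F : S.FirstOrder z xi psi dxi dH) : ∑ k, S.ul z k * S.uStar z k = 0 := by
  have := F.lower_contract (S.u z) (S.uStar z)
  simp only [F.lower_uStar] at this
  rw [sum_sum_swap] at this
  simp only [F.u_du, zero_mul, Finset.sum_const_zero] at this
  exact this

theorem nl_nDot (F : S.FirstOrder z xi psi dxi dH) : ∑ k, S.nl z k * S.nDot z k = 0 := by
  have := F.lower_contract (S.n z) (S.nDot z)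
  simp only [F.lower_nDot] at this
  rw [sum_sum_swap] at this
  simp only [F.n_dn, zero_mul, Finset.sum_const_zero] at this
  exact this

theorem nl_uStar (F : S.FirstOrder z xi psi dxi dH) :
    ∑ k, S.nl z k * S.uStar z k = ∑ b, (∑ a, S.n z a * S.du z a b) * S.n z b := by
  rw [← sum_sum_swap]
  have := F.lower_contract (S.n z) (S.uStar z)
  simp only [F.lower_uStar] at this
  exact this

/-- `ξ H* = -2 ψ H`. -/
theorem dH_n (F : S.FirstOrder z xi psi dxi dH) :
    xi * ∑ l, dH l * S.n z l = -(2 * psi * S.H z) := by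
  -- The u component of Maxwell's equation is H* + H(n^a_;a + n_{a;b}u^a u^b) = 0. The two kinematic
  -- terms are 3ψ/ξ and -ψ/ξ.
  have h := F.maxwell_contract (S.ul z)
  rw [F.un, F.uu, F.ul_uStar, F.ul_nDot] at h
  have h1 := F.div_n
  have h2 := F.u_dn_u
  linear_combination xi * h - S.H z * h2 - S.H z * h1

/-- `H˙ = H (σ_{ab} n^a n^b - ⅔ θ)`, in terms of the velocity gradient. -/
theorem dH_u (F : S.FirstOrder z xi psi dxi dH) :
    ∑ l, dH l * S.u z l
      = S.H z * (∑ b, (∑ a, S.n z a * S.du z a b) * S.n z b - S.theta z) := by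
  have h := F.maxwell_contract (S.nl z)
  rw [F.nn, F.nu, F.nl_uStar, F.nl_nDot] at h
  linear_combination h

/-- The field lines are frozen into the fluid: Maxwell's equation puts the bracket of u and n in the
span of u and n. Contractions with u and n supply the two coefficients, and the screen part, the
Greenberg vector, is zero. -/
theorem nDot_sub_uStar (F : S.FirstOrder z xi psi dxi dH) (k : Fin 4) :
    S.nDot z k - S.uStar z k = -(∑ b, (∑ a, S.n z a * S.du z a b) * S.n z b) * S.n z k
      - (∑ b, (∑ a, S.u z a * S.dn z a b) * S.u z b) * S.u z k := by
  have h := F.maxwell_contract (S.ul z)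
  rw [F.un, F.uu, F.ul_uStar, F.ul_nDot] at h
  have h2 := F.maxwell k
  rw [F.dH_u] at h2
  have hH := F.H_pos.ne'
  apply mul_left_cancel₀ hH
  linear_combination h2 + S.u z k * h

theorem greenberg_eq_zero (F : S.FirstOrder z xi psi dxi dH) (a : Fin 4) :
    S.greenberg z a = 0 := by
  have h1 : ∑ c, S.g z a c * (S.nDot z c - S.uStar z c)
      = -(∑ b, (∑ a, S.n z a * S.du z a b) * S.n z b) * S.nl z a
        - (∑ b, (∑ a, S.u z a * S.dn z a b) * S.u z b) * S.ul z a := by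
    simp only [nl, ul, lower, F.nDot_sub_uStar]
    rw [Finset.mul_sum, Finset.mul_sum, ← Finset.sum_sub_distrib]
    exact Finset.sum_congr rfl fun k _ => by ring
  have h2 : ∑ c, S.ul z c * (S.nDot z c - S.uStar z c)
      = ∑ b, (∑ a, S.u z a * S.dn z a b) * S.u z b := by
    simp only [mul_sub]
    rw [Finset.sum_sub_distrib, F.ul_nDot, F.ul_uStar, sub_zero]
  have h3 : ∑ c, S.nl z c * (S.nDot z c - S.uStar z c)
      = -∑ b, (∑ a, S.n z a * S.du z a b) * S.n z b := by
    simp only [mul_sub]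
    rw [Finset.sum_sub_distrib, F.nl_nDot, F.nl_uStar, zero_sub]
  rw [greenberg, sum_p, h1, h2, h3]
  ring

theorem nStar_eq (F : S.FirstOrder z xi psi dxi dH) (a : Fin 4) :
    xi * S.nStar z a = psi * S.n z a - ∑ b, ginv S.g z a b * dxi b := by
  rw [← F.ginv_lower (S.nStar z) a, Finset.mul_sum, ← F.ginv_lower (S.n z) a, Finset.mul_sum,
    ← Finset.sum_sub_distrib]
  refine Finset.sum_congr rfl fun b _ => ?_
  rw [F.lower_nStar, mul_left_comm, F.dn_n]
  simp only [nl, lower]; ring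

theorem p_symm (F : S.FirstOrder z xi psi dxi dH) (a b : Fin 4) : S.p z a b = S.p z b a := by
  simp only [p, h, F.symm a b]; ring

theorem sum_pMix_nl (F : S.FirstOrder z xi psi dxi dH) (a : Fin 4) :
    ∑ c, S.pMix z a c * S.nl z c = 0 := by
  rw [sum_pMix, F.u_n, F.n_n]; ring

theorem sum_pMix_ul (F : S.FirstOrder z xi psi dxi dH) (a : Fin 4) :
    ∑ c, S.pMix z a c * S.ul z c = 0 := by
  rw [sum_pMix, F.u_u, F.n_u]; ring

theorem sum_pMix_g (F : S.FirstOrder z xi psi dxi dH) (a b : Fin 4) :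
    ∑ c, S.pMix z a c * S.g z c b = S.p z a b := by
  rw [sum_pMix, F.g_u, F.g_n]; rfl

theorem sum_pMix_p (F : S.FirstOrder z xi psi dxi dH) (a b : Fin 4) :
    ∑ c, S.pMix z a c * S.p z c b = S.p z a b := by
  have h1 : ∀ c, S.pMix z a c * S.p z c b = S.pMix z a c * S.g z c b
      + S.pMix z a c * S.ul z c * S.ul z b - S.pMix z a c * S.nl z c * S.nl z b := fun c => by
    simp only [p, h]; ring
  simp only [h1]
  rw [Finset.sum_sub_distrib, Finset.sum_add_distrib, ← Finset.sum_mul, ← Finset.sum_mul,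
    F.sum_pMix_nl, F.sum_pMix_ul, F.sum_pMix_g]
  ring

/-- Apart from a multiple of the metric, every term carries a factor n_a or n_b. Screen projection
therefore leaves pure trace, which is the source of both 𝒮_ab = 0 and ℰ = 2ψ/ξ. -/
theorem sym_dn (F : S.FirstOrder z xi psi dxi dH) (a b : Fin 4) :
    (S.dn z a b + S.dn z b a) / 2
      = psi / xi * S.g z a b - (S.nl z a * dxi b + S.nl z b * dxi a) / (2 * xi) := by
  have h := F.ckv a b
  have hx := F.xi_pos.ne'
  field_simp
  linear_combination h

theorem sum_pUp_nl (F : S.FirstOrder z xi psi dxi dH) (a : Fin 4) :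
    ∑ c, S.pUp z a c * S.nl z c = 0 := by
  have := F.ginv_lower (S.n z) a
  rw [sum_pUp, F.u_n, F.n_n]
  simp only [nl, lower]
  rw [this]; ring

theorem ginv_symm (F : S.FirstOrder z xi psi dxi dH) (a b : Fin 4) :
    ginv S.g z a b = ginv S.g z b a := by
  have h1 : (S.g z)ᵀ = S.g z := by ext i j; exact F.symm j i
  have h2 : ((S.g z)⁻¹)ᵀ = (S.g z)⁻¹ := by rw [Matrix.transpose_nonsing_inv, h1]
  exact congrFun (congrFun h2 b) a

theorem pUp_symm (F : S.FirstOrder z xi psi dxi dH) (a b : Fin 4) :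
    S.pUp z a b = S.pUp z b a := by
  simp only [pUp, hUp, F.ginv_symm a b]; ring

theorem pUp_trace (F : S.FirstOrder z xi psi dxi dH) :
    ∑ c, ∑ d, S.pUp z c d * S.g z c d = 2 := by
  have h1 : ∀ c, ∑ d, S.pUp z c d * S.g z c d
      = 1 + S.u z c * S.ul z c - S.n z c * S.nl z c := by
    intro c
    have hg : ∑ d, ginv S.g z c d * S.g z c d = 1 := by
      have := F.ginv_g c c
      rw [if_pos rfl] at this
      rw [← this]; exact Finset.sum_congr rfl fun d _ => by rw [F.symm]
    have hu : ∑ d, S.u z d * S.g z c d = S.ul z c := by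
      rw [← F.g_u]; exact Finset.sum_congr rfl fun d _ => by rw [F.symm]
    have hn : ∑ d, S.n z d * S.g z c d = S.nl z c := by
      rw [← F.g_n]; exact Finset.sum_congr rfl fun d _ => by rw [F.symm]
    rw [sum_pUp S z c (fun d => S.g z c d), hg, hu, hn]
  simp only [h1]
  rw [Finset.sum_sub_distrib, Finset.sum_add_distrib, F.u_u, F.n_n]
  norm_num

theorem pUp_sym_dn (F : S.FirstOrder z xi psi dxi dH) :
    ∑ c, ∑ d, S.pUp z c d * ((S.dn z c d + S.dn z d c) / 2) = 2 * (psi / xi) := by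
  have e1 : ∑ c, ∑ d, S.pUp z c d * (S.nl z d * dxi c) = 0 := by
    refine Finset.sum_eq_zero fun c _ => ?_
    have : ∑ d, S.pUp z c d * (S.nl z d * dxi c) = (∑ d, S.pUp z c d * S.nl z d) * dxi c := by
      rw [Finset.sum_mul]; exact Finset.sum_congr rfl fun d _ => by ring
    rw [this, F.sum_pUp_nl, zero_mul]
  have e2 : ∑ c, ∑ d, S.pUp z c d * (S.nl z c * dxi d) = 0 := by
    rw [← e1, Finset.sum_comm]
    exact Finset.sum_congr rfl fun c _ => Finset.sum_congr rfl fun d _ => by rw [F.pUp_symm]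
  have e3 : ∑ c, ∑ d, S.pUp z c d * ((S.dn z c d + S.dn z d c) / 2)
      = psi / xi * (∑ c, ∑ d, S.pUp z c d * S.g z c d)
        - 1 / (2 * xi) * (∑ c, ∑ d, S.pUp z c d * (S.nl z c * dxi d)
          + ∑ c, ∑ d, S.pUp z c d * (S.nl z d * dxi c)) := by
    simp only [Finset.mul_sum, ← Finset.sum_add_distrib, ← Finset.sum_sub_distrib]
    exact Finset.sum_congr rfl fun c _ => Finset.sum_congr rfl fun d _ => by
      rw [F.sym_dn]; ring
  rw [e3, e1, e2, F.pUp_trace]; ring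

theorem screenExp_eq (F : S.FirstOrder z xi psi dxi dH) : S.screenExp z = 2 * (psi / xi) := by
  have h1 : S.screenExp z = ∑ c, ∑ d, S.pUp z c d * S.dn z d c := by
    rw [screenExp, Finset.sum_comm]
    exact Finset.sum_congr rfl fun c _ => Finset.sum_congr rfl fun d _ => by rw [F.pUp_symm]
  have h2 := F.pUp_sym_dn
  have h3 : ∑ c, ∑ d, S.pUp z c d * ((S.dn z c d + S.dn z d c) / 2)
      = 1 / 2 * (S.screenExp z + ∑ c, ∑ d, S.pUp z c d * S.dn z d c) := by
    simp only [screenExp, Finset.mul_sum, ← Finset.sum_add_distrib]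
    exact Finset.sum_congr rfl fun c _ => Finset.sum_congr rfl fun d _ => by ring
  rw [h3, ← h1] at h2
  linarith

theorem screenShear_eq_zero (F : S.FirstOrder z xi psi dxi dH) (a b : Fin 4) :
    S.screenShear z a b = 0 := by
  have h1 : S.screenShear z a b
      = ∑ c, S.pMix z a c * ∑ d, S.pMix z b d * ((S.dn z c d + S.dn z d c) / 2)
        - (1 / 2) * S.p z a b * ∑ c, ∑ d, S.pUp z c d * ((S.dn z c d + S.dn z d c) / 2) := by
    simp only [screenShear, Finset.mul_sum, ← Finset.sum_sub_distrib]
    exact Finset.sum_congr rfl fun c _ => Finset.sum_congr rfl fun d _ => by ring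
  have h2 : ∀ c, ∑ d, S.pMix z b d * ((S.dn z c d + S.dn z d c) / 2)
      = psi / xi * S.p z c b - S.nl z c * ((∑ d, S.pMix z b d * dxi d) / (2 * xi)) := by
    intro c
    have e1 : ∑ d, S.pMix z b d * ((S.dn z c d + S.dn z d c) / 2)
        = psi / xi * (∑ d, S.pMix z b d * S.g z d c)
          - S.nl z c / (2 * xi) * (∑ d, S.pMix z b d * dxi d)
          - dxi c / (2 * xi) * ∑ d, S.pMix z b d * S.nl z d := by
      simp only [Finset.mul_sum, ← Finset.sum_sub_distrib]
      exact Finset.sum_congr rfl fun d _ => by rw [F.sym_dn, F.symm d c]; ring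
    rw [e1, F.sum_pMix_g, F.sum_pMix_nl, F.p_symm b c]; ring
  have h3 : ∑ c, S.pMix z a c * (psi / xi * S.p z c b
      - S.nl z c * ((∑ d, S.pMix z b d * dxi d) / (2 * xi)))
      = psi / xi * (∑ c, S.pMix z a c * S.p z c b)
        - (∑ c, S.pMix z a c * S.nl z c) * ((∑ d, S.pMix z b d * dxi d) / (2 * xi)) := by
    rw [Finset.mul_sum, Finset.sum_mul, ← Finset.sum_sub_distrib]
    exact Finset.sum_congr rfl fun c _ => by ring
  simp only [h1, h2]
  rw [h3, F.sum_pMix_p, F.sum_pMix_nl, F.pUp_sym_dn]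
  ring

/-- The shear contracted with the direction of the magnetic field. -/
theorem sigma_n (F : S.FirstOrder z xi psi dxi dH) (b : Fin 4) :
    ∑ c, S.sigma z b c * S.n z c
      = (1 / 2) * (∑ e, S.hMix z b e
          * (∑ d, S.du z e d * S.n z d + ∑ d, S.n z d * S.du z d e))
        - (1 / 3) * S.theta z * S.nl z b := by
  have hn : ∀ d, ∑ c, S.hMix z c d * S.n z c = S.n z d := by
    intro d
    have : ∑ c, S.hMix z c d * S.n z c = S.n z d + (∑ c, S.ul z c * S.n z c) * S.u z d := by
      simp only [hMix, add_mul, ite_mul, one_mul, zero_mul, Finset.sum_add_distrib, Finset.sum_mul,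
        Finset.sum_ite_eq', Finset.mem_univ, if_true, mul_right_comm]
    rw [this, F.un]; ring
  have hh : ∑ c, S.h z b c * S.n z c = S.nl z b := by
    simp only [h, add_mul, Finset.sum_add_distrib, mul_assoc, ← Finset.mul_sum]
    rw [F.un, mul_zero, add_zero]; rfl
  have h1 : ∑ c, S.sigma z b c * S.n z c
      = ∑ e, ∑ d, S.hMix z b e * ((S.du z e d + S.du z d e) / 2) * (∑ c, S.hMix z c d * S.n z c)
        - (1 / 3) * S.theta z * ∑ c, S.h z b c * S.n z c := by
    simp only [sigma, sub_mul, Finset.sum_sub_distrib, Finset.mul_sum, Finset.sum_mul]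
    congr 1
    · rw [Finset.sum_comm]
      refine Finset.sum_congr rfl fun e _ => ?_
      rw [Finset.sum_comm]
      exact Finset.sum_congr rfl fun d _ => Finset.sum_congr rfl fun c _ => by ring
    · exact Finset.sum_congr rfl fun c _ => by ring
  rw [h1, hh]
  simp only [hn]
  congr 1
  rw [Finset.mul_sum]
  refine Finset.sum_congr rfl fun e _ => ?_
  rw [← Finset.sum_add_distrib, Finset.mul_sum, Finset.mul_sum]
  exact Finset.sum_congr rfl fun d _ => by ring

theorem sigmaNN_eq (F : S.FirstOrder z xi psi dxi dH) :
    S.sigmaNN z = ∑ b, (∑ a, S.n z a * S.du z a b) * S.n z b - (1 / 3) * S.theta z := by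
  have h1 : S.sigmaNN z = ∑ a, S.n z a * ∑ c, S.sigma z a c * S.n z c := by
    simp only [sigmaNN, Finset.mul_sum]
    exact Finset.sum_congr rfl fun a _ => Finset.sum_congr rfl fun b _ => by ring
  have h2 : ∀ x : Fin 4 → ℝ, ∑ b, S.n z b * (∑ e, S.hMix z b e * x e) = ∑ b, S.n z b * x b := by
    intro x
    simp only [sum_hMix, mul_add, Finset.sum_add_distrib]
    have : ∑ b, S.n z b * (S.ul z b * ∑ c, S.u z c * x c)
        = (∑ b, S.n z b * S.ul z b) * ∑ c, S.u z c * x c := by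
      rw [Finset.sum_mul]; exact Finset.sum_congr rfl fun b _ => by ring
    rw [this, F.n_u]; ring
  have h3 : S.sigmaNN z = (1 / 2) * (∑ b, S.n z b * (∑ e, S.hMix z b e
      * (∑ d, S.du z e d * S.n z d + ∑ d, S.n z d * S.du z d e)))
      - (1 / 3) * S.theta z * ∑ b, S.n z b * S.nl z b := by
    rw [h1]
    simp only [F.sigma_n]
    rw [Finset.mul_sum (f := fun b => S.n z b * S.nl z b),
      Finset.mul_sum (f := fun b => S.n z b * ∑ e, S.hMix z b e *
        (∑ d, S.du z e d * S.n z d + ∑ d, S.n z d * S.du z d e)), ← Finset.sum_sub_distrib]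
    exact Finset.sum_congr rfl fun b _ => by ring
  rw [h3, h2, F.n_n]
  simp only [mul_add, Finset.sum_add_distrib]
  rw [sum_sum_swap]
  have : ∑ b, S.n z b * ∑ d, S.n z d * S.du z d b
      = ∑ b, (∑ a, S.n z a * S.du z a b) * S.n z b :=
    Finset.sum_congr rfl fun b _ => mul_comm _ _
  rw [this]; ring

theorem sum_pUp_ul (F : S.FirstOrder z xi psi dxi dH) (a : Fin 4) :
    ∑ c, S.pUp z a c * S.ul z c = 0 := by
  have := F.ginv_lower (S.u z) a
  rw [sum_pUp, F.u_u, F.n_u]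
  simp only [ul, lower]
  rw [this]; ring

theorem pUp_lower (F : S.FirstOrder z xi psi dxi dH) (x : Fin 4 → ℝ) (a : Fin 4) :
    ∑ b, S.pUp z a b * ∑ c, S.g z b c * x c
      = x a + S.u z a * (∑ c, S.ul z c * x c) - S.n z a * ∑ c, S.nl z c * x c := by
  rw [sum_pUp, F.ginv_lower, ← F.lower_contract, ← F.lower_contract]
  rfl

/-- `n˙^a` in terms of the shear. -/
theorem nDot_eq (F : S.FirstOrder z xi psi dxi dH) (a : Fin 4) :
    S.nDot z a = psi / xi * S.u z a + ∑ b, ∑ c, S.pUp z a b * S.sigma z b c * S.n z c := by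
  have hx := F.xi_pos.ne'
  have h1 : ∑ b, ∑ c, S.pUp z a b * S.sigma z b c * S.n z c
      = ∑ b, S.pUp z a b * ∑ c, S.sigma z b c * S.n z c := by
    simp only [Finset.mul_sum, mul_assoc]
  have h2 : ∀ x : Fin 4 → ℝ, ∑ b, S.pUp z a b * (∑ e, S.hMix z b e * x e)
      = ∑ b, S.pUp z a b * x b := by
    intro x
    simp only [sum_hMix, mul_add, Finset.sum_add_distrib]
    have : ∑ b, S.pUp z a b * (S.ul z b * ∑ c, S.u z c * x c)
        = (∑ b, S.pUp z a b * S.ul z b) * ∑ c, S.u z c * x c := by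
      rw [Finset.sum_mul]; exact Finset.sum_congr rfl fun b _ => by ring
    rw [this, F.sum_pUp_ul]; ring
  have h3 : ∑ b, S.pUp z a b * ∑ c, S.sigma z b c * S.n z c
      = (1 / 2) * (∑ b, S.pUp z a b * (∑ e, S.hMix z b e
          * (∑ d, S.du z e d * S.n z d + ∑ d, S.n z d * S.du z d e)))
        - (1 / 3) * S.theta z * ∑ b, S.pUp z a b * S.nl z b := by
    simp only [F.sigma_n]
    rw [Finset.mul_sum (f := fun b => S.pUp z a b * S.nl z b),
      Finset.mul_sum (f := fun b => S.pUp z a b * ∑ e, S.hMix z b e *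
        (∑ d, S.du z e d * S.n z d + ∑ d, S.n z d * S.du z d e)), ← Finset.sum_sub_distrib]
    exact Finset.sum_congr rfl fun b _ => by ring
  -- The second sum is -u^d n_{d;b}, and the conformal Killing equation contracted with u expresses
  -- it by the lowered n˙ up to multiples of u_b and n_b, which the screen projector kills.
  have h4 : ∀ b, ∑ d, S.du z b d * S.n z d + ∑ d, S.n z d * S.du z d b
      = (∑ c, S.g z b c * S.uStar z c + ∑ c, S.g z b c * S.nDot z c)
        - 2 * psi / xi * S.ul z b + (∑ a, S.u z a * dxi a) / xi * S.nl z b := by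
    intro b
    rw [F.lower_uStar, F.lower_nDot, F.n_du]
    have := F.dn_u b
    field_simp
    linear_combination -this
  have h5 : ∑ b, S.pUp z a b * (∑ d, S.du z b d * S.n z d + ∑ d, S.n z d * S.du z d b)
      = (∑ b, S.pUp z a b * ∑ c, S.g z b c * S.uStar z c
          + ∑ b, S.pUp z a b * ∑ c, S.g z b c * S.nDot z c)
        - 2 * psi / xi * (∑ b, S.pUp z a b * S.ul z b)
        + (∑ a, S.u z a * dxi a) / xi * ∑ b, S.pUp z a b * S.nl z b := by
    simp only [h4]
    rw [Finset.mul_sum, Finset.mul_sum, ← Finset.sum_add_distrib, ← Finset.sum_sub_distrib,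
      ← Finset.sum_add_distrib]
    exact Finset.sum_congr rfl fun b _ => by ring
  rw [h1, h3, h2, h5, F.sum_pUp_ul, F.sum_pUp_nl, F.pUp_lower, F.pUp_lower, F.ul_uStar,
    F.nl_uStar, F.ul_nDot, F.nl_nDot]
  -- On the screen the shear contracted with n is half the sum of u* and n˙. By Maxwell's equation
  -- these agree there, so half the sum is n˙ itself; its u component is ψ/ξ by `u_dn_u`.
  have h6 := F.nDot_sub_uStar a
  have h7 := F.u_dn_u
  have h8 : psi / xi = -∑ b, (∑ a, S.u z a * S.dn z a b) * S.u z b := by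
    field_simp; linarith
  rw [h8]
  linear_combination (1 / 2) * h6

end FirstOrder

end Fields

end Coord

/-! ## The alternating symbol -/

namespace Coord

theorem levi_eq_det (a b c d : Fin 4) :
    levi a b c d = Matrix.det (Matrix.of ![Pi.single a 1, Pi.single b 1, Pi.single c 1,
      (Pi.single d 1 : Fin 4 → ℝ)]) := by
  rw [levi]
  congr 1
  ext i j
  fin_cases i <;> simp [Pi.single_apply, eq_comm]

theorem levi_perm (v : Fin 4 → Fin 4) (σ : Equiv.Perm (Fin 4)) :
    levi (v (σ 0)) (v (σ 1)) (v (σ 2)) (v (σ 3))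
      = (Equiv.Perm.sign σ : ℤ) * levi (v 0) (v 1) (v 2) (v 3) := by
  have h := Matrix.det_permute σ (Matrix.of fun i j : Fin 4 => if v i = j then (1 : ℝ) else 0)
  have e : ∀ w : Fin 4 → Fin 4, levi (w 0) (w 1) (w 2) (w 3)
      = Matrix.det (Matrix.of fun i j : Fin 4 => if w i = j then (1 : ℝ) else 0) := by
    intro w
    rw [levi]
    congr 1
    ext i j
    fin_cases i <;> rfl
  rw [e v, ← h, e (fun i => v (σ i))]
  rfl

theorem levi_swap₁ (a b c d : Fin 4) : levi b a c d = -levi a b c d := by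
  have := levi_perm ![a, b, c, d] (Equiv.swap 0 1)
  rw [Equiv.Perm.sign_swap (by decide)] at this
  simpa [Equiv.swap_apply_def] using this

theorem levi_swap₂ (a b c d : Fin 4) : levi a c b d = -levi a b c d := by
  have := levi_perm ![a, b, c, d] (Equiv.swap 1 2)
  rw [Equiv.Perm.sign_swap (by decide)] at this
  simpa [Equiv.swap_apply_def] using this

theorem levi_swap₃ (a b c d : Fin 4) : levi a b d c = -levi a b c d := by
  have := levi_perm ![a, b, c, d] (Equiv.swap 2 3)
  rw [Equiv.Perm.sign_swap (by decide)] at this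
  simpa [Equiv.swap_apply_def] using this

/-- The rows of the determinant are expanded in the standard basis one at a time. Contractions of
the symbol with vectors become determinants: they vanish when two rows agree, and lowering all
indices multiplies them by det g. -/
theorem levi_contract (w x y v : Fin 4 → ℝ) :
    ∑ a, ∑ b, ∑ c, ∑ d, levi a b c d * w a * x b * y c * v d
      = Matrix.det (Matrix.of ![w, x, y, v]) := by
  have h3 : ∀ r₀ r₁ r₂ : Fin 4 → ℝ, ∑ d, v d * Matrix.det (Matrix.of ![r₀, r₁, r₂, Pi.single d 1])
      = Matrix.det (Matrix.of ![r₀, r₁, r₂, v]) := by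
    intro r₀ r₁ r₂
    simp [Matrix.det_succ_row_zero, Fin.sum_univ_succ, Fin.succAbove, Pi.single_apply]
    ring
  have h2 : ∀ r₀ r₁ : Fin 4 → ℝ, ∑ c, y c * Matrix.det (Matrix.of ![r₀, r₁, Pi.single c 1, v])
      = Matrix.det (Matrix.of ![r₀, r₁, y, v]) := by
    intro r₀ r₁
    simp [Matrix.det_succ_row_zero, Fin.sum_univ_succ, Fin.succAbove, Pi.single_apply]
    ring
  have h1 : ∀ r₀ : Fin 4 → ℝ, ∑ b, x b * Matrix.det (Matrix.of ![r₀, Pi.single b 1, y, v])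
      = Matrix.det (Matrix.of ![r₀, x, y, v]) := by
    intro r₀
    simp [Matrix.det_succ_row_zero, Fin.sum_univ_succ, Fin.succAbove, Pi.single_apply]
    ring
  have h0 : ∑ a, w a * Matrix.det (Matrix.of ![Pi.single a 1, x, y, v])
      = Matrix.det (Matrix.of ![w, x, y, v]) := by
    simp [Matrix.det_succ_row_zero, Fin.sum_univ_succ, Fin.succAbove, Pi.single_apply]
    ring
  rw [← h0]
  refine Finset.sum_congr rfl fun a _ => ?_
  rw [← h1, Finset.mul_sum]
  refine Finset.sum_congr rfl fun b _ => ?_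
  rw [← h2, Finset.mul_sum, Finset.mul_sum]
  refine Finset.sum_congr rfl fun c _ => ?_
  rw [← h3, Finset.mul_sum, Finset.mul_sum, Finset.mul_sum]
  exact Finset.sum_congr rfl fun d _ => by rw [levi_eq_det]; ring

/-- A fixed pair of indices leaves only the complementary pair, in its two orders. These six
formulas are the duality between the components F_ab and those of a bivector density. -/
theorem levi_pairs (P : Fin 4 → Fin 4 → ℝ) :
    ∑ k, ∑ l, levi 0 1 k l * P k l = P 2 3 - P 3 2 ∧
    ∑ k, ∑ l, levi 0 2 k l * P k l = P 3 1 - P 1 3 ∧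
    ∑ k, ∑ l, levi 0 3 k l * P k l = P 1 2 - P 2 1 ∧
    ∑ k, ∑ l, levi 1 2 k l * P k l = P 0 3 - P 3 0 ∧
    ∑ k, ∑ l, levi 1 3 k l * P k l = P 2 0 - P 0 2 ∧
    ∑ k, ∑ l, levi 2 3 k l * P k l = P 0 1 - P 1 0 := by
  have z : ∀ a b c d : Fin 4, (a = b ∨ a = c ∨ a = d ∨ b = c ∨ b = d ∨ c = d) →
      levi a b c d = 0 := by
    intro a b c d h
    have s₁ : ∀ a c d, levi a a c d = 0 := fun a c d => by linarith [levi_swap₁ a a c d]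
    have s₂ : ∀ a b d, levi a b b d = 0 := fun a b d => by linarith [levi_swap₂ a b b d]
    have s₃ : ∀ a b c, levi a b c c = 0 := fun a b c => by linarith [levi_swap₃ a b c c]
    rcases h with rfl | rfl | rfl | rfl | rfl | rfl
    · exact s₁ _ _ _
    · rw [← neg_eq_zero, ← levi_swap₂]; exact s₁ _ _ _
    · rw [← neg_eq_zero, ← levi_swap₃, ← neg_eq_zero, ← levi_swap₂]; exact s₁ _ _ _
    · exact s₂ _ _ _
    · rw [← neg_eq_zero, ← levi_swap₃]; exact s₂ _ _ _
    · exact s₃ _ _ _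
  have one : levi 0 1 2 3 = 1 := by
    rw [levi]
    have : (Matrix.of fun i j : Fin 4 => if ![0, 1, 2, 3] i = j then (1 : ℝ) else 0) = 1 := by
      ext i j; fin_cases i <;> simp [Matrix.one_apply] <;> rfl
    rw [this, Matrix.det_one]
  have v1 : levi 0 1 3 2 = -1 := by rw [levi_swap₃, one]
  have v2 : levi 0 2 1 3 = -1 := by rw [levi_swap₂, one]
  have v3 : levi 0 2 3 1 = 1 := by rw [levi_swap₃, v2, neg_neg]
  have v4 : levi 0 3 1 2 = 1 := by rw [levi_swap₂, v1, neg_neg]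
  have v5 : levi 0 3 2 1 = -1 := by rw [levi_swap₃, v4]
  have v6 : levi 1 2 0 3 = 1 := by rw [levi_swap₂, levi_swap₁, one, neg_neg]
  have v7 : levi 1 2 3 0 = -1 := by rw [levi_swap₃, v6]
  have v8 : levi 1 3 0 2 = -1 := by rw [levi_swap₂, levi_swap₁, v1]; norm_num
  have v9 : levi 1 3 2 0 = 1 := by rw [levi_swap₃, v8, neg_neg]
  have v10 : levi 2 3 0 1 = 1 := by rw [levi_swap₂, levi_swap₁, v3]; norm_num
  have v11 : levi 2 3 1 0 = -1 := by rw [levi_swap₃, v10]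
  refine ⟨?_, ?_, ?_, ?_, ?_, ?_⟩ <;>
  · simp only [Fin.sum_univ_four, v1, v3, v4, v5, v6, v7, v8, v9, v10, v11, v2, one]
    simp [z]
    ring

end Coord

/-! ## Jacobi's formula for a derivation -/

namespace DiffRing

variable {A : Type*} [CommRing A] [Algebra ℝ A]
variable {D : Fin 4 → Derivation ℝ A A} {G Gi : Matrix (Fin 4) (Fin 4) A}
  {Γ : Fin 4 → Matrix (Fin 4) (Fin 4) A}

/-- Jacobi's formula for an arbitrary derivation. The Leibniz rule differentiates one column at a
time, and Cramer's rule recognises each resulting determinant as an entry of the adjugate applied to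
that column. -/
theorem deriv_det (d : Derivation ℝ A A) (M : Matrix (Fin 4) (Fin 4) A) :
    d M.det = (M.adjugate * M.map d).trace := by
  have h2 : (M.adjugate * M.map d).trace = ∑ i, (M.updateCol i fun j => d (M j i)).det :=
    Finset.sum_congr rfl fun i _ =>
      (congrFun (Matrix.cramer_eq_adjugate_mulVec M fun j => d (M j i)) i).symm
  rw [h2]
  simp only [Matrix.det_apply', _root_.map_sum]
  rw [Finset.sum_comm]
  refine Finset.sum_congr rfl fun σ _ => ?_
  simp only [Derivation.leibniz, Derivation.map_intCast, Fin.prod_univ_four, Fin.sum_univ_four,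
    Matrix.updateCol_apply, smul_eq_mul]
  simp
  ring

theorem LeviCivita.deriv_det (h : LeviCivita D G Gi Γ) (b : Fin 4) :
    D b G.det = 2 * G.det * (Γ b).trace := by
  rw [DiffRing.deriv_det, h.compat, mul_add, Matrix.trace_add]
  have h1 : (G.adjugate * (G * Γ b)).trace = G.det * (Γ b).trace := by
    rw [← mul_assoc, Matrix.adjugate_mul, Matrix.smul_mul, one_mul, Matrix.trace_smul, smul_eq_mul]
  have h2 : (G.adjugate * ((Γ b)ᵀ * G)).trace = G.det * (Γ b).trace := by
    rw [Matrix.trace_mul_comm, mul_assoc, Matrix.mul_adjugate, Matrix.mul_smul, mul_one,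
      Matrix.trace_smul, Matrix.trace_transpose, smul_eq_mul]
  rw [h1, h2]; ring

/-- The derivative of the volume density `s = √(-det G)`. -/
theorem LeviCivita.deriv_density (h : LeviCivita D G Gi Γ) {s si : A} (hs : s * s = -G.det)
    (hsi : s * si = 1) (b : Fin 4) : D b s = s * (Γ b).trace := by
  have h1 : D b (s * s) = -(2 * G.det * (Γ b).trace) := by rw [hs, map_neg, h.deriv_det]
  rw [Derivation.leibniz, smul_eq_mul] at h1
  have h2 : s * D b s = s * (s * (Γ b).trace) := two_cancel (by
    linear_combination h1 - 2 * (Γ b).trace * hs)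
  calc D b s = (s * si) * D b s := by rw [hsi, one_mul]
    _ = si * (s * D b s) := by ring
    _ = (s * si) * (s * (Γ b).trace) := by rw [h2]; ring
    _ = s * (Γ b).trace := by rw [hsi, one_mul]

theorem LeviCivita.deriv_density_inv (h : LeviCivita D G Gi Γ) {s si : A} (hs : s * s = -G.det)
    (hsi : s * si = 1) (b : Fin 4) : D b si = -(si * (Γ b).trace) := by
  have h1 : D b (s * si) = 0 := by rw [hsi]; simp
  rw [Derivation.leibniz, smul_eq_mul, smul_eq_mul, h.deriv_density hs hsi] at h1
  have h2 : si * (s * D b si + si * (s * (Γ b).trace)) = 0 := by rw [h1, mul_zero]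
  linear_combination h2 - (D b si + si * (Γ b).trace) * hsi

/-- The divergence of `X^k u^l - X^l u^k`, given that of its density. -/
theorem LeviCivita.div_wedge (h : LeviCivita D G Gi Γ) {s si : A} (hs : s * s = -G.det)
    (hsi : s * si = 1) (X u : Fin 4 → A) (k : Fin 4)
    (hd : ∑ l, D l (s * (X k * u l - X l * u k)) = 0) :
    (nabla D Γ X *ᵥ u) k + (nabla D Γ u).trace * X k - (nabla D Γ u *ᵥ X) k
      - (nabla D Γ X).trace * u k = 0 := by
  have h1 : ∑ l, D l (s * (X k * u l - X l * u k))
      = s * ∑ l, ((X k * D l (u l) + u l * D l (X k) - (X l * D l (u k) + u k * D l (X l)))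
        + (Γ l).trace * (X k * u l - X l * u k)) := by
    rw [Finset.mul_sum]
    refine Finset.sum_congr rfl fun l _ => ?_
    simp only [Derivation.leibniz, _root_.map_sub, smul_eq_mul, h.deriv_density hs hsi]
    ring
  rw [h1] at hd
  have h2 : ∑ l, ((X k * D l (u l) + u l * D l (X k) - (X l * D l (u k) + u k * D l (X l)))
        + (Γ l).trace * (X k * u l - X l * u k)) = 0 := by
    have : si * (s * ∑ l, ((X k * D l (u l) + u l * D l (X k)
        - (X l * D l (u k) + u k * D l (X l))) + (Γ l).trace * (X k * u l - X l * u k))) = 0 := by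
      rw [hd, mul_zero]
    rwa [← mul_assoc, mul_comm si, hsi, one_mul] at this
  rw [← h2]
  have t : ∀ V : Fin 4 → A, ∑ l, ∑ c, Γ l l c * V c = ∑ l, (Γ l).trace * V l := by
    intro V
    rw [Finset.sum_comm]
    refine Finset.sum_congr rfl fun c _ => ?_
    rw [Matrix.trace, Finset.sum_mul]
    exact Finset.sum_congr rfl fun l _ => by rw [h.torsion c l l]; rfl
  -- The Christoffel terms of ∇_u X and of ∇_X u are equal by symmetry, so they drop out of the
  -- difference.
  have w : ∑ l, ∑ c, Γ l k c * X c * u l = ∑ l, ∑ c, Γ l k c * u c * X l := by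
    rw [Finset.sum_comm]
    exact Finset.sum_congr rfl fun l _ => Finset.sum_congr rfl fun c _ => by
      rw [h.torsion l c k]; ring
  have tr : ∀ V : Fin 4 → A, (nabla D Γ V).trace = ∑ l, (D l (V l) + (Γ l).trace * V l) := by
    intro V
    rw [Finset.sum_add_distrib, ← t, ← Finset.sum_add_distrib]
    rfl
  have mv : ∀ V W : Fin 4 → A, (nabla D Γ V *ᵥ W) k
      = ∑ l, D l (V k) * W l + ∑ l, ∑ c, Γ l k c * V c * W l := by
    intro V W
    simp only [Matrix.mulVec, dotProduct, nabla, Matrix.of_apply, add_mul, Finset.sum_mul,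
      Finset.sum_add_distrib]
  have e : ∑ l, ((X k * D l (u l) + u l * D l (X k) - (X l * D l (u k) + u k * D l (X l)))
        + (Γ l).trace * (X k * u l - X l * u k))
      = ∑ l, D l (X k) * u l + ∑ l, (D l (u l) + (Γ l).trace * u l) * X k
        - ∑ l, D l (u k) * X l - ∑ l, (D l (X l) + (Γ l).trace * X l) * u k := by
    rw [← Finset.sum_add_distrib, ← Finset.sum_sub_distrib, ← Finset.sum_sub_distrib]
    exact Finset.sum_congr rfl fun l _ => by ring
  rw [tr, tr, mv, mv, w, Finset.sum_mul, Finset.sum_mul, e]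
  ring

/-- The divergence of an antisymmetric tensor, by means of its density. -/
theorem LeviCivita.div_antisymm (h : LeviCivita D G Gi Γ) {s si : A} (hs : s * s = -G.det)
    (hsi : s * si = 1) {Φ : Fin 4 → Fin 4 → A} (hΦ : ∀ a b, Φ a b = -Φ b a) (a : Fin 4) :
    ∑ b, D b (si * Φ a b) + ∑ b, ∑ c, Γ b a c * (si * Φ c b) + ∑ b, ∑ c, Γ b b c * (si * Φ a c)
      = si * ∑ b, D b (Φ a b) := by
  have e1 : ∑ b, ∑ c, Γ b a c * (si * Φ c b) = 0 := by
    have : ∑ b, ∑ c, Γ b a c * (si * Φ c b) = -∑ b, ∑ c, Γ b a c * (si * Φ c b) := by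
      conv_lhs => rw [Finset.sum_comm]
      simp only [← Finset.sum_neg_distrib]
      exact Finset.sum_congr rfl fun b _ => Finset.sum_congr rfl fun c _ => by
        rw [hΦ b c, h.torsion b c a]; ring
    exact two_cancel (by linear_combination this)
  have e2 : ∑ b, ∑ c, Γ b b c * (si * Φ a c) = ∑ b, (Γ b).trace * (si * Φ a b) := by
    rw [Finset.sum_comm]
    refine Finset.sum_congr rfl fun c _ => ?_
    rw [Matrix.trace, Finset.sum_mul]
    exact Finset.sum_congr rfl fun b _ => by rw [h.torsion c b b]; rfl
  rw [e1, e2, add_zero, ← Finset.sum_add_distrib, Finset.mul_sum]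
  refine Finset.sum_congr rfl fun b _ => ?_
  rw [Derivation.leibniz, smul_eq_mul, smul_eq_mul, h.deriv_density_inv hs hsi]
  ring

/-- The covariant derivative of a lowered vector. -/
theorem LeviCivita.nabla_lower (h : LeviCivita D G Gi Γ) (V : Fin 4 → A) (a b : Fin 4) :
    D b ((G *ᵥ V) a) - ∑ c, Γ a c b * (G *ᵥ V) c = (G * nabla D Γ V) a b := by
  have h1 := congrFun (deriv_mulVec (D b) G V) a
  have h3 : (G * nabla D Γ V) a b = (G *ᵥ ((fun k => D b (V k)) + Γ b *ᵥ V)) a := rfl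
  have h4 : ∑ c, Γ a c b * (G *ᵥ V) c = ((Γ b)ᵀ *ᵥ (G *ᵥ V)) a := by
    simp only [Matrix.mulVec, dotProduct, Matrix.transpose_apply]
    exact Finset.sum_congr rfl fun c _ => by rw [h.torsion b a c]
  have h5 : G.map (D b) *ᵥ V = (Γ b)ᵀ *ᵥ (G *ᵥ V) + G *ᵥ (Γ b *ᵥ V) := by
    rw [h.compat, Matrix.add_mulVec, Matrix.mulVec_mulVec, Matrix.mulVec_mulVec]
  rw [h3, h4, Matrix.mulVec_add, Pi.add_apply]
  refine (congrArg (· - _) h1).trans ?_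
  rw [h5]
  simp only [Pi.add_apply]
  ring

/-- The covariant derivative of a scalar product. -/
theorem LeviCivita.deriv_inner (h : LeviCivita D G Gi Γ) (x y : Fin 4 → A) (b : Fin 4) :
    D b (x ⬝ᵥ G *ᵥ y) = (y ᵥ* (G * nabla D Γ x)) b + (x ᵥ* (G * nabla D Γ y)) b := by
  have e : ∀ v w : Fin 4 → A, (v ᵥ* (G * nabla D Γ w)) b
      = v ⬝ᵥ G *ᵥ ((fun k => D b (w k)) + Γ b *ᵥ w) := fun v w => rfl
  rw [e, e, deriv_dotProduct, deriv_mulVec, h.compat, Matrix.add_mulVec,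
    ← Matrix.mulVec_mulVec, ← Matrix.mulVec_mulVec]
  simp only [Matrix.mulVec_add, dotProduct_add]
  rw [dot_mulVec_symm h.symm y, dot_mulVec_symm h.symm y, Matrix.dotProduct_mulVec x (Γ b)ᵀ,
    Matrix.vecMul_transpose]
  ring

end DiffRing

/-! ## The ring of smooth functions on an open set of coordinates -/

namespace Coord

variable {U : Set Pt}

/-- Extension by zero of a function on `U`. -/
def extend (f : U → ℝ) : Pt → ℝ := Function.extend Subtype.val f 0

theorem extend_apply (f : U → ℝ) (z : U) : extend f z = f z :=
  Subtype.val_injective.extend_apply f 0 z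

theorem extend_eqOn {f : U → ℝ} {F : Pt → ℝ} (h : ∀ z : U, f z = F z) : Set.EqOn (extend f) F U :=
  fun z hz => (extend_apply f ⟨z, hz⟩).trans (h ⟨z, hz⟩)

/-- The algebra of smooth functions on `U`. -/
def smoothAlg (U : Set Pt) : Subalgebra ℝ (U → ℝ) where
  carrier := {f | ContDiffOn ℝ ∞ (extend f) U}
  mul_mem' {f g} hf hg := (hf.mul hg).congr
    (extend_eqOn fun z => by simp [extend_apply])
  add_mem' {f g} hf hg := (hf.add hg).congr
    (extend_eqOn fun z => by simp [extend_apply])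
  algebraMap_mem' r := (contDiffOn_const (c := r)).congr (extend_eqOn fun z => rfl)

/-- Derivatives at a point of an open set see only the values on that set; extending functions on
`U` by zero is therefore harmless. -/
theorem pd_congr (hU : IsOpen U) {f g : Pt → ℝ} (h : Set.EqOn f g U) {z : Pt} (hz : z ∈ U)
    (a : Fin 4) : pd a f z = pd a g z := by
  rw [pd, pd, Filter.EventuallyEq.fderiv_eq (h.eventuallyEq_of_mem (hU.mem_nhds hz))]

theorem contDiffOn_pd (hU : IsOpen U) {f : Pt → ℝ} (hf : ContDiffOn ℝ ∞ f U) (a : Fin 4) :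
    ContDiffOn ℝ ∞ (pd a f) U :=
  (hf.fderiv_of_isOpen (m := ∞) hU le_rfl).clm_apply contDiffOn_const

theorem differentiableAt_of_contDiffOn (hU : IsOpen U) {f : Pt → ℝ} (hf : ContDiffOn ℝ ∞ f U)
    {z : Pt} (hz : z ∈ U) : DifferentiableAt ℝ f z :=
  (hf.contDiffAt (hU.mem_nhds hz)).differentiableAt (by simp)

theorem pd_mul {f g : Pt → ℝ} {z : Pt} (hf : DifferentiableAt ℝ f z)
    (hg : DifferentiableAt ℝ g z) (a : Fin 4) :
    pd a (f * g) z = f z * pd a g z + g z * pd a f z := by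
  simp [pd, fderiv_mul hf hg]

/-- The partial derivative as a derivation. -/
def der (hU : IsOpen U) (a : Fin 4) : Derivation ℝ (smoothAlg U) (smoothAlg U) :=
  Derivation.mk'
    { toFun := fun f => ⟨fun z => pd a (extend f.1) z,
        (contDiffOn_pd hU f.2 a).congr (extend_eqOn fun _ => rfl)⟩
      map_add' := fun f g => by
        ext z
        have h : Set.EqOn (extend (f + g).1) (extend f.1 + extend g.1) U :=
          extend_eqOn fun z => by simp [extend_apply]
        change pd a (extend (f + g).1) z = pd a (extend f.1) z + pd a (extend g.1) z
        rw [pd_congr hU h z.2]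
        simp [pd, fderiv_add (differentiableAt_of_contDiffOn hU f.2 z.2)
          (differentiableAt_of_contDiffOn hU g.2 z.2)]
      map_smul' := fun r f => by
        ext z
        have h : Set.EqOn (extend (r • f).1) (r • extend f.1) U :=
          extend_eqOn fun z => by simp [extend_apply]
        change pd a (extend (r • f).1) z = r * pd a (extend f.1) z
        rw [pd_congr hU h z.2]
        simp [pd, fderiv_const_smul (differentiableAt_of_contDiffOn hU f.2 z.2)] }
    (fun f g => by
      ext z
      have h : Set.EqOn (extend (f * g).1) (extend f.1 * extend g.1) U :=
        extend_eqOn fun z => by simp [extend_apply]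
      change pd a (extend (f * g).1) z = f.1 z * pd a (extend g.1) z + g.1 z * pd a (extend f.1) z
      rw [pd_congr hU h z.2, pd_mul (differentiableAt_of_contDiffOn hU f.2 z.2)
        (differentiableAt_of_contDiffOn hU g.2 z.2), extend_apply, extend_apply])

/-- Evaluation at a point of `U`. -/
def ev (z : U) : smoothAlg U →ₐ[ℝ] ℝ := (Pi.evalAlgHom ℝ (fun _ : U => ℝ) z).comp (smoothAlg U).val

theorem ext_ev {f g : smoothAlg U} (h : ∀ z, ev z f = ev z g) : f = g :=
  Subtype.ext (funext h)

/-- A smooth function on `U`, as an element of the algebra. -/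
def toAlg {f : Pt → ℝ} (hf : ContDiffOn ℝ ∞ f U) : smoothAlg U :=
  ⟨fun z => f z, hf.congr (extend_eqOn fun _ => rfl)⟩

theorem ev_der (hU : IsOpen U) (x : smoothAlg U) {f : Pt → ℝ} (h : ∀ z : U, ev z x = f z)
    (z : U) (a : Fin 4) : ev z (der hU a x) = pd a f z :=
  pd_congr hU (extend_eqOn h) z.2 a

/-- Both orders are values of the second Fréchet derivative, which is symmetric for smooth
functions. -/
theorem der_comm (hU : IsOpen U) : DiffRing.Commuting (der hU) := by
  intro a b f
  refine ext_ev fun z => ?_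
  have h1 : ∀ a b : Fin 4, ev z (der hU a (der hU b f))
      = fderiv ℝ (fderiv ℝ (extend f.1)) z (EuclideanSpace.single a 1)
        (EuclideanSpace.single b 1) := by
    intro a b
    rw [ev_der hU (der hU b f) (f := pd b (extend f.1)) (fun _ => rfl)]
    have hd : DifferentiableAt ℝ (fderiv ℝ (extend f.1)) z :=
      ((f.2.fderiv_of_isOpen (m := ∞) hU le_rfl).contDiffAt
        (hU.mem_nhds z.2)).differentiableAt (by simp)
    change fderiv ℝ (fun y => fderiv ℝ (extend f.1) y (EuclideanSpace.single b 1)) z _ = _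
    rw [fderiv_clm_apply hd (differentiableAt_const _)]
    simp
  rw [h1, h1]
  have hs := (f.2.contDiffAt (hU.mem_nhds z.2)).isSymmSndFDerivAt (by
    rw [minSmoothness_of_isRCLikeNormedField]; exact WithTop.coe_le_coe.2 le_top)
  exact hs _ _

theorem contDiffOn_det {g : Ten} (hg : ∀ a b, ContDiffOn ℝ ∞ (fun z => g z a b) U) :
    ContDiffOn ℝ ∞ (fun z => (g z).det) U := by
  simp only [Matrix.det_apply']
  exact ContDiffOn.sum fun σ _ => contDiffOn_const.mul (contDiffOn_prod fun i _ => hg _ _)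

theorem contDiffOn_ginv {g : Ten} (hg : ∀ a b, ContDiffOn ℝ ∞ (fun z => g z a b) U)
    (hd : ∀ z ∈ U, (g z).det ≠ 0) (a b : Fin 4) : ContDiffOn ℝ ∞ (fun z => ginv g z a b) U := by
  have h : Set.EqOn (fun z => ginv g z a b) (fun z => ((g z).det)⁻¹ * (g z).adjugate a b) U := by
    intro z _
    simp [ginv, Matrix.inv_def]
  refine ContDiffOn.congr (ContDiffOn.mul ((contDiffOn_det hg).inv hd) ?_) h
  simp only [Matrix.adjugate_apply]
  refine contDiffOn_det (g := fun z => (g z).updateRow b (Pi.single a 1)) fun i j => ?_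
  by_cases hi : i = b
  · subst hi; simpa using contDiffOn_const
  · simpa [Matrix.updateRow_ne hi] using hg i j

theorem contDiffOn_Gam (hU : IsOpen U) {g : Ten} (hg : ∀ a b, ContDiffOn ℝ ∞ (fun z => g z a b) U)
    (hd : ∀ z ∈ U, (g z).det ≠ 0) (a b c : Fin 4) : ContDiffOn ℝ ∞ (Gam g a b c) U := by
  refine contDiffOn_const.mul (ContDiffOn.sum fun d _ => (contDiffOn_ginv hg hd a d).mul ?_)
  exact ((contDiffOn_pd hU (hg _ _) _).add (contDiffOn_pd hU (hg _ _) _)).sub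
    (contDiffOn_pd hU (hg _ _) _)

end Coord

/-! ## The fields of a magnetofluid in the ring of smooth functions -/

namespace Coord

namespace Fields

/-- The fields are smooth on the open set `U`, with the algebraic properties of a magnetofluid. -/
structure Regular (S : Fields) (U : Set Pt) : Prop where
  isOpen : IsOpen U
  g_smooth : ∀ a b, ContDiffOn ℝ ∞ (fun z => S.g z a b) U
  u_smooth : ∀ a, ContDiffOn ℝ ∞ (fun z => S.u z a) U
  n_smooth : ∀ a, ContDiffOn ℝ ∞ (fun z => S.n z a) U
  H_smooth : ContDiffOn ℝ ∞ S.H U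
  mu_smooth : ContDiffOn ℝ ∞ S.mu U
  pp_smooth : ContDiffOn ℝ ∞ S.pp U
  symm : ∀ z ∈ U, ∀ a b, S.g z a b = S.g z b a
  det_neg : ∀ z ∈ U, (S.g z).det < 0
  uu : ∀ z ∈ U, ∑ a, S.u z a * S.ul z a = -1
  nn : ∀ z ∈ U, ∑ a, S.n z a * S.nl z a = 1
  un : ∀ z ∈ U, ∑ a, S.u z a * S.nl z a = 0
  H_pos : ∀ z ∈ U, 0 < S.H z

namespace Regular

variable {S : Fields} {U : Set Pt}

/-- The partial derivatives on smooth functions. -/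
def D (R : S.Regular U) : Fin 4 → Derivation ℝ (smoothAlg U) (smoothAlg U) := der R.isOpen

/-- The metric. -/
def G (R : S.Regular U) : Matrix (Fin 4) (Fin 4) (smoothAlg U) := Matrix.of fun a b => toAlg (R.g_smooth a b)

/-- The inverse metric. -/
def Gi (R : S.Regular U) : Matrix (Fin 4) (Fin 4) (smoothAlg U) := Matrix.of fun a b =>
  toAlg (contDiffOn_ginv R.g_smooth (fun z hz => (R.det_neg z hz).ne) a b)

/-- The Christoffel symbols. -/
def Γ (R : S.Regular U) (b : Fin 4) : Matrix (Fin 4) (Fin 4) (smoothAlg U) := Matrix.of fun c a =>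
  toAlg (contDiffOn_Gam R.isOpen R.g_smooth (fun z hz => (R.det_neg z hz).ne) c b a)

/-- The four-velocity. -/
def u (R : S.Regular U) (a : Fin 4) : smoothAlg U := toAlg (R.u_smooth a)

/-- The direction of the magnetic field. -/
def n (R : S.Regular U) (a : Fin 4) : smoothAlg U := toAlg (R.n_smooth a)

/-- The field strength. -/
def H (R : S.Regular U) : smoothAlg U := toAlg R.H_smooth

/-- Evaluation at a point is an algebra homomorphism, so an identity in the ring yields the same
identity between components at each point. These equations hold by definition and make the
translation automatic. -/
theorem ev_G (R : S.Regular U) (z : U) (a b : Fin 4) : ev z (R.G a b) = S.g z a b := rfl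
theorem ev_Gi (R : S.Regular U) (z : U) (a b : Fin 4) : ev z (R.Gi a b) = ginv S.g z a b := rfl
theorem ev_Γ (R : S.Regular U) (z : U) (a b c : Fin 4) : ev z (R.Γ b c a) = Gam S.g c b a z := rfl
theorem ev_u (R : S.Regular U) (z : U) (a : Fin 4) : ev z (R.u a) = S.u z a := rfl
theorem ev_n (R : S.Regular U) (z : U) (a : Fin 4) : ev z (R.n a) = S.n z a := rfl
theorem ev_H (R : S.Regular U) (z : U) : ev z R.H = S.H z := rfl

theorem ev_D (R : S.Regular U) (x : smoothAlg U) {f : Pt → ℝ} (h : ∀ z : U, ev z x = f z) (z : U) (a : Fin 4) :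
    ev z (R.D a x) = pd a f z := ev_der R.isOpen x h z a

theorem ev_DG (R : S.Regular U) (z : U) (a b c : Fin 4) :
    ev z (R.D c (R.G a b)) = pd c (fun y => S.g y a b) z := R.ev_D _ (fun _ => rfl) z c

theorem pd_g_symm (R : S.Regular U) (z : U) (a b c : Fin 4) :
    pd c (fun y => S.g y a b) z = pd c (fun y => S.g y b a) z :=
  pd_congr R.isOpen (fun y hy => R.symm y hy a b) z.2 c

theorem Gam_symm (R : S.Regular U) (z : U) (a b c : Fin 4) : Gam S.g a b c z = Gam S.g a c b z := by
  simp only [Gam]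
  congr 1
  refine Finset.sum_congr rfl fun d _ => ?_
  rw [R.pd_g_symm z b c d]; ring

theorem g_mul_ginv (R : S.Regular U) (z : U) (a b : Fin 4) :
    ∑ c, S.g z a c * ginv S.g z c b = if a = b then 1 else 0 := by
  have := Matrix.mul_nonsing_inv (S.g z) (isUnit_iff_ne_zero.mpr (R.det_neg z z.2).ne)
  rw [← Matrix.one_apply, ← this, Matrix.mul_apply]; rfl

theorem lower_Gam (R : S.Regular U) (z : U) (a b c : Fin 4) :
    ∑ d, S.g z a d * Gam S.g d b c z = (1 / 2) * (pd b (fun y => S.g y a c) z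
      + pd c (fun y => S.g y a b) z - pd a (fun y => S.g y b c) z) := by
  have h : ∑ d, S.g z a d * Gam S.g d b c z = (1 / 2) * ∑ e, (∑ d, S.g z a d * ginv S.g z d e)
      * (pd b (fun y => S.g y e c) z + pd c (fun y => S.g y e b) z
        - pd e (fun y => S.g y b c) z) := by
    simp only [Gam, Finset.mul_sum, Finset.sum_mul]
    rw [Finset.sum_comm]
    exact Finset.sum_congr rfl fun e _ => Finset.sum_congr rfl fun d _ => by ring
  rw [h]; simp [R.g_mul_ginv]

/-- The link that makes every identity over the ring available for the given metric. For
compatibility, four of the six derivatives of g in the two lowered Christoffel symbols cancel and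
the other two coincide. -/
theorem leviCivita (R : S.Regular U) : DiffRing.LeviCivita R.D R.G R.Gi R.Γ where
  symm := by
    ext1 a b
    exact ext_ev fun z => R.symm z z.2 b a
  inv := by
    ext1 a b
    refine ext_ev fun z => ?_
    simp only [Matrix.mul_apply, map_sum, map_mul, ev_G, ev_Gi, R.g_mul_ginv, Matrix.one_apply]
    split_ifs <;> simp
  torsion a b c := ext_ev fun z => R.Gam_symm z c b a
  compat b := by
    ext1 i j
    refine ext_ev fun z => ?_
    have h1 : ∑ c, Gam S.g c b i z * S.g z c j = ∑ c, S.g z j c * Gam S.g c b i z :=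
      Finset.sum_congr rfl fun c _ => by rw [R.symm z z.2 j c, mul_comm]
    simp only [Matrix.add_apply, Matrix.mul_apply, Matrix.map_apply, Matrix.transpose_apply,
      map_add, map_sum, map_mul, ev_G, ev_Γ, ev_DG, h1, R.lower_Gam]
    rw [R.pd_g_symm z j i b, R.pd_g_symm z j b i, R.pd_g_symm z i b j]
    ring

theorem commuting (R : S.Regular U) : DiffRing.Commuting R.D := der_comm R.isOpen

theorem ev_ric (R : S.Regular U) (z : U) (a b : Fin 4) : ev z (DiffRing.ric R.D R.Γ a b) = ricci S.g z a b := by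
  have ht := R.leviCivita.torsion
  have hG : ∀ a b c d, ev z (R.D d (R.Γ b c a)) = pd d (Gam S.g c b a) z := fun a b c d =>
    R.ev_D _ (fun _ => rfl) z d
  simp only [DiffRing.ric, DiffRing.curv, Matrix.of_apply, Matrix.add_apply, Matrix.sub_apply,
    Matrix.map_apply, Matrix.mul_apply, map_sum, map_add, map_sub, map_mul, ricci,
    Finset.sum_add_distrib, Finset.sum_sub_distrib]
  have e1 : ∀ c, ev z (R.D c (R.Γ b c a)) = pd c (Gam S.g c a b) z := fun c => by
    rw [ht a b c, hG]
  have e2 : ∀ c, ev z (R.D b (R.Γ c c a)) = pd b (Gam S.g c a c) z := fun c => by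
    rw [ht a c c, hG]
  simp only [e1, e2, ev_Γ]
  simp only [R.Gam_symm z _ _ a]

theorem ev_nabla (R : S.Regular U) {V : Vec} {W : Fin 4 → smoothAlg U} (h : ∀ (z : U) a, ev z (W a) = V z a)
    (z : U) (a b : Fin 4) : ev z (DiffRing.nabla R.D R.Γ W a b) = dVec S.g V z a b := by
  simp only [DiffRing.nabla, Matrix.of_apply, map_add, map_sum, map_mul, ev_Γ, h, dVec]
  rw [R.ev_D (W a) (f := fun y => V y a) (fun z => h z a)]

theorem ev_mulVec (R : S.Regular U) {V : Vec} {W : Fin 4 → smoothAlg U} (h : ∀ (z : U) a, ev z (W a) = V z a)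
    (z : U) (a : Fin 4) : ev z ((R.G *ᵥ W) a) = lower S.g V z a := by
  simp only [Matrix.mulVec, dotProduct, map_sum, map_mul, ev_G, h, lower]

theorem ev_lower_nabla (R : S.Regular U) {V : Vec} {W : Fin 4 → smoothAlg U} (h : ∀ (z : U) a, ev z (W a) = V z a)
    (z : U) (a b : Fin 4) :
    ev z ((R.G * DiffRing.nabla R.D R.Γ W) a b) = dCov S.g (lower S.g V) z a b := by
  rw [← R.leviCivita.nabla_lower]
  simp only [map_sub, map_sum, map_mul, ev_Γ, R.ev_mulVec h, dCov]
  rw [R.ev_D ((R.G *ᵥ W) a) (f := fun y => lower S.g V y a) (fun z => R.ev_mulVec h z a)]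

theorem huu (R : S.Regular U) : R.u ⬝ᵥ R.G *ᵥ R.u = -1 := ext_ev fun z => by
  simp only [dotProduct, map_sum, map_mul, R.ev_mulVec R.ev_u, ev_u, map_neg, map_one]
  exact R.uu z z.2

theorem hnn (R : S.Regular U) : R.n ⬝ᵥ R.G *ᵥ R.n = 1 := ext_ev fun z => by
  simp only [dotProduct, map_sum, map_mul, R.ev_mulVec R.ev_n, ev_n, map_one]
  exact R.nn z z.2

theorem hun (R : S.Regular U) : R.u ⬝ᵥ R.G *ᵥ R.n = 0 := ext_ev fun z => by
  simp only [dotProduct, map_sum, map_mul, R.ev_mulVec R.ev_n, ev_u, map_zero]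
  exact R.un z z.2

theorem hnu (R : S.Regular U) : R.n ⬝ᵥ R.G *ᵥ R.u = 0 := by
  rw [DiffRing.dot_mulVec_symm R.leviCivita.symm, R.hun]

theorem dCov_eq (R : S.Regular U) {V : Vec} {W : Fin 4 → smoothAlg U} (h : ∀ (z : U) a, ev z (W a) = V z a)
    (z : U) (a b : Fin 4) :
    dCov S.g (lower S.g V) z a b = ∑ c, S.g z a c * dVec S.g V z c b := by
  rw [← R.ev_lower_nabla h, Matrix.mul_apply]
  simp only [map_sum, map_mul, ev_G, R.ev_nabla h]

/-- The covariant derivative of a constant scalar product vanishes. -/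
theorem inner_const (R : S.Regular U) {V V' : Vec} {W W' : Fin 4 → smoothAlg U}
    (h : ∀ (z : U) a, ev z (W a) = V z a) (h' : ∀ (z : U) a, ev z (W' a) = V' z a) (z : U)
    (b : Fin 4) (hc : R.D b (W ⬝ᵥ R.G *ᵥ W') = 0) :
    ∑ a, V' z a * dCov S.g (lower S.g V) z a b + ∑ a, V z a * dCov S.g (lower S.g V') z a b = 0 := by
  rw [R.leviCivita.deriv_inner] at hc
  have := congrArg (ev z) hc
  simpa only [Matrix.vecMul, dotProduct, map_add, map_sum, map_mul, R.ev_lower_nabla h,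
    R.ev_lower_nabla h', h, h', map_zero] using this

theorem u_du (R : S.Regular U) (z : U) (b : Fin 4) : ∑ a, S.u z a * S.du z a b = 0 := by
  have := R.inner_const R.ev_u R.ev_u z b (by rw [R.huu]; simp)
  simp only [du, ul]; linarith

theorem n_dn (R : S.Regular U) (z : U) (b : Fin 4) : ∑ a, S.n z a * S.dn z a b = 0 := by
  have := R.inner_const R.ev_n R.ev_n z b (by rw [R.hnn]; simp)
  simp only [dn, nl]; linarith

theorem n_du (R : S.Regular U) (z : U) (b : Fin 4) : ∑ a, S.n z a * S.du z a b = -∑ a, S.u z a * S.dn z a b := by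
  have := R.inner_const R.ev_u R.ev_n z b (by rw [R.hun]; simp)
  simp only [du, ul, dn, nl]; linarith

end Regular

end Fields

end Coord

/-! ### Maxwell's equation as a divergence -/

namespace DiffRing

variable {A : Type*} [CommRing A] [Algebra ℝ A]
variable {D : Fin 4 → Derivation ℝ A A} {Γ : Fin 4 → Matrix (Fin 4) (Fin 4) A}

theorem nabla_smul (f : A) (V : Fin 4 → A) (a b : Fin 4) :
    nabla D Γ (f • V) a b = D b f * V a + f * nabla D Γ V a b := by
  simp only [nabla, Matrix.of_apply, Pi.smul_apply, smul_eq_mul, Derivation.leibniz, mul_add,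
    Finset.mul_sum]
  have : ∑ c, Γ b a c * (f * V c) = ∑ c, f * (Γ b a c * V c) :=
    Finset.sum_congr rfl fun c _ => by ring
  rw [this]; ring

end DiffRing

namespace Coord

namespace Fields

/-- A special conformal Killing vector `xi n` in a coordinate patch, in presence of the homogeneous
Maxwell equation and of Einstein's equations. -/
structure StringCKV (S : Fields) (U : Set Pt) (lam Lam : ℝ) (xi psi : Pt → ℝ) : Prop
    extends S.Regular U where
  xi_smooth : ContDiffOn ℝ ∞ xi U
  psi_smooth : ContDiffOn ℝ ∞ psi U
  xi_pos : ∀ z ∈ U, 0 < xi z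
  lie : ∀ z ∈ U, ∀ a b,
    lieMetric S.g (fun y c => xi y * S.n y c) z a b = 2 * psi z * S.g z a b
  special : ∀ z ∈ U, ∀ a b, hess S.g psi z a b = 0
  maxwell : ∀ z ∈ U, S.MaxwellAt z
  einstein : ∀ z ∈ U, S.EinsteinAt lam Lam z

namespace Regular

variable {S : Fields} {U : Set Pt}

theorem contDiffOn_density (R : S.Regular U) : ContDiffOn ℝ ∞ (fun z => √(-(S.g z).det)) U :=
  (contDiffOn_det R.g_smooth).neg.sqrt fun z hz => by
    have := R.det_neg z hz
    linarith

/-- The density `√(-det g)`. -/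
def s (R : S.Regular U) : smoothAlg U := toAlg R.contDiffOn_density

/-- The inverse of the density. -/
def si (R : S.Regular U) : smoothAlg U := toAlg (R.contDiffOn_density.inv fun z hz => by
  have := R.det_neg z hz
  exact (Real.sqrt_pos.mpr (by linarith)).ne')

theorem ev_s (R : S.Regular U) (z : U) : ev z R.s = √(-(S.g z).det) := rfl
theorem ev_si (R : S.Regular U) (z : U) : ev z R.si = (√(-(S.g z).det))⁻¹ := rfl

theorem ev_det (R : S.Regular U) (z : U) : ev z R.G.det = (S.g z).det := by
  rw [AlgHom.map_det]; rfl

theorem s_mul_s (R : S.Regular U) : R.s * R.s = -R.G.det := ext_ev fun z => by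
  have := R.det_neg z z.2
  rw [map_mul, ev_s, map_neg, ev_det, Real.mul_self_sqrt (by linarith)]

theorem s_mul_si (R : S.Regular U) : R.s * R.si = 1 := ext_ev fun z => by
  have := R.det_neg z z.2
  rw [map_mul, ev_s, ev_si, map_one, mul_inv_cancel₀ (Real.sqrt_pos.mpr (by linarith)).ne']

/-- The density of `H^k u^l - H^l u^k`. -/
def wedge (R : S.Regular U) (k l : Fin 4) : smoothAlg U :=
  R.s * ((R.H • R.n) k * R.u l - (R.H • R.n) l * R.u k)

/-- Lowering all four indices of η multiplies the symbol by det g, so (-det g)^{-1/2} becomes -(-det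
g)^{1/2}. The covariant field is then the symbol contracted with the contravariant H and u, times a
density. -/
theorem emLow_eq (R : S.Regular U) (z : U) (a b : Fin 4) :
    S.emLow z a b = -∑ k, ∑ l, levi a b k l * (√(-(S.g z).det) * (S.Hv z k * S.u z l)) := by
  have hl : ∀ V : Vec, lower S.g V z = V z ᵥ* S.g z := fun V => by
    ext e
    simp only [lower, Matrix.vecMul, dotProduct]
    exact Finset.sum_congr rfl fun k _ => by rw [R.symm z z.2, mul_comm]
  have hX := hl S.Hv
  have hu : S.ul z = S.u z ᵥ* S.g z := hl S.u
  have h1 : S.emLow z a b = (√(-(S.g z).det))⁻¹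
      * Matrix.det (Matrix.of ![S.g z a, S.g z b, lower S.g S.Hv z, S.ul z]) := by
    rw [← levi_contract]
    simp only [emLow, emUp, eta, Matrix.of_apply, Finset.mul_sum]
    exact Finset.sum_congr rfl fun c _ => Finset.sum_congr rfl fun d _ =>
      Finset.sum_congr rfl fun e _ => Finset.sum_congr rfl fun f _ => by ring
  -- All four rows are lowered by the same matrix g, which can be factored out of the determinant.
  have h2 : Matrix.of ![S.g z a, S.g z b, lower S.g S.Hv z, S.ul z]
      = Matrix.of ![Pi.single a 1, Pi.single b 1, S.Hv z, S.u z] * S.g z := by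
    rw [hX, hu]
    ext i j
    fin_cases i
    · simp [Matrix.mul_apply, Pi.single_apply]
    · simp [Matrix.mul_apply, Pi.single_apply]
    · rfl
    · rfl
  rw [h1, h2, Matrix.det_mul, ← levi_contract]
  have h3 : ∑ c, ∑ d, ∑ k, ∑ l, levi c d k l * (Pi.single a 1 : Fin 4 → ℝ) c
      * (Pi.single b 1 : Fin 4 → ℝ) d * S.Hv z k * S.u z l
      = ∑ k, ∑ l, levi a b k l * (S.Hv z k * S.u z l) := by
    rw [Finset.sum_eq_single a (by intro c _ hc; simp [hc]) (by simp),
      Finset.sum_eq_single b (by intro c _ hc; simp [hc]) (by simp)]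
    simp [mul_assoc]
  rw [h3]
  have hd := R.det_neg z z.2
  have hs : √(-(S.g z).det) * √(-(S.g z).det) = -(S.g z).det := Real.mul_self_sqrt (by linarith)
  have hne : √(-(S.g z).det) ≠ 0 := (Real.sqrt_pos.mpr (by linarith)).ne'
  have h4 : (√(-(S.g z).det))⁻¹ * (S.g z).det = -√(-(S.g z).det) := by
    field_simp; linear_combination hs
  have h5 : ∑ k, ∑ l, levi a b k l * (√(-(S.g z).det) * (S.Hv z k * S.u z l))
      = √(-(S.g z).det) * ∑ k, ∑ l, levi a b k l * (S.Hv z k * S.u z l) := by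
    simp only [Finset.mul_sum]
    exact Finset.sum_congr rfl fun k _ => Finset.sum_congr rfl fun l _ => by ring
  rw [h5]
  linear_combination (∑ k, ∑ l, levi a b k l * (S.Hv z k * S.u z l)) * h4

theorem emLow_antisymm (R : S.Regular U) (z : U) (a b : Fin 4) :
    S.emLow z a b = -S.emLow z b a := by
  rw [R.emLow_eq, R.emLow_eq]
  simp only [levi_swap₁ a b, neg_mul, Finset.sum_neg_distrib, neg_neg]

/-- Maxwell's equation with partial derivatives. -/
theorem cyclic_pd (R : S.Regular U) (z : U) (h : S.MaxwellAt z) (a b c : Fin 4) :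
    pd c (fun y => S.emLow y a b) z + pd a (fun y => S.emLow y b c) z
      + pd b (fun y => S.emLow y c a) z = 0 := by
  have h0 := h a b c
  simp only [dTen] at h0
  have e : ∀ a b c, ∑ d, Gam S.g d a c z * S.emLow z d b = -∑ d, Gam S.g d c a z * S.emLow z b d := by
    intro a b c
    rw [← Finset.sum_neg_distrib]
    exact Finset.sum_congr rfl fun d _ => by
      rw [R.emLow_antisymm z d b, R.Gam_symm z d a c]; ring
  rw [e a b c, e b c a, e c a b] at h0
  linarith

/-- Maxwell's equation as the divergence of a bivector density. -/
theorem div_wedge_density (R : S.Regular U) (h : ∀ z ∈ U, S.MaxwellAt z) (k : Fin 4) :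
    ∑ l, R.D l (R.wedge k l) = 0 := by
  have hQ : ∀ (z : U) a b, S.emLow z a b = -∑ k, ∑ l, levi a b k l
      * ev z (R.s * ((R.H • R.n) k * R.u l)) := fun z a b => R.emLow_eq z a b
  have hw : ∀ (z : U) k l, ev z (R.wedge k l)
      = ev z (R.s * ((R.H • R.n) k * R.u l)) - ev z (R.s * ((R.H • R.n) l * R.u k)) := by
    intro z k l
    rw [wedge, ← map_sub, ← mul_sub]
  -- Up to sign, each component of the bivector density is the component of F with complementary
  -- indices.
  have hl := fun z : U => levi_pairs fun k l => ev z (R.s * ((R.H • R.n) k * R.u l))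
  simp only [← hw] at hl
  have f01 : ∀ z : U, ev z (R.wedge 2 3) = -S.emLow z 0 1 := fun z => by
    rw [hQ, (hl z).1, neg_neg]
  have f02 : ∀ z : U, ev z (R.wedge 3 1) = -S.emLow z 0 2 := fun z => by
    rw [hQ, (hl z).2.1, neg_neg]
  have f03 : ∀ z : U, ev z (R.wedge 1 2) = -S.emLow z 0 3 := fun z => by
    rw [hQ, (hl z).2.2.1, neg_neg]
  have f12 : ∀ z : U, ev z (R.wedge 0 3) = -S.emLow z 1 2 := fun z => by
    rw [hQ, (hl z).2.2.2.1, neg_neg]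
  have f13 : ∀ z : U, ev z (R.wedge 2 0) = -S.emLow z 1 3 := fun z => by
    rw [hQ, (hl z).2.2.2.2.1, neg_neg]
  have f23 : ∀ z : U, ev z (R.wedge 0 1) = -S.emLow z 2 3 := fun z => by
    rw [hQ, (hl z).2.2.2.2.2, neg_neg]
  have wa : ∀ k l, R.wedge k l = -R.wedge l k := fun k l => by simp only [wedge]; ring
  have f10 : ∀ z : U, ev z (R.wedge 3 2) = -S.emLow z 1 0 := fun z => by
    rw [wa, map_neg, f01, R.emLow_antisymm z 1 0]
  have f20 : ∀ z : U, ev z (R.wedge 1 3) = -S.emLow z 2 0 := fun z => by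
    rw [wa, map_neg, f02, R.emLow_antisymm z 2 0]
  have f30 : ∀ z : U, ev z (R.wedge 2 1) = -S.emLow z 3 0 := fun z => by
    rw [wa, map_neg, f03, R.emLow_antisymm z 3 0]
  have f21 : ∀ z : U, ev z (R.wedge 3 0) = -S.emLow z 2 1 := fun z => by
    rw [wa, map_neg, f12, R.emLow_antisymm z 2 1]
  have f31 : ∀ z : U, ev z (R.wedge 0 2) = -S.emLow z 3 1 := fun z => by
    rw [wa, map_neg, f13, R.emLow_antisymm z 3 1]
  have f32 : ∀ z : U, ev z (R.wedge 1 0) = -S.emLow z 3 2 := fun z => by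
    rw [wa, map_neg, f23, R.emLow_antisymm z 3 2]
  have dw : ∀ (z : U) (k l a b c : Fin 4), (∀ z : U, ev z (R.wedge k l) = -S.emLow z a b) →
      ev z (R.D c (R.wedge k l)) = -pd c (fun y => S.emLow y a b) z := by
    intro z k l a b c hh
    rw [R.ev_D _ (f := -fun y => S.emLow y a b) hh]
    simp [pd, fderiv_neg]
  have diag : ∀ k, R.wedge k k = 0 := fun k => by simp only [wedge]; ring
  refine ext_ev fun z => ?_
  have c := fun a b c => R.cyclic_pd z (h z z.2) a b c
  rw [map_sum, Fin.sum_univ_four, map_zero]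
  have d0 : ∀ k, ev z (R.D k (R.wedge k k)) = 0 := fun k => by rw [diag]; simp
  -- The component k of the divergence is the cyclic identity for the three indices different from
  -- k; their order fixes the signs.
  match k with
  | 0 => linarith [c 1 2 3, d0 0, dw z _ _ _ _ 1 f23, dw z _ _ _ _ 2 f31, dw z _ _ _ _ 3 f12]
  | 1 => linarith [c 0 3 2, d0 1, dw z _ _ _ _ 0 f32, dw z _ _ _ _ 2 f03, dw z _ _ _ _ 3 f20]
  | 2 => linarith [c 0 1 3, d0 2, dw z _ _ _ _ 0 f13, dw z _ _ _ _ 1 f30, dw z _ _ _ _ 3 f01]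
  | 3 => linarith [c 0 2 1, d0 3, dw z _ _ _ _ 0 f21, dw z _ _ _ _ 1 f02, dw z _ _ _ _ 2 f10]

end Regular

end Fields

end Coord

/-! ### Conformal Killing and Maxwell equations at a point -/

namespace Coord

namespace Fields

namespace StringCKV

variable {S : Fields} {U : Set Pt} {lam Lam : ℝ} {xi psi : Pt → ℝ}

/-- The norm of the conformal Killing vector. -/
def x (C : S.StringCKV U lam Lam xi psi) : smoothAlg U := toAlg C.xi_smooth

/-- The conformal factor. -/
def ps (C : S.StringCKV U lam Lam xi psi) : smoothAlg U := toAlg C.psi_smooth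

theorem lie_eq (C : S.StringCKV U lam Lam xi psi) :
    ∑ d, (C.x • C.n) d • C.G.map (C.D d)
      + (C.G * DiffRing.jac C.D (C.x • C.n) + (DiffRing.jac C.D (C.x • C.n))ᵀ * C.G)
      = (2 * C.ps) • C.G := by
  ext1 a b
  refine ext_ev fun z => ?_
  have h := C.lie z z.2 a b
  have hV : ∀ (z : U) c, ev z ((C.x • C.n) c) = xi z * S.n z c := fun z c => rfl
  have hD : ∀ c d, ev z (C.D d ((C.x • C.n) c)) = pd d (fun y => xi y * S.n y c) z := fun c d =>
    C.ev_D _ (f := fun y => xi y * S.n y c) (fun z => hV z c) z d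
  have h2 : ev z (2 * C.ps) = 2 * psi z := by rw [map_mul, map_ofNat]; rfl
  simp only [Matrix.add_apply, Matrix.sum_apply, Matrix.smul_apply, Matrix.map_apply,
    Matrix.mul_apply, Matrix.transpose_apply, DiffRing.jac, Matrix.of_apply, smul_eq_mul, map_add,
    map_sum, map_mul, hV, hD, Regular.ev_DG, Regular.ev_G, lieMetric] at h ⊢
  rw [map_ofNat, show ev z C.ps = psi z from rfl, ← h]
  have e : ∑ c, pd a (fun y => xi y * S.n y c) z * S.g z c b
      = ∑ c, S.g z c b * pd a (fun y => xi y * S.n y c) z :=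
    Finset.sum_congr rfl fun _ _ => mul_comm _ _
  rw [e]; ring

theorem hess_eq (C : S.StringCKV U lam Lam xi psi) (a b : Fin 4) :
    C.D b (C.D a C.ps) = ∑ c, C.Γ b c a * C.D c C.ps := by
  refine ext_ev fun z => ?_
  have h := C.special z z.2 a b
  have hD : ∀ (z : U) c, ev z (C.D c C.ps) = pd c psi z := fun z c =>
    C.ev_D _ (fun _ => rfl) z c
  rw [C.ev_D _ (f := fun y => pd a psi y) (fun z => hD z a)]
  simp only [map_sum, map_mul, Regular.ev_Γ, hD]
  simp only [hess, dCov] at h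
  simp only [C.Gam_symm z _ b a]
  linarith

theorem ckv_eq (C : S.StringCKV U lam Lam xi psi) (z : U) (a b : Fin 4) :
    S.nl z a * pd b xi z + S.nl z b * pd a xi z + xi z * (S.dn z a b + S.dn z b a)
      = 2 * psi z * S.g z a b := by
  have h0 := C.lie_eq
  rw [C.leviCivita.lie_metric] at h0
  have hl : ∀ a b, (C.G * DiffRing.nabla C.D C.Γ (C.x • C.n)) a b
      = C.D b C.x * (C.G *ᵥ C.n) a + C.x * (C.G * DiffRing.nabla C.D C.Γ C.n) a b := by
    intro a b
    simp only [Matrix.mul_apply, DiffRing.nabla_smul, Matrix.mulVec, dotProduct, Finset.mul_sum,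
      ← Finset.sum_add_distrib]
    exact Finset.sum_congr rfl fun c _ => by ring
  have ht : ((DiffRing.nabla C.D C.Γ (C.x • C.n))ᵀ * C.G)
      = (C.G * DiffRing.nabla C.D C.Γ (C.x • C.n))ᵀ := by
    rw [Matrix.transpose_mul, C.leviCivita.symm]
  rw [ht] at h0
  have h1 := congrArg (ev z) (congrFun (congrFun h0 a) b)
  have hD : ∀ c, ev z (C.D c C.x) = pd c xi z := fun c => C.ev_D _ (fun _ => rfl) z c
  simp only [Matrix.add_apply, Matrix.transpose_apply, hl, map_add, map_mul, Matrix.smul_apply,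
    smul_eq_mul, C.ev_mulVec C.ev_n, C.ev_lower_nabla C.ev_n, hD, map_ofNat, Regular.ev_G] at h1
  have hx : ev z C.x = xi z := rfl
  have hp : ev z C.ps = psi z := rfl
  rw [hx, hp] at h1
  simp only [nl, dn]
  linarith

/-- The divergence of the bivector H^k u^l - H^l u^k, in which the alternating tensor no longer
occurs. The product rule separates the gradient of H from the derivatives of n. -/
theorem maxwell_eq (C : S.StringCKV U lam Lam xi psi) (z : U) (k : Fin 4) :
    (∑ l, pd l S.H z * S.u z l) * S.n z k + S.H z * S.nDot z k + S.H z * S.theta z * S.n z k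
    - S.H z * S.uStar z k
    - (∑ l, pd l S.H z * S.n z l + S.H z * ∑ l, dVec S.g S.n z l l) * S.u z k = 0 := by
  have h0 := C.leviCivita.div_wedge C.s_mul_s C.s_mul_si (C.H • C.n) C.u k
    (C.div_wedge_density C.maxwell k)
  have h1 := congrArg (ev z) h0
  have hD : ∀ c, ev z (C.D c C.H) = pd c S.H z := fun c => C.ev_D _ (fun _ => rfl) z c
  simp only [map_add, map_sub, Matrix.mulVec, dotProduct, Matrix.trace, Matrix.diag, map_sum,
    map_mul, DiffRing.nabla_smul, C.ev_nabla C.ev_n, C.ev_nabla C.ev_u, hD, Regular.ev_u,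
    Regular.ev_n, Regular.ev_H, Pi.smul_apply, smul_eq_mul, map_zero] at h1
  rw [← h1]
  simp only [nDot, uStar, theta, add_mul, Finset.sum_add_distrib, Finset.mul_sum, Finset.sum_mul]
  have e1 : ∀ x : Fin 4, pd x S.H z * S.n z k * S.u z x = pd x S.H z * S.u z x * S.n z k :=
    fun _ => by ring
  simp only [e1]
  have e2 : ∀ x : Fin 4, dVec S.g S.u z x x * (S.H z * S.n z k)
      = S.H z * dVec S.g S.u z x x * S.n z k := fun _ => by ring
  have e3 : ∀ x : Fin 4, dVec S.g S.u z k x * (S.H z * S.n z x)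
      = S.H z * (dVec S.g S.u z k x * S.n z x) := fun _ => by ring
  simp only [e2, e3, mul_assoc]

theorem firstOrder (C : S.StringCKV U lam Lam xi psi) (z : U) :
    S.FirstOrder z (xi z) (psi z) (fun a => pd a xi z) (fun a => pd a S.H z) where
  symm := C.symm z z.2
  det_neg := C.det_neg z z.2
  uu := by rw [← C.uu z z.2]; exact Finset.sum_congr rfl fun _ _ => mul_comm _ _
  nn := by rw [← C.nn z z.2]; exact Finset.sum_congr rfl fun _ _ => mul_comm _ _
  un := by
    have := congrArg (ev z) C.hnu
    simp only [dotProduct, map_sum, map_mul, C.ev_mulVec C.ev_u, Regular.ev_n, map_zero] at this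
    rw [← this]; exact Finset.sum_congr rfl fun _ _ => mul_comm _ _
  nu := by rw [← C.un z z.2]; exact Finset.sum_congr rfl fun _ _ => mul_comm _ _
  H_pos := C.H_pos z z.2
  xi_pos := C.xi_pos z z.2
  du_eq := C.dCov_eq C.ev_u z
  dn_eq := C.dCov_eq C.ev_n z
  u_du := C.u_du z
  n_dn := C.n_dn z
  n_du := C.n_du z
  ckv := C.ckv_eq z
  maxwell := C.maxwell_eq z

end StringCKV

/-! ### Einstein's equations and the conservation laws -/

namespace FirstOrder

variable {S : Fields} {z : Pt} {xi psi : ℝ} {dxi dH : Fin 4 → ℝ}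

theorem ginv_ul (F : S.FirstOrder z xi psi dxi dH) (a : Fin 4) :
    ∑ b, ginv S.g z a b * S.ul z b = S.u z a := F.ginv_lower (S.u z) a

theorem ginv_nl (F : S.FirstOrder z xi psi dxi dH) (a : Fin 4) :
    ∑ b, ginv S.g z a b * S.nl z b = S.n z a := F.ginv_lower (S.n z) a

theorem stress_eq (S : Fields) (z : Pt) (lam : ℝ) (a b : Fin 4) :
    S.stress lam z a b = (S.mu z + S.pp z + lam * S.H z ^ 2)
        * (S.ul z a * S.ul z b - S.nl z a * S.nl z b)
      + (S.pp z + (1 / 2) * lam * S.H z ^ 2) * S.g z a b := by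
  simp only [stress, p, h]; ring

theorem stressTrace_eq (F : S.FirstOrder z xi psi dxi dH) (lam : ℝ) :
    S.stressTrace lam z = 2 * (S.pp z - S.mu z) := by
  have e1 : ∑ a, ∑ b, ginv S.g z a b * S.g z a b = 4 := by
    have : ∀ a, ∑ b, ginv S.g z a b * S.g z a b = 1 := fun a => by
      have := F.ginv_g a a
      rw [if_pos rfl] at this
      rw [← this]; exact Finset.sum_congr rfl fun b _ => by rw [F.symm]
    simp [this]
  have e2 : ∑ a, ∑ b, ginv S.g z a b * (S.ul z a * S.ul z b) = -1 := by
    rw [← F.uu]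
    refine Finset.sum_congr rfl fun a _ => ?_
    rw [← F.ginv_ul, Finset.mul_sum]
    exact Finset.sum_congr rfl fun b _ => by ring
  have e3 : ∑ a, ∑ b, ginv S.g z a b * (S.nl z a * S.nl z b) = 1 := by
    rw [← F.nn]
    refine Finset.sum_congr rfl fun a _ => ?_
    rw [← F.ginv_nl, Finset.mul_sum]
    exact Finset.sum_congr rfl fun b _ => by ring
  have e4 : S.stressTrace lam z = (S.mu z + S.pp z + lam * S.H z ^ 2)
      * (∑ a, ∑ b, ginv S.g z a b * (S.ul z a * S.ul z b)
        - ∑ a, ∑ b, ginv S.g z a b * (S.nl z a * S.nl z b))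
      + (S.pp z + (1 / 2) * lam * S.H z ^ 2) * ∑ a, ∑ b, ginv S.g z a b * S.g z a b := by
    simp only [stressTrace, stress_eq, ← Finset.sum_sub_distrib, Finset.mul_sum,
      ← Finset.sum_add_distrib]
    exact Finset.sum_congr rfl fun a _ => Finset.sum_congr rfl fun b _ => by ring
  rw [e4, e1, e2, e3]; ring

end FirstOrder

namespace StringCKV

variable {S : Fields} {U : Set Pt} {lam Lam : ℝ} {xi psi : Pt → ℝ}

theorem contDiffOn_E (C : S.StringCKV U lam Lam xi psi) :
    ContDiffOn ℝ ∞ (fun z => S.mu z + (1 / 2) * lam * S.H z ^ 2 + Lam) U :=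
  (C.mu_smooth.add (contDiffOn_const.mul (C.H_smooth.pow 2))).add contDiffOn_const

theorem contDiffOn_β (C : S.StringCKV U lam Lam xi psi) :
    ContDiffOn ℝ ∞ (fun z => S.pp z + (1 / 2) * lam * S.H z ^ 2 - Lam) U :=
  (C.pp_smooth.add (contDiffOn_const.mul (C.H_smooth.pow 2))).sub contDiffOn_const

/-- `μ + ½λH² + Λ`. -/
def E (C : S.StringCKV U lam Lam xi psi) : smoothAlg U := toAlg C.contDiffOn_E

/-- `p_⊥ + ½λH² - Λ`. -/
def β (C : S.StringCKV U lam Lam xi psi) : smoothAlg U := toAlg C.contDiffOn_β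

theorem ricci_eq (C : S.StringCKV U lam Lam xi psi) (z : U) (a b : Fin 4) :
    ricci S.g z a b = (S.mu z + S.pp z + lam * S.H z ^ 2)
        * (S.ul z a * S.ul z b - S.nl z a * S.nl z b)
      + (S.mu z + (1 / 2) * lam * S.H z ^ 2 + Lam) * S.g z a b := by
  rw [C.einstein z z.2 a b, (C.firstOrder z).stressTrace_eq, FirstOrder.stress_eq]
  ring

/-- The trace T = 2(p_⊥ - μ) turns the coefficient of the metric into μ + ½λH² + Λ, which is `E`.
The sum β + E is μ + p_⊥ + λH², where Λ cancels. -/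
theorem ric_eq (C : S.StringCKV U lam Lam xi psi) :
    DiffRing.ric C.D C.Γ = DiffRing.stringRic C.G C.u C.n C.β C.E := by
  ext1 a b
  refine ext_ev fun z => ?_
  have hE : ev z C.E = S.mu z + (1 / 2) * lam * S.H z ^ 2 + Lam := rfl
  have hβ : ev z C.β = S.pp z + (1 / 2) * lam * S.H z ^ 2 - Lam := rfl
  rw [C.ev_ric, C.ricci_eq]
  simp only [DiffRing.stringRic, Matrix.add_apply, Matrix.smul_apply, Matrix.sub_apply,
    Matrix.vecMulVec_apply, smul_eq_mul, map_add, map_mul, map_sub, C.ev_mulVec C.ev_u,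
    C.ev_mulVec C.ev_n, Regular.ev_G, hE, hβ]
  simp only [ul, nl]
  ring

theorem bianchi (C : S.StringCKV U lam Lam xi psi) {V : Vec} {W : Fin 4 → smoothAlg U}
    (h : ∀ (z : U) a, ev z (W a) = V z a)
    (hV : (C.u ⬝ᵥ C.G *ᵥ W) • C.u - (C.n ⬝ᵥ C.G *ᵥ W) • C.n = -W) (z : U) :
    along V (fun z => S.mu z + (1 / 2) * lam * S.H z ^ 2 + Lam) z
      = -(S.mu z + S.pp z + lam * S.H z ^ 2) * (∑ a, dVec S.g V z a a
        + ∑ a, S.ul z a * ∑ b, dVec S.g V z a b * S.u z b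
        - ∑ a, S.nl z a * ∑ b, dVec S.g V z a b * S.n z b) := by
  have h1 := congrArg (ev z)
    (C.leviCivita.string_bianchi C.commuting C.ric_eq C.huu C.hnn hV)
  have hE : ev z C.E = S.mu z + (1 / 2) * lam * S.H z ^ 2 + Lam := rfl
  have hβ : ev z C.β = S.pp z + (1 / 2) * lam * S.H z ^ 2 - Lam := rfl
  have hD : ∀ c, ev z (C.D c C.E)
      = pd c (fun z => S.mu z + (1 / 2) * lam * S.H z ^ 2 + Lam) z :=
    fun c => C.ev_D _ (fun _ => rfl) z c
  simp only [map_add, map_sub, map_sum, map_mul, map_neg, dotProduct, Matrix.trace, Matrix.diag,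
    C.ev_nabla h, C.ev_mulVec C.ev_u, C.ev_mulVec C.ev_n, hD, h] at h1
  rw [along, h1, hE, hβ]
  have m : ∀ W' : Fin 4 → smoothAlg U, ∀ a, ev z ((DiffRing.nabla C.D C.Γ W *ᵥ W') a)
      = ∑ b, dVec S.g V z a b * ev z (W' b) := by
    intro W' a
    simp only [Matrix.mulVec, dotProduct, map_sum, map_mul, C.ev_nabla h]
  simp only [m, Regular.ev_u, Regular.ev_n, ul, nl]
  ring

/-- The conservation laws and the vanishing of `p_⊥ + ½λH² - Λ` at a point where `ψ ≠ 0`. -/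
theorem conservation (C : S.StringCKV U lam Lam xi psi) (z : U) (hp : psi z ≠ 0) :
    S.pp z + (1 / 2) * lam * S.H z ^ 2 - Lam = 0 ∧
    xi z * along S.n (fun z => S.mu z + (1 / 2) * lam * S.H z ^ 2 + Lam) z
      = -2 * psi z * (S.mu z + (1 / 2) * lam * S.H z ^ 2 + Lam) ∧
    S.H z * along S.u (fun z => S.mu z + (1 / 2) * lam * S.H z ^ 2 + Lam) z
      = (S.mu z + (1 / 2) * lam * S.H z ^ 2 + Lam) * along S.u S.H z := by
  have F := C.firstOrder z
  have hE : ev z C.E = S.mu z + (1 / 2) * lam * S.H z ^ 2 + Lam := rfl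
  have hβ : ev z C.β = S.pp z + (1 / 2) * lam * S.H z ^ 2 - Lam := rfl
  have hx : ev z C.x = xi z := rfl
  have hps : ev z C.ps = psi z := rfl
  have hDE : ∀ c, ev z (C.D c C.E)
      = pd c (fun z => S.mu z + (1 / 2) * lam * S.H z ^ 2 + Lam) z :=
    fun c => C.ev_D _ (fun _ => rfl) z c
  -- Two consequences of the invariance of the Ricci tensor: both R_ab u^a u^b = β and the scalar 2E
  -- - 2β are multiplied by -2ψ under differentiation along ξn.
  have a1 := congrArg (ev z) (C.leviCivita.lie_uu C.commuting C.lie_eq C.hess_eq C.ric_eq C.huu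
    C.hun)
  have a2 := congrArg (ev z) (C.leviCivita.lie_scalar C.commuting C.lie_eq C.hess_eq)
  rw [C.ric_eq, C.leviCivita.trace_stringRic_four C.huu C.hnn] at a2
  simp only [map_sum, map_mul, map_neg, Pi.smul_apply, smul_eq_mul, Regular.ev_n, hx,
    hβ, hps, hE, map_sub, two_mul, map_add] at a1 a2
  set e := S.mu z + (1 / 2) * lam * S.H z ^ 2 + Lam with he
  set b := S.pp z + (1 / 2) * lam * S.H z ^ 2 - Lam with hb
  have c1 : xi z * ∑ d, S.n z d * ev z (C.D d C.β) = -2 * psi z * b := by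
    rw [Finset.mul_sum]
    refine Eq.trans (Finset.sum_congr rfl fun d _ => ?_) (a1.trans ?_) <;> ring
  have c2 : xi z * (2 * (∑ d, S.n z d * ev z (C.D d C.E))
      - 2 * ∑ d, S.n z d * ev z (C.D d C.β)) = -2 * psi z * (2 * e - 2 * b) := by
    rw [Finset.mul_sum, Finset.mul_sum, ← Finset.sum_sub_distrib, Finset.mul_sum]
    refine Eq.trans (Finset.sum_congr rfl fun d _ => ?_) (a2.trans ?_) <;> ring
  have c3 : ∑ d, S.n z d * ev z (C.D d C.E)
      = along S.n (fun z => S.mu z + (1 / 2) * lam * S.H z ^ 2 + Lam) z := by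
    simp only [hDE, along]
  have bn := C.bianchi C.ev_n (by rw [C.hun, C.hnn]; simp) z
  have bu := C.bianchi C.ev_u (by
    rw [C.huu, C.hnu, zero_smul, sub_zero]
    exact funext fun i => neg_one_mul (C.u i)) z
  have nn : ∑ a, S.nl z a * ∑ b, dVec S.g S.n z a b * S.n z b = 0 := by
    have := F.lower_contract (S.n z) (S.nStar z)
    simp only [F.lower_nStar] at this
    rw [FirstOrder.sum_sum_swap] at this
    simp only [F.n_dn, zero_mul, Finset.sum_const_zero] at this
    exact this
  have uu : ∑ a, S.ul z a * ∑ b, dVec S.g S.u z a b * S.u z b = 0 := by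
    have h1 : ∀ b, ∑ c, S.g z b c * ∑ d, dVec S.g S.u z c d * S.u z d
        = ∑ d, S.du z b d * S.u z d := by
      intro b
      simp only [F.du_eq, Finset.mul_sum, Finset.sum_mul, mul_assoc]
      exact Finset.sum_comm
    have := F.lower_contract (S.u z) (fun a => ∑ b, dVec S.g S.u z a b * S.u z b)
    simp only [h1] at this
    refine this.trans ?_
    rw [FirstOrder.sum_sum_swap]
    simp only [F.u_du, zero_mul, Finset.sum_const_zero]
  have nu := F.ul_nDot
  have un := F.nl_uStar
  simp only [nDot] at nu
  simp only [uStar] at un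
  rw [nn, nu] at bn
  rw [uu, un] at bu
  rw [c3] at c2
  have k1 := F.div_n
  have k2 := F.u_dn_u
  have k3 := F.dH_u
  have heb : S.mu z + S.pp z + lam * S.H z ^ 2 = b + e := by rw [he, hb]; ring
  rw [heb] at bn bu
  -- `c1` and `c2` give ξE* = -2ψE. The Bianchi identity along n gives ξE* = -(β + E)(3ψ - ψ).
  -- Comparison leaves ψβ = 0.
  have b0 : b = 0 := by
    have h1 : psi z * b = 0 := by
      linear_combination -(1 / 4) * c2 - (1 / 2) * c1 + (1 / 2) * xi z * bn
        - (1 / 2) * (b + e) * (k1 + k2)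
    exact (mul_eq_zero.mp h1).resolve_left hp
  refine ⟨b0, ?_, ?_⟩
  · rw [b0] at c1 c2
    linear_combination (1 / 2) * c2 + c1
  -- With β = 0 the Bianchi identity along u reads E˙ = E(n^a u_{a;b} n^b - θ), and Maxwell's
  -- equation gives H the same logarithmic derivative.
  · have h2 : along S.u S.H z = ∑ l, pd l S.H z * S.u z l :=
      Finset.sum_congr rfl fun l _ => mul_comm _ _
    rw [h2, k3, bu, b0, theta]
    ring

end StringCKV

end Fields

end Coord

/-! ## The electric current, the vorticity and the screen rotation -/

namespace Coord

/-- The alternating symbol contracted with two vectors in the outer slots. -/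
def levi2 (w v : Fin 4 → ℝ) (b c : Fin 4) : ℝ := ∑ a, ∑ d, levi a b c d * w a * v d

theorem levi2_antisymm (w v : Fin 4 → ℝ) (b c : Fin 4) : levi2 w v c b = -levi2 w v b c := by
  simp only [levi2, levi_swap₂ _ b c, neg_mul, Finset.sum_neg_distrib]

theorem levi2_self (v : Fin 4 → ℝ) (b c : Fin 4) : levi2 v v b c = 0 := by
  have h : levi2 v v b c = -levi2 v v b c := by
    conv_lhs => rw [levi2, Finset.sum_comm]
    simp only [levi2, ← Finset.sum_neg_distrib]
    refine Finset.sum_congr rfl fun a _ => Finset.sum_congr rfl fun d _ => ?_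
    -- Exchanging the first and last slots takes five adjacent transpositions, an odd number.
    rw [levi_swap₁ b d, levi_swap₂ b c d a, levi_swap₃ b c a d, levi_swap₂ b a c d,
      levi_swap₁ a b]
    ring
  linarith

theorem sum_transpose_levi2 (w v : Fin 4 → ℝ) (M : Fin 4 → Fin 4 → ℝ) :
    ∑ b, ∑ c, M c b * levi2 w v b c = -∑ b, ∑ c, M b c * levi2 w v b c := by
  rw [Finset.sum_comm]
  simp only [← Finset.sum_neg_distrib]
  exact Finset.sum_congr rfl fun b _ => Finset.sum_congr rfl fun c _ => by
    rw [levi2_antisymm]; ring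

theorem sum_symm_levi2 (w v : Fin 4 → ℝ) {M : Fin 4 → Fin 4 → ℝ} (hM : ∀ b c, M b c = M c b) :
    ∑ b, ∑ c, M b c * levi2 w v b c = 0 := by
  have h := sum_transpose_levi2 w v M
  have e : ∑ b, ∑ c, M c b * levi2 w v b c = ∑ b, ∑ c, M b c * levi2 w v b c :=
    Finset.sum_congr rfl fun b _ => Finset.sum_congr rfl fun c _ => by rw [hM]
  rw [e] at h
  linarith

theorem sum_outer_levi2 (w v x y : Fin 4 → ℝ) :
    ∑ b, ∑ c, x b * y c * levi2 w v b c = Matrix.det (Matrix.of ![w, x, y, v]) := by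
  rw [← levi_contract]
  simp only [levi2, Finset.mul_sum]
  have e : ∀ b, ∑ c, ∑ a, ∑ d, x b * y c * (levi a b c d * w a * v d)
      = ∑ a, ∑ c, ∑ d, x b * y c * (levi a b c d * w a * v d) := fun b => Finset.sum_comm
  simp only [e]
  rw [Finset.sum_comm]
  exact Finset.sum_congr rfl fun a _ => Finset.sum_congr rfl fun b _ =>
    Finset.sum_congr rfl fun c _ => Finset.sum_congr rfl fun d _ => by ring

theorem sum_levi_eq (w v : Fin 4 → ℝ) (M : Fin 4 → Fin 4 → ℝ) :
    ∑ a, w a * ∑ b, ∑ c, ∑ d, levi a b c d * M b c * v d = ∑ b, ∑ c, M b c * levi2 w v b c := by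
  simp only [levi2, Finset.mul_sum]
  rw [Finset.sum_comm]
  refine Finset.sum_congr rfl fun b _ => ?_
  rw [Finset.sum_comm]
  exact Finset.sum_congr rfl fun c _ => Finset.sum_congr rfl fun a _ =>
    Finset.sum_congr rfl fun d _ => by ring

/-- The same contraction, with the matrix in the second and last slots. -/
theorem sum_levi_eq' (w v : Fin 4 → ℝ) (M : Fin 4 → Fin 4 → ℝ) :
    ∑ a, w a * ∑ b, ∑ c, ∑ d, levi a b c d * v c * M b d = ∑ b, ∑ c, M b c * levi2 v w b c := by
  simp only [levi2, Finset.mul_sum]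
  rw [Finset.sum_comm]
  refine Finset.sum_congr rfl fun b _ => ?_
  have e : ∀ a, ∑ c, ∑ d, w a * (levi a b c d * v c * M b d)
      = ∑ d, ∑ c, w a * (levi a b c d * v c * M b d) := fun a => Finset.sum_comm
  simp only [e]
  rw [Finset.sum_comm]
  refine Finset.sum_congr rfl fun d _ => ?_
  rw [Finset.sum_comm]
  refine Finset.sum_congr rfl fun c _ => Finset.sum_congr rfl fun a _ => ?_
  have h : levi c b d a = levi a b c d := by
    rw [levi_swap₁ b c d a, levi_swap₃ b c a d, levi_swap₂ b a c d, levi_swap₁ a b c d]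
    ring
  rw [h]
  ring

namespace Fields

namespace Regular

variable {S : Fields} {U : Set Pt}

/-- The current, with partial derivatives. -/
theorem current_eq (R : S.Regular U) (z : U) (a : Fin 4) :
    S.current z a = (√(-(S.g z).det))⁻¹ * ∑ b, ∑ c, ∑ d, levi a b c d
      * ((pd b S.H z * S.nl z c + S.H z * pd b (fun y => S.nl y c) z) * S.ul z d
        + S.H z * S.nl z c * pd b (fun y => S.ul y d) z) := by
  set Φ : Fin 4 → Fin 4 → smoothAlg U := fun a b =>
    ∑ c, ∑ d, levi a b c d • (R.H * (R.G *ᵥ R.n) c * (R.G *ᵥ R.u) d) with hΦ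
  have anti : ∀ a b, Φ a b = -Φ b a := by
    intro a b
    simp only [hΦ, levi_swap₁ a b, neg_smul, Finset.sum_neg_distrib, neg_neg]
  have hn : ∀ (z : U) c, ev z ((R.G *ᵥ R.n) c) = S.nl z c := fun z c => R.ev_mulVec R.ev_n z c
  have hu : ∀ (z : U) c, ev z ((R.G *ᵥ R.u) c) = S.ul z c := fun z c => R.ev_mulVec R.ev_u z c
  have hX : ∀ (z : U) c, lower S.g S.Hv z c = S.H z * S.nl z c := by
    intro z c
    simp only [lower, Hv, nl, Finset.mul_sum]
    exact Finset.sum_congr rfl fun _ _ => by ring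
  have hem : ∀ (z : U) a b, ev z (R.si * Φ a b) = S.emUp z a b := by
    intro z a b
    simp only [hΦ, map_mul, map_sum, map_smul, hn, hu, ev_H, ev_si, emUp, eta, Matrix.of_apply, hX,
      smul_eq_mul, Finset.mul_sum]
    exact Finset.sum_congr rfl fun c _ => Finset.sum_congr rfl fun d _ => by ring
  have hDH : ∀ b, ev z (R.D b R.H) = pd b S.H z := fun b => R.ev_D _ (fun _ => rfl) z b
  have hDn : ∀ b c, ev z (R.D b ((R.G *ᵥ R.n) c)) = pd b (fun y => S.nl y c) z := fun b c =>
    R.ev_D _ (f := fun y => S.nl y c) (fun z => hn z c) z b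
  have hDu : ∀ b c, ev z (R.D b ((R.G *ᵥ R.u) c)) = pd b (fun y => S.ul y c) z := fun b c =>
    R.ev_D _ (f := fun y => S.ul y c) (fun z => hu z c) z b
  have h1 := congrArg (ev z) (R.leviCivita.div_antisymm R.s_mul_s R.s_mul_si anti a)
  have hD : ∀ b, ev z (R.D b (R.si * Φ a b)) = pd b (fun y => S.emUp y a b) z := fun b =>
    R.ev_D _ (f := fun y => S.emUp y a b) (fun z => hem z a b) z b
  have h2 : ∀ b, ev z (R.D b (Φ a b)) = ∑ c, ∑ d, levi a b c d
      * ((pd b S.H z * S.nl z c + S.H z * pd b (fun y => S.nl y c) z) * S.ul z d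
        + S.H z * S.nl z c * pd b (fun y => S.ul y d) z) := by
    intro b
    simp only [hΦ, map_sum, Derivation.map_smul, map_smul, Derivation.leibniz, smul_eq_mul,
      map_add, map_mul, hn, hu, hDn, hDu, hDH, ev_H]
    exact Finset.sum_congr rfl fun c _ => Finset.sum_congr rfl fun d _ => by ring
  rw [map_mul, map_sum] at h1
  simp only [h2] at h1
  rw [ev_si] at h1
  rw [← h1, current, divTen]
  simp only [map_add, map_sum, map_mul (ev z) (R.Γ _ _ _), hem, hD, ev_Γ]

end Regular

namespace StringCKV

variable {S : Fields} {U : Set Pt} {lam Lam : ℝ} {xi psi : Pt → ℝ}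

/-- Contractions of the current with a covector. -/
theorem contract_current (R : S.Regular U) (z : U) (w : Fin 4 → ℝ) :
    ∑ a, w a * S.current z a = (√(-(S.g z).det))⁻¹
      * (∑ b, ∑ c, (pd b S.H z * S.nl z c + S.H z * pd b (fun y => S.nl y c) z)
            * levi2 w (S.ul z) b c
        + S.H z * ∑ b, ∑ c, pd b (fun y => S.ul y c) z * levi2 (S.nl z) w b c) := by
  rw [← sum_levi_eq, ← sum_levi_eq']
  simp only [R.current_eq]
  rw [Finset.mul_sum (s := Finset.univ) (a := S.H z), ← Finset.sum_add_distrib, Finset.mul_sum]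
  refine Finset.sum_congr rfl fun a _ => ?_
  rw [mul_left_comm, mul_left_comm (S.H z), ← mul_add]
  congr 2
  simp only [Finset.mul_sum, ← Finset.sum_add_distrib]
  exact Finset.sum_congr rfl fun b _ => Finset.sum_congr rfl fun c _ =>
    Finset.sum_congr rfl fun d _ => by ring

theorem pd_nl (S : Fields) (z : Pt) (b c : Fin 4) :
    pd b (fun y => S.nl y c) z = S.dn z c b + ∑ e, Gam S.g e c b z * S.nl z e := by
  simp only [dn, dCov]; ring

theorem pd_ul (S : Fields) (z : Pt) (b c : Fin 4) :
    pd b (fun y => S.ul y c) z = S.du z c b + ∑ e, Gam S.g e c b z * S.ul z e := by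
  simp only [du, dCov]; ring

/-- The Christoffel part is symmetric in b and c, so the antisymmetric symbol annihilates it and
partial derivatives may be replaced by covariant ones. The sign comes from writing the
differentiation index last. -/
theorem sum_pd_levi2 (R : S.Regular U) (z : U) (w v y : Fin 4 → ℝ) (P Q : Fin 4 → Fin 4 → ℝ)
    (hP : ∀ b c, P b c = Q c b + ∑ e, Gam S.g e c b z * y e) :
    ∑ b, ∑ c, P b c * levi2 w v b c = -∑ b, ∑ c, Q b c * levi2 w v b c := by
  rw [← sum_transpose_levi2]
  have h0 := sum_symm_levi2 w v (M := fun b c => ∑ e, Gam S.g e c b z * y e) fun b c =>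
    Finset.sum_congr rfl fun e _ => by rw [R.Gam_symm]
  simp only [hP, add_mul, Finset.sum_add_distrib]
  simp only [add_eq_left]
  exact h0

theorem omega_H (S : Fields) (z : Pt) :
    ∑ a, S.omega z a * lower S.g S.Hv z a = (1 / 2) * (√(-(S.g z).det))⁻¹ * S.H z
      * ∑ b, ∑ c, S.du z b c * levi2 (S.nl z) (S.ul z) b c := by
  rw [← sum_levi_eq, Finset.mul_sum]
  refine Finset.sum_congr rfl fun a _ => ?_
  have hX : lower S.g S.Hv z a = S.H z * S.nl z a := by
    simp only [lower, Hv, nl, Finset.mul_sum]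
    exact Finset.sum_congr rfl fun _ _ => by ring
  have h1 : ∑ b, ∑ c, ∑ d, eta S.g z a b c d * S.du z b c * S.ul z d
      = (√(-(S.g z).det))⁻¹ * ∑ b, ∑ c, ∑ d, levi a b c d * S.du z b c * S.ul z d := by
    simp only [eta, Finset.mul_sum]
    exact Finset.sum_congr rfl fun b _ => Finset.sum_congr rfl fun c _ =>
      Finset.sum_congr rfl fun d _ => by ring
  rw [omega, hX, h1]
  ring

/-- The charge density is `2 ω^a H_a`. -/
theorem charge_eq (R : S.Regular U) (z : U) :
    S.charge z = 2 * ∑ a, S.omega z a * lower S.g S.Hv z a := by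
  rw [charge, contract_current R, omega_H S, sum_pd_levi2 R z _ _ _ _ _ (pd_ul S z)]
  -- Contraction with u_a puts u in both outer slots of the first part of the current. The
  -- derivatives of H and n drop out, and only the curl of u is left.
  simp only [levi2_self, mul_zero, Finset.sum_const_zero]
  ring

/-- The conduction current along the magnetic field. -/
theorem conduction_H (C : S.StringCKV U lam Lam xi psi) (z : U) :
    ∑ b, S.conduction z b * lower S.g S.Hv z b = -(S.H z ^ 2 * (√(-(S.g z).det))⁻¹
      * ∑ b, ∑ c, S.dn z b c * levi2 (S.nl z) (S.ul z) b c) := by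
  have F := C.firstOrder z
  have hX : ∀ a, lower S.g S.Hv z a = S.H z * S.nl z a := fun a => by
    simp only [lower, Hv, nl, Finset.mul_sum]
    exact Finset.sum_congr rfl fun _ _ => by ring
  have h1 : ∀ b, S.conduction z b = S.current z b + (∑ c, S.ul z c * S.current z c) * S.u z b := by
    intro b
    simp only [conduction, hMix, add_mul, Finset.sum_add_distrib, ite_mul, one_mul, zero_mul,
      Finset.sum_ite_eq', Finset.mem_univ, if_true, Finset.sum_mul]
    congr 1
    exact Finset.sum_congr rfl fun c _ => by ring
  have h2 : ∑ b, S.conduction z b * lower S.g S.Hv z b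
      = S.H z * ∑ b, S.nl z b * S.current z b
        + S.H z * (∑ c, S.ul z c * S.current z c) * ∑ b, S.u z b * S.nl z b := by
    simp only [h1, hX]
    rw [Finset.mul_sum, Finset.mul_sum, ← Finset.sum_add_distrib]
    exact Finset.sum_congr rfl fun b _ => by ring
  have h3 : ∑ b, ∑ c, (pd b S.H z * S.nl z c + S.H z * pd b (fun y => S.nl y c) z)
      * levi2 (S.nl z) (S.ul z) b c
      = ∑ b, ∑ c, pd b S.H z * S.nl z c * levi2 (S.nl z) (S.ul z) b c
        + S.H z * ∑ b, ∑ c, pd b (fun y => S.nl y c) z * levi2 (S.nl z) (S.ul z) b c := by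
    simp only [Finset.mul_sum, ← Finset.sum_add_distrib]
    exact Finset.sum_congr rfl fun b _ => Finset.sum_congr rfl fun c _ => by ring
  -- The gradient of H is multiplied by a factor containing n twice. The derivatives of u disappear
  -- below for the same reason, so only the curl of n contributes.
  have h4 : ∑ b, ∑ c, pd b S.H z * S.nl z c * levi2 (S.nl z) (S.ul z) b c = 0 := by
    rw [sum_outer_levi2 _ _ (fun b => pd b S.H z)]
    exact Matrix.det_zero_of_row_eq (i := 0) (j := 2) (by decide) rfl
  rw [h2, F.u_n, contract_current C.toRegular, h3, h4, sum_pd_levi2 C.toRegular z _ _ _ _ _ (pd_nl S z)]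
  simp only [levi2_self, mul_zero, Finset.sum_const_zero]
  ring

end StringCKV

namespace FirstOrder

variable {S : Fields} {z : Pt} {xi psi : ℝ} {dxi dH : Fin 4 → ℝ}

theorem sum_pMix_n (F : S.FirstOrder z xi psi dxi dH) (e : Fin 4) :
    ∑ b, S.pMix z b e * S.n z b = 0 := by
  have : ∑ b, S.pMix z b e * S.n z b
      = S.n z e + (∑ b, S.n z b * S.ul z b) * S.u z e - (∑ b, S.n z b * S.nl z b) * S.n z e := by
    simp only [pMix, hMix, sub_mul, add_mul, Finset.sum_sub_distrib, Finset.sum_add_distrib,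
      ite_mul, one_mul, zero_mul, Finset.sum_ite_eq', Finset.mem_univ, if_true, Finset.sum_mul]
    congr 1
    · congr 1
      exact Finset.sum_congr rfl fun c _ => by ring
    · exact Finset.sum_congr rfl fun c _ => by ring
  rw [this, F.n_u, F.n_n]; ring

theorem screenRot_n (F : S.FirstOrder z xi psi dxi dH) (c : Fin 4) :
    ∑ b, S.screenRot z b c * S.n z b = 0 := by
  have : ∑ b, S.screenRot z b c * S.n z b
      = ∑ e, ∑ f, (∑ b, S.pMix z b e * S.n z b) * S.pMix z c f * ((S.dn z e f - S.dn z f e) / 2) := by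
    simp only [screenRot, Finset.sum_mul]
    rw [Finset.sum_comm]
    refine Finset.sum_congr rfl fun e _ => ?_
    rw [Finset.sum_comm]
    exact Finset.sum_congr rfl fun f _ => Finset.sum_congr rfl fun b _ => by ring
  rw [this]; simp [F.sum_pMix_n]

theorem screenRot_n' (F : S.FirstOrder z xi psi dxi dH) (b : Fin 4) :
    ∑ c, S.screenRot z b c * S.n z c = 0 := by
  have : ∑ c, S.screenRot z b c * S.n z c
      = ∑ e, ∑ f, (∑ c, S.pMix z c f * S.n z c) * S.pMix z b e * ((S.dn z e f - S.dn z f e) / 2) := by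
    simp only [screenRot, Finset.sum_mul]
    rw [Finset.sum_comm]
    refine Finset.sum_congr rfl fun e _ => ?_
    rw [Finset.sum_comm]
    exact Finset.sum_congr rfl fun f _ => Finset.sum_congr rfl fun b _ => by ring
  rw [this]; simp [F.sum_pMix_n]

/-- Covectors orthogonal to `n` annihilate the screen rotation vector. -/
theorem screenRot_levi2 (F : S.FirstOrder z xi psi dxi dH) {w : Fin 4 → ℝ}
    (hw : ∑ a, w a * S.n z a = 0) :
    ∑ b, ∑ c, S.screenRot z b c * levi2 w (S.ul z) b c = 0 := by
  have h1 : ∀ b c, S.screenRot z b c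
      = ∑ e, S.screenRot z b e * ((if e = c then 1 else 0) - S.n z e * S.nl z c) := by
    intro b c
    simp only [mul_sub, Finset.sum_sub_distrib, ← mul_assoc, ← Finset.sum_mul, F.screenRot_n',
      zero_mul, sub_zero]
    simp
  have h2 : ∑ b, ∑ c, S.screenRot z b c * levi2 w (S.ul z) b c
      = ∑ e, ∑ b, ∑ c, S.screenRot z b e * ((if e = c then 1 else 0) - S.n z e * S.nl z c)
        * levi2 w (S.ul z) b c := by
    conv_rhs => rw [Finset.sum_comm]
    refine Finset.sum_congr rfl fun b _ => ?_
    conv_rhs => rw [Finset.sum_comm]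
    exact Finset.sum_congr rfl fun c _ => by rw [← Finset.sum_mul, ← h1]
  rw [h2]
  refine Finset.sum_eq_zero fun e _ => ?_
  rw [sum_outer_levi2 w (S.ul z) (fun b => S.screenRot z b e)
    (fun c => (if e = c then 1 else 0) - S.n z e * S.nl z c)]
  -- All four rows annihilate the nonzero vector n, so the determinant vanishes.
  refine Matrix.exists_mulVec_eq_zero_iff.mp ⟨S.n z, fun h0 => ?_, ?_⟩
  · have := F.nn
    simp [h0] at this
  · ext i
    fin_cases i
    · exact hw
    · exact F.screenRot_n e
    · change ∑ c, ((if e = c then 1 else 0) - S.n z e * S.nl z c) * S.n z c = 0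
      simp only [sub_mul, Finset.sum_sub_distrib, mul_assoc, ← Finset.mul_sum, F.nn]
      simp
    · exact F.un

/-- The projections in the screen rotation may be omitted in its contraction with `u` and `n`. -/
theorem screenRot_levi2_nl (S : Fields) (z : Pt) :
    ∑ b, ∑ c, S.screenRot z b c * levi2 (S.nl z) (S.ul z) b c
      = ∑ b, ∑ c, S.dn z b c * levi2 (S.nl z) (S.ul z) b c := by
  set B : Fin 4 → Fin 4 → ℝ := fun e c => ∑ f, S.pMix z c f * ((S.dn z e f - S.dn z f e) / 2)
    with hB
  have h1 : ∀ b c, S.screenRot z b c = B b c + S.ul z b * (∑ e, S.u z e * B e c)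
      - S.nl z b * ∑ e, S.n z e * B e c := by
    intro b c
    rw [← sum_pMix S z b (fun e => B e c)]
    simp only [screenRot, hB, Finset.mul_sum, mul_assoc]
  have h2 : ∀ b c, B b c = (S.dn z b c - S.dn z c b) / 2
      + (∑ f, S.u z f * ((S.dn z b f - S.dn z f b) / 2)) * S.ul z c
      - (∑ f, S.n z f * ((S.dn z b f - S.dn z f b) / 2)) * S.nl z c := by
    intro b c
    rw [hB]
    simp only
    rw [sum_pMix S z c (fun f => (S.dn z b f - S.dn z f b) / 2)]
    ring
  -- Each term that the projectors add has u or n in one of the inner slots; as u and n also fill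
  -- the outer slots, the determinant has two equal rows.
  have o1 : ∀ y : Fin 4 → ℝ, ∑ b, ∑ c, S.ul z b * y c * levi2 (S.nl z) (S.ul z) b c = 0 := fun y => by
    rw [sum_outer_levi2]; exact Matrix.det_zero_of_row_eq (i := 1) (j := 3) (by decide) rfl
  have o2 : ∀ y : Fin 4 → ℝ, ∑ b, ∑ c, S.nl z b * y c * levi2 (S.nl z) (S.ul z) b c = 0 := fun y => by
    rw [sum_outer_levi2]; exact Matrix.det_zero_of_row_eq (i := 0) (j := 1) (by decide) rfl
  have o3 : ∀ x : Fin 4 → ℝ, ∑ b, ∑ c, x b * S.ul z c * levi2 (S.nl z) (S.ul z) b c = 0 := fun x => by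
    rw [sum_outer_levi2]; exact Matrix.det_zero_of_row_eq (i := 2) (j := 3) (by decide) rfl
  have o4 : ∀ x : Fin 4 → ℝ, ∑ b, ∑ c, x b * S.nl z c * levi2 (S.nl z) (S.ul z) b c = 0 := fun x => by
    rw [sum_outer_levi2]; exact Matrix.det_zero_of_row_eq (i := 0) (j := 2) (by decide) rfl
  have h3 := sum_transpose_levi2 (S.nl z) (S.ul z) (S.dn z)
  have h4 : ∑ b, ∑ c, (S.dn z b c - S.dn z c b) / 2 * levi2 (S.nl z) (S.ul z) b c
      = (1 / 2) * (∑ b, ∑ c, S.dn z b c * levi2 (S.nl z) (S.ul z) b c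
        - ∑ b, ∑ c, S.dn z c b * levi2 (S.nl z) (S.ul z) b c) := by
    simp only [Finset.mul_sum, ← Finset.sum_sub_distrib]
    exact Finset.sum_congr rfl fun b _ => Finset.sum_congr rfl fun c _ => by ring
  simp only [h1, add_mul, sub_mul, Finset.sum_add_distrib, Finset.sum_sub_distrib]
  rw [o1 (fun c => ∑ e, S.u z e * B e c), o2 (fun c => ∑ e, S.n z e * B e c)]
  simp only [h2, add_mul, sub_mul, Finset.sum_add_distrib, Finset.sum_sub_distrib]
  rw [o3 (fun b => ∑ f, S.u z f * ((S.dn z b f - S.dn z f b) / 2)),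
    o4 (fun b => ∑ f, S.n z f * ((S.dn z b f - S.dn z f b) / 2)), h4, h3]
  ring

/-- By `screenRot_levi2` every covector orthogonal to n annihilates ℛ^a, so the vector is a multiple
of n. The factor is its n component, where the projections may be omitted. -/
theorem screenRotVec_eq (F : S.FirstOrder z xi psi dxi dH) (a : Fin 4) :
    S.screenRotVec z a = (1 / 2) * (√(-(S.g z).det))⁻¹ * S.n z a
      * ∑ b, ∑ c, S.dn z b c * levi2 (S.nl z) (S.ul z) b c := by
  set v : Fin 4 → ℝ := fun a => ∑ b, ∑ c, ∑ d, levi a b c d * S.screenRot z b c * S.ul z d with hv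
  have h1 : S.screenRotVec z a = (1 / 2) * (√(-(S.g z).det))⁻¹ * v a := by
    simp only [screenRotVec, eta, hv, Finset.mul_sum]
    exact Finset.sum_congr rfl fun b _ => Finset.sum_congr rfl fun c _ =>
      Finset.sum_congr rfl fun d _ => by ring
  have h2 : ∑ e, ((if a = e then 1 else 0) - S.n z a * S.nl z e) * v e = 0 := by
    rw [hv, sum_levi_eq]
    refine F.screenRot_levi2 ?_
    simp only [sub_mul, Finset.sum_sub_distrib, mul_assoc, ← Finset.mul_sum, F.nn]
    simp
  have h3 : ∑ e, S.nl z e * v e = ∑ b, ∑ c, S.dn z b c * levi2 (S.nl z) (S.ul z) b c := by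
    rw [hv, sum_levi_eq, screenRot_levi2_nl]
  simp only [sub_mul, Finset.sum_sub_distrib, mul_assoc, ← Finset.mul_sum, h3, ite_mul, one_mul,
    zero_mul, Finset.sum_ite_eq, Finset.mem_univ, if_true] at h2
  rw [h1]
  linear_combination (1 / 2) * (√(-(S.g z).det))⁻¹ * h2

end FirstOrder

end Fields

end Coord

/-! ## The reduced equations in a coordinate patch -/

namespace Coord

theorem pd_log {f : Pt → ℝ} {z : Pt} (hf : DifferentiableAt ℝ f z) (h0 : f z ≠ 0) (a : Fin 4) :
    pd a (fun y => Real.log (f y)) z = pd a f z / f z := by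
  rw [pd, pd, fderiv.log hf h0]
  simp only [smul_apply, smul_eq_mul]
  ring

theorem along_log {f : Pt → ℝ} {z : Pt} (hf : DifferentiableAt ℝ f z) (h0 : f z ≠ 0) (V : Vec) :
    along V (fun y => Real.log (f y)) z = along V f z / f z := by
  simp only [along, pd_log hf h0, Finset.sum_div, mul_div_assoc]

theorem along_energy {f k : Pt → ℝ} {z : Pt} (hf : DifferentiableAt ℝ f z)
    (hk : DifferentiableAt ℝ k z) (lam Lam : ℝ) (V : Vec) :
    along V (fun y => f y + (1 / 2) * lam * k y ^ 2 + Lam) z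
      = along V f z + lam * k z * along V k z := by
  have h : ∀ a, pd a (fun y => f y + (1 / 2) * lam * k y ^ 2 + Lam) z
      = pd a f z + lam * k z * pd a k z := by
    intro a
    have h1 : HasFDerivAt (fun y => f y + (1 / 2) * lam * k y ^ 2 + Lam)
        (fderiv ℝ f z + ((1 / 2) * lam) • ((2 * k z ^ 1) • fderiv ℝ k z)) z := by
      have h2 := (hk.hasFDerivAt.pow 2).const_mul ((1 / 2) * lam)
      simpa using (hf.hasFDerivAt.add h2).add_const Lam
    rw [pd, pd, pd, h1.fderiv]
    simp only [add_apply, smul_apply, smul_eq_mul]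
    ring
  simp only [along, h, mul_add, Finset.sum_add_distrib, Finset.mul_sum]
  congr 1
  exact Finset.sum_congr rfl fun a _ => by ring

namespace Fields

theorem FirstOrder.ginv_p {S : Fields} {z : Pt} {xi psi : ℝ} {dxi dH : Fin 4 → ℝ}
    (F : S.FirstOrder z xi psi dxi dH) : ∑ a, ∑ b, ginv S.g z a b * S.p z a b = 2 := by
  have e1 : ∀ a, ∑ b, ginv S.g z a b * S.g z a b = 1 := fun a => by
    have := F.ginv_g a a
    rw [if_pos rfl] at this
    rw [← this]; exact Finset.sum_congr rfl fun b _ => by rw [F.symm]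
  have h1 : ∀ a, ∑ b, ginv S.g z a b * S.p z a b
      = 1 + S.ul z a * S.u z a - S.nl z a * S.n z a := by
    intro a
    rw [← e1 a, ← F.ginv_ul a, ← F.ginv_nl a, Finset.mul_sum, Finset.mul_sum,
      ← Finset.sum_add_distrib, ← Finset.sum_sub_distrib]
    exact Finset.sum_congr rfl fun b _ => by simp only [p, h]; ring
  simp only [h1, Finset.sum_add_distrib, Finset.sum_sub_distrib, F.uu, F.nn]
  norm_num

namespace StringCKV

variable {S : Fields} {U : Set Pt} {lam Lam : ℝ} {xi psi : Pt → ℝ}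

theorem factor_eq (C : S.StringCKV U lam Lam xi psi) (z : U) :
    xi z * along S.n S.H z = -(2 * psi z * S.H z) := by
  rw [← (C.firstOrder z).dH_n, along]
  exact congrArg _ (Finset.sum_congr rfl fun _ _ => mul_comm _ _)

/-- This is how the condition H* ≠ 0 acts: by ξH* = -2ψH it excludes zeros of the conformal factor,
and the conservation laws become available. -/
theorem factor_ne_zero (C : S.StringCKV U lam Lam xi psi) (z : U) (hH : along S.n S.H z ≠ 0) :
    psi z ≠ 0 := fun h0 => by
  have h := C.factor_eq z
  rw [h0] at h
  simp only [mul_zero, zero_mul, neg_zero, mul_eq_zero] at h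
  exact h.elim (C.xi_pos z z.2).ne' hH

/-- The Ricci tensor is a multiple of the screen projector. -/
theorem ricci_eq_p (C : S.StringCKV U lam Lam xi psi) (z : U) (hH : along S.n S.H z ≠ 0)
    (a b : Fin 4) :
    ricci S.g z a b = (S.mu z + (1 / 2) * lam * S.H z ^ 2 + Lam) * S.p z a b := by
  have h := (C.conservation z (C.factor_ne_zero z hH)).1
  rw [C.ricci_eq z]
  simp only [p, Fields.h]
  linear_combination (S.ul z a * S.ul z b - S.nl z a * S.nl z b) * h

theorem ricciScalar_eq (C : S.StringCKV U lam Lam xi psi) (z : U) (hH : along S.n S.H z ≠ 0) :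
    ricciScalar S.g z = 2 * (S.mu z + (1 / 2) * lam * S.H z ^ 2 + Lam) := by
  simp only [ricciScalar, C.ricci_eq_p z hH, mul_left_comm (ginv S.g z _ _), ← Finset.mul_sum,
    (C.firstOrder z).ginv_p]
  ring

/-- The functions E and H obey the same equation ξf* = -2ψf. -/
theorem along_n_energy (C : S.StringCKV U lam Lam xi psi) (z : U) (hH : along S.n S.H z ≠ 0) :
    S.H z * along S.n (fun z => S.mu z + (1 / 2) * lam * S.H z ^ 2 + Lam) z
      = (S.mu z + (1 / 2) * lam * S.H z ^ 2 + Lam) * along S.n S.H z := by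
  have h := (C.conservation z (C.factor_ne_zero z hH)).2.1
  refine mul_left_cancel₀ (C.xi_pos z z.2).ne' ?_
  linear_combination S.H z * h
    - (S.mu z + (1 / 2) * lam * S.H z ^ 2 + Lam) * C.factor_eq z

theorem lnHstar_eq (C : S.StringCKV U lam Lam xi psi) (z : U) :
    S.lnHstar z = along S.n S.H z / S.H z :=
  along_log (differentiableAt_of_contDiffOn C.isOpen C.H_smooth z.2) (C.H_pos z z.2).ne' _

theorem lnHdot_eq (C : S.StringCKV U lam Lam xi psi) (z : U) :
    S.lnHdot z = along S.u S.H z / S.H z :=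
  along_log (differentiableAt_of_contDiffOn C.isOpen C.H_smooth z.2) (C.H_pos z z.2).ne' _

theorem factor_div (C : S.StringCKV U lam Lam xi psi) (z : U) :
    psi z / xi z = -(1 / 2) * S.lnHstar z := by
  have h1 := (C.xi_pos z z.2).ne'
  have h2 := (C.H_pos z z.2).ne'
  rw [C.lnHstar_eq]
  field_simp
  linear_combination C.factor_eq z

/-- The reduced field equations of a string fluid with a special conformal Killing vector along the
magnetic field. -/
theorem reduced (C : S.StringCKV U lam Lam xi psi) (z : U) (hH : along S.n S.H z ≠ 0) :
    along S.n S.mu z - (S.mu z - (1 / 2) * lam * S.H z ^ 2 + Lam) * S.lnHstar z = 0 ∧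
    along S.u S.mu z - (S.mu z + S.pp z) * S.lnHdot z = 0 ∧
    (∀ a b, S.screenShear z a b = 0) ∧
    S.screenExp z = -S.lnHstar z ∧
    (∀ a, S.nDot z a = -(1 / 2) * S.lnHstar z * S.u z a
      + ∑ b, ∑ c, S.pUp z a b * S.sigma z b c * S.n z c) ∧
    (∀ a, S.nStar z a = along S.n (fun y => Real.log (xi y)) z * S.n z a
      - ∑ b, ginv S.g z a b * pd b (fun y => Real.log (xi y)) z) ∧
    (∀ a, S.greenberg z a = 0) ∧
    S.sigmaNN z - (2 / 3) * S.theta z = S.lnHdot z ∧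
    S.charge z = 2 * ∑ a, S.omega z a * lower S.g S.Hv z a ∧
    (∀ a, S.screenRotVec z a
      = -((∑ b, S.conduction z b * lower S.g S.Hv z b) / (2 * S.H z ^ 3)) * S.Hv z a) := by
  have F := C.firstOrder z
  have hHz := (C.H_pos z z.2).ne'
  have hx := (C.xi_pos z z.2).ne'
  have dmu := differentiableAt_of_contDiffOn C.isOpen C.mu_smooth z.2
  have dH := differentiableAt_of_contDiffOn C.isOpen C.H_smooth z.2
  have dxi := differentiableAt_of_contDiffOn C.isOpen C.xi_smooth z.2
  obtain ⟨hb, -, hu⟩ := C.conservation z (C.factor_ne_zero z hH)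
  have hn := C.along_n_energy z hH
  rw [along_energy dmu dH] at hn hu
  refine ⟨?_, ?_, F.screenShear_eq_zero, ?_, fun a => ?_, fun a => ?_, F.greenberg_eq_zero, ?_,
    charge_eq C.toRegular z, fun a => ?_⟩
  · rw [C.lnHstar_eq]
    field_simp
    -- Here E* = μ* + λHH*. Moving the field term across changes ½λH² in E into -½λH².
    linear_combination 2 * hn
  · rw [C.lnHdot_eq]
    field_simp
    -- The same rearrangement gives the coefficient μ - ½λH² + Λ, which equals μ + p_⊥ because β =
    -- 0.
    linear_combination hu - along S.u S.H z * hb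
  · rw [F.screenExp_eq, C.factor_div]; ring
  · rw [F.nDot_eq, C.factor_div]
  · rw [along_log dxi hx]
    have h1 : along S.n xi z = psi z := F.dxi_n
    have h2 : ∑ b, ginv S.g z a b * pd b (fun y => Real.log (xi y)) z
        = (∑ b, ginv S.g z a b * pd b xi z) / xi z := by
      rw [Finset.sum_div]
      exact Finset.sum_congr rfl fun b _ => by rw [pd_log dxi hx]; ring
    rw [h1, h2]
    field_simp
    linear_combination F.nStar_eq a
  · have h1 : along S.u S.H z = ∑ l, pd l S.H z * S.u z l :=
      Finset.sum_congr rfl fun _ _ => mul_comm _ _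
    rw [C.lnHdot_eq, h1, F.dH_u, mul_div_cancel_left₀ _ hHz, F.sigmaNN_eq]
    ring
  · rw [F.screenRotVec_eq, C.conduction_H, Hv]
    field_simp

end StringCKV

end Fields

end Coord

/-! ## From the manifold to its charts -/

theorem Coord.along_div {f k : Coord.Pt → ℝ} {z : Coord.Pt} (hf : DifferentiableAt ℝ f z)
    (hk : DifferentiableAt ℝ k z) (h0 : k z ≠ 0) (V : Coord.Vec) :
    along V (fun y => f y / k y) z = (k z * along V f z - f z * along V k z) / k z ^ 2 := by
  have h : ∀ a, pd a (fun y => f y / k y) z = (k z * pd a f z - f z * pd a k z) / k z ^ 2 := by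
    intro a
    have h1 := hf.hasFDerivAt.mul ((hasDerivAt_inv h0).comp_hasFDerivAt z hk.hasFDerivAt)
    have h2 : (fun y => f y / k y) = f * ((fun x => x⁻¹) ∘ k) := by
      ext y; simp [div_eq_mul_inv]
    rw [pd, pd, pd, h2, h1.fderiv]
    simp only [smul_apply, add_apply, smul_eq_mul, Function.comp_apply]
    field_simp
    ring
  simp only [along, h, Finset.mul_sum, ← Finset.sum_sub_distrib, Finset.sum_div]
  exact Finset.sum_congr rfl fun a _ => by ring

section Bridge

variable {M : Type*} [TopologicalSpace M] [ChartedSpace Coord.Pt M] [IsManifold (𝓡 4) ∞ M]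
  {e : OpenPartialHomeomorph M Coord.Pt} {z : Coord.Pt}

/-- The components of a tangent vector in a chart. -/
def tangentComp (e : OpenPartialHomeomorph M Coord.Pt) (z : Coord.Pt)
    (v : TangentSpace (𝓡 4) (e.symm z)) (a : Fin 4) : ℝ :=
  (show Coord.Pt from mfderiv (𝓡 4) (𝓡 4) e (e.symm z) v) a

theorem isManifold_one (M : Type*) [TopologicalSpace M] [ChartedSpace Coord.Pt M]
    [IsManifold (𝓡 4) ∞ M] : IsManifold (𝓡 4) 1 M := IsManifold.of_le (n := ∞) (by decide)

/-- The differential of the chart is injective and sends the coordinate frame to the standard basis,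
where the expansion is clear. -/
theorem sum_tangentComp (he : e ∈ atlas Coord.Pt M) (hz : z ∈ e.target)
    (v : TangentSpace (𝓡 4) (e.symm z)) : ∑ a, tangentComp e z v a • frame e a z = v := by
  have := isManifold_one M
  have hd : e.MDifferentiable (𝓡 4) (𝓡 4) := mdifferentiable_of_mem_atlas he
  apply hd.mfderiv_injective (e.map_target hz)
  have h1 : ∀ a, mfderiv (𝓡 4) (𝓡 4) e (e.symm z) (frame e a z)
      = (EuclideanSpace.single a (1 : ℝ) : Coord.Pt) := fun a =>
    congrArg (fun L => L (EuclideanSpace.single a (1 : ℝ) : Coord.Pt)) (hd.comp_symm_deriv hz)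
  rw [map_sum]
  simp only [map_smul, h1]
  set w : Coord.Pt := mfderiv (𝓡 4) (𝓡 4) e (e.symm z) v with hw
  have h2 : ∑ a, w a • (EuclideanSpace.single a (1 : ℝ) : Coord.Pt) = w := by
    ext i
    simp [Pi.single_apply]
  exact h2

theorem bilin_eq (g : (x : M) → LinearMap.BilinForm ℝ (TangentSpace (𝓡 4) x))
    (he : e ∈ atlas Coord.Pt M) (hz : z ∈ e.target) (v w : TangentSpace (𝓡 4) (e.symm z)) :
    g (e.symm z) v w
      = ∑ a, ∑ b, tangentComp e z v a * tangentComp e z w b * metricComp g e z a b := by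
  conv_lhs => rw [← sum_tangentComp he hz v, ← sum_tangentComp he hz w]
  simp only [map_sum, map_smul, LinearMap.sum_apply, LinearMap.smul_apply, smul_eq_mul, metricComp,
    Matrix.of_apply]
  rw [Finset.sum_comm]
  refine Finset.sum_congr rfl fun a _ => ?_
  simp only [Finset.mul_sum, mul_assoc]
  exact Finset.sum_congr rfl fun b _ => by ring

/-- The change to an orthonormal basis, with matrix P, gives det g · (det P)² = -1. -/
theorem LorentzMetric.det_neg (g : LorentzMetric M) (he : e ∈ atlas Coord.Pt M)
    (hz : z ∈ e.target) : (metricComp g.val e z).det < 0 := by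
  obtain ⟨b, hb⟩ := g.signature (e.symm z)
  set P : Matrix (Fin 4) (Fin 4) ℝ := Matrix.of fun i a => tangentComp e z (b i) a with hP
  have h1 : P * metricComp g.val e z * Pᵀ
      = Matrix.diagonal fun i : Fin 4 => if i = 0 then (-1 : ℝ) else 1 := by
    ext i j
    rw [Matrix.diagonal_apply, ← hb i j, bilin_eq g.val he hz]
    simp only [Matrix.mul_apply, Matrix.transpose_apply, hP, Matrix.of_apply, Finset.sum_mul]
    rw [Finset.sum_comm]
    exact Finset.sum_congr rfl fun a _ => Finset.sum_congr rfl fun c _ => by ring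
  have h2 := congrArg Matrix.det h1
  rw [Matrix.det_mul, Matrix.det_mul, Matrix.det_transpose, Matrix.det_diagonal] at h2
  have h3 : ∏ i : Fin 4, (if i = 0 then (-1 : ℝ) else 1) = -1 := by simp
  rw [h3] at h2
  nlinarith [sq_nonneg P.det]

theorem SmoothScalar.contDiffOn {f : M → ℝ} (hf : SmoothScalar f) (he : e ∈ atlas Coord.Pt M) :
    ContDiffOn ℝ ∞ (f ∘ e.symm) e.target :=
  contMDiffOn_iff_contDiffOn.1 (ContMDiff.comp_contMDiffOn hf
    (contMDiffOn_symm_of_mem_maximalAtlas (IsManifold.subset_maximalAtlas he)))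

theorem mfderiv_eq_along {f : M → ℝ} (hf : SmoothScalar f) (he : e ∈ atlas Coord.Pt M)
    (hz : z ∈ e.target) (V : (x : M) → TangentSpace (𝓡 4) x) :
    mfderiv (𝓡 4) 𝓘(ℝ) f (e.symm z) (V (e.symm z)) = Coord.along (vecComp V e) (f ∘ e.symm) z := by
  have := isManifold_one M
  have hd : e.MDifferentiable (𝓡 4) (𝓡 4) := mdifferentiable_of_mem_atlas he
  have h1 : ∀ a, mfderiv (𝓡 4) 𝓘(ℝ) f (e.symm z) (frame e a z) = Coord.pd a (f ∘ e.symm) z := by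
    intro a
    rw [frame, ← mfderiv_comp_apply z (hf.mdifferentiableAt (by decide))
      (hd.mdifferentiableAt_symm hz), mfderiv_eq_fderiv]
    rfl
  conv_lhs => rw [← sum_tangentComp he hz (V (e.symm z))]
  rw [map_sum]
  simp only [map_smul, h1]
  rfl

theorem exists_chart (x : M) :
    ∃ e ∈ atlas Coord.Pt M, ∃ z ∈ e.target, e.symm z = x :=
  ⟨chartAt _ x, chart_mem_atlas _ x, chartAt _ x x, mem_chart_target _ x,
    (chartAt _ x).left_inv (mem_chart_source _ x)⟩

/-- By the chain rule `f ∘ γ` has zero derivative on an interval, which is convex. -/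
theorem ConstAlong.of_mfderiv {V : (x : M) → TangentSpace (𝓡 4) x} {f : M → ℝ}
    (hf : SmoothScalar f) (h : ∀ x, mfderiv (𝓡 4) 𝓘(ℝ) f x (V x) = (0 : ℝ)) : ConstAlong V f := by
  intro γ a b hγ s hs t ht
  have hd : ∀ t ∈ Set.Ioo a b, HasFDerivWithinAt (f ∘ γ) (0 : ℝ →L[ℝ] ℝ) (Set.Ioo a b) t := by
    intro t ht
    have h1 := ((hf.mdifferentiableAt (x := γ t) (by decide)).hasMFDerivAt).comp_hasMFDerivWithinAt
      t (hγ t ht)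
    have h2 := hasMFDerivWithinAt_iff_hasFDerivWithinAt.1 h1
    refine h2.congr_fderiv ?_
    ext
    refine Eq.trans ?_ (h (γ t))
    exact congrArg (mfderiv (𝓡 4) 𝓘(ℝ) f (γ t)) (one_smul ℝ (V (γ t)))
  exact ((convex_Ioo a b).is_const_of_fderivWithin_eq_zero
    (fun t ht => (hd t ht).differentiableWithinAt)
    (fun t ht => (hd t ht).fderivWithin (isOpen_Ioo.uniqueDiffWithinAt ht)) hs ht)

/-! ### The magnetofluid in the charts of the manifold -/

namespace Magnetofluid

variable {S : Magnetofluid M} {ξ ψ : M → ℝ}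

theorem regular (S : Magnetofluid M) (he : e ∈ atlas Coord.Pt M) :
    (S.inChart e).Regular e.target where
  isOpen := e.open_target
  g_smooth := S.g.smooth e he
  u_smooth := S.u_smooth e he
  n_smooth := S.n_smooth e he
  H_smooth := S.H_smooth.contDiffOn he
  mu_smooth := S.mu_smooth.contDiffOn he
  pp_smooth := S.pp_smooth.contDiffOn he
  symm _ _ _ _ := S.g.symm _ _ _
  det_neg _ hz := S.g.det_neg he hz
  uu z hz := by
    rw [← S.u_unit (e.symm z), bilin_eq S.g.val he hz]
    simp only [Coord.Fields.ul, Coord.lower, Finset.mul_sum]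
    exact Finset.sum_congr rfl fun a _ => Finset.sum_congr rfl fun b _ => by
      rw [mul_assoc, mul_comm (tangentComp _ _ _ b)]; rfl
  nn z hz := by
    rw [← S.n_unit (e.symm z), bilin_eq S.g.val he hz]
    simp only [Coord.Fields.nl, Coord.lower, Finset.mul_sum]
    exact Finset.sum_congr rfl fun a _ => Finset.sum_congr rfl fun b _ => by
      rw [mul_assoc, mul_comm (tangentComp _ _ _ b)]; rfl
  un z hz := by
    rw [← S.u_orth_n (e.symm z), bilin_eq S.g.val he hz]
    simp only [Coord.Fields.nl, Coord.lower, Finset.mul_sum]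
    exact Finset.sum_congr rfl fun a _ => Finset.sum_congr rfl fun b _ => by
      rw [mul_assoc, mul_comm (tangentComp _ _ _ b)]; rfl
  H_pos _ _ := S.H_pos _

theorem stringCKV (hS : S.IsEMSF) (hξ : S.IsProperSpecialCKV ξ ψ) (he : e ∈ atlas Coord.Pt M) :
    (S.inChart e).StringCKV e.target S.lam S.Lam (ξ ∘ e.symm) (ψ ∘ e.symm) where
  toRegular := S.regular he
  xi_smooth := hξ.smooth.contDiffOn he
  psi_smooth := hξ.factor_smooth.contDiffOn he
  xi_pos _ _ := hξ.pos _
  lie := hξ.lie_eq e he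
  special := hξ.special e he
  maxwell z hz := (hS e he z hz).1
  einstein z hz := (hS e he z hz).2

theorem along_H_ne_zero (hH : ∀ x, S.star S.H x ≠ 0) (he : e ∈ atlas Coord.Pt M)
    (hz : z ∈ e.target) : Coord.along (S.inChart e).n (S.inChart e).H z ≠ 0 := fun h =>
  hH (e.symm z) ((mfderiv_eq_along S.H_smooth he hz S.n).trans h)

/-- The energy density of matter, field and vacuum. -/
def energy (S : Magnetofluid M) (x : M) : ℝ := S.mu x + (1 / 2) * S.lam * S.H x ^ 2 + S.Lam

theorem energy_smooth (S : Magnetofluid M) : SmoothScalar S.energy :=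
  ((S.mu_smooth.add (contMDiff_const.mul (S.H_smooth.pow 2))).add contMDiff_const)

/-- The scalar `R` is computed at each point in the preferred chart there. Its identification with
the globally defined smooth function `energy` replaces separate proofs that it is smooth and
independent of the chart. -/
theorem R_eq (hS : S.IsEMSF) (hξ : S.IsProperSpecialCKV ξ ψ) (hH : ∀ x, S.star S.H x ≠ 0) (x : M) :
    S.R x = 2 * S.energy x := by
  have h := (stringCKV hS hξ (chart_mem_atlas Coord.Pt x)).ricciScalar_eq
    ⟨_, mem_chart_target Coord.Pt x⟩ (along_H_ne_zero hH (chart_mem_atlas _ x) (mem_chart_target _ x))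
  have hx : (chartAt Coord.Pt x).symm (chartAt Coord.Pt x x) = x :=
    (chartAt _ x).left_inv (mem_chart_source _ x)
  refine Eq.trans h ?_
  simp only [inChart, Function.comp_apply, hx, energy]

/-- By the quotient rule in a chart, the hypothesis on `V` is the vanishing of the numerator of the
derivative of E/H. -/
theorem along_energy_div_eq_zero {V : (x : M) → TangentSpace (𝓡 4) x}
    (hV : ∀ e ∈ atlas Coord.Pt M, ∀ z ∈ e.target,
      S.H (e.symm z) * Coord.along (vecComp V e) (S.energy ∘ e.symm) z
        = S.energy (e.symm z) * Coord.along (vecComp V e) (S.H ∘ e.symm) z) (x : M) :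
    mfderiv (𝓡 4) 𝓘(ℝ) (fun x => S.energy x / S.H x) x (V x) = (0 : ℝ) := by
  have hs : SmoothScalar fun x => S.energy x / S.H x :=
    S.energy_smooth.div₀ S.H_smooth fun x => (S.H_pos x).ne'
  obtain ⟨e, he, z, hz, rfl⟩ := exists_chart x
  refine (mfderiv_eq_along hs he hz V).trans ?_
  refine (Coord.along_div
    (Coord.differentiableAt_of_contDiffOn e.open_target (S.energy_smooth.contDiffOn he) hz)
    (Coord.differentiableAt_of_contDiffOn e.open_target (S.H_smooth.contDiffOn he) hz)
    (S.H_pos _).ne' _).trans ?_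
  simp only [Function.comp_apply]
  rw [hV e he z hz, sub_self, zero_div]

theorem constAlong_R_div {V : (x : M) → TangentSpace (𝓡 4) x} (hR : ∀ x, S.R x = 2 * S.energy x)
    (hV : ∀ e ∈ atlas Coord.Pt M, ∀ z ∈ e.target,
      S.H (e.symm z) * Coord.along (vecComp V e) (S.energy ∘ e.symm) z
        = S.energy (e.symm z) * Coord.along (vecComp V e) (S.H ∘ e.symm) z) :
    ConstAlong V fun x => S.R x / S.H x := by
  intro γ a b hγ s hs t ht
  have h := ConstAlong.of_mfderiv (S.energy_smooth.div₀ S.H_smooth fun x => (S.H_pos x).ne')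
    (along_energy_div_eq_zero hV) γ a b hγ s hs t ht
  simp only [hR, mul_div_assoc]
  exact congrArg _ h

end Magnetofluid

end Bridge

end

theorem mainTheorem2 {M : Type*} [TopologicalSpace M] [ChartedSpace Coord.Pt M]
    [IsManifold (𝓡 4) ∞ M] (hM : OrientedAtlas M)
    (S : Magnetofluid M) (hS : S.IsEMSF)
    (ξ ψ : M → ℝ) (hξ : S.IsProperSpecialCKV ξ ψ)
    (hE : ∀ x, S.mu x + (1 / 2) * S.lam * S.H x ^ 2 + S.Lam ≠ 0)
    (hH : ∀ x, S.star S.H x ≠ 0) :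
    -- (a) `R_{ab} = (R/2) p_{ab}`
    (∀ e ∈ atlas Coord.Pt M, ∀ z ∈ e.target, ∀ a b,
      Coord.ricci (S.inChart e).g z a b = S.R (e.symm z) / 2 * (S.inChart e).p z a b) ∧
    -- (b) `R/H` is constant along the magnetic field lines and along the fluid flow lines
    ConstAlong S.n (fun x => S.R x / S.H x) ∧
    ConstAlong S.u (fun x => S.R x / S.H x) ∧
    -- (c) the reduced equations, in every chart `e`, at every point with coordinates `z`
    (∀ e ∈ atlas Coord.Pt M, ∀ C : Coord.Fields, C = S.inChart e → ∀ z ∈ e.target,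
      -- `μ* - (μ - ½λH² + Λ)(ln H)* = 0`
      Coord.along C.n C.mu z
        - (C.mu z - (1 / 2) * S.lam * C.H z ^ 2 + S.Lam) * C.lnHstar z = 0 ∧
      -- `μ˙ - (μ + p_⊥)(ln H)˙ = 0`
      Coord.along C.u C.mu z - (C.mu z + C.pp z) * C.lnHdot z = 0 ∧
      -- `𝒮_{ab} = 0` and `ℰ = -(ln H)*`
      (∀ a b, C.screenShear z a b = 0) ∧
      C.screenExp z = -C.lnHstar z ∧
      -- `n˙^a = -½ (ln H)* u^a + p^a_b σ^b_c n^c`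
      (∀ a, C.nDot z a = -(1 / 2) * C.lnHstar z * C.u z a
        + ∑ b, ∑ c, C.pUp z a b * C.sigma z b c * C.n z c) ∧
      -- `n*^a = (ln ξ)* n^a - (ln ξ)^{,a}`
      (∀ a, C.nStar z a = Coord.along C.n (fun y => Real.log (ξ (e.symm y))) z * C.n z a
        - ∑ b, Coord.ginv C.g z a b * Coord.pd b (fun y => Real.log (ξ (e.symm y))) z) ∧
      -- `N_a = 0`
      (∀ a, C.greenberg z a = 0) ∧
      -- `σ_{ab} n^a n^b - ⅔ θ = (ln H)˙`
      C.sigmaNN z - (2 / 3) * C.theta z = C.lnHdot z ∧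
      -- `e = 2 ω^a H_a`
      C.charge z = 2 * ∑ a, C.omega z a * Coord.lower C.g C.Hv z a ∧
      -- `ℛ^a = -(j^b H_b / (2 H³)) H^a`
      (∀ a, C.screenRotVec z a =
        -((∑ b, C.conduction z b * Coord.lower C.g C.Hv z b) / (2 * C.H z ^ 3)) * C.Hv z a)) := by
  have hR := Magnetofluid.R_eq hS hξ hH
  refine ⟨fun e he z hz a b => ?_, Magnetofluid.constAlong_R_div hR fun e he z hz => ?_,
    Magnetofluid.constAlong_R_div hR fun e he z hz => ?_, ?_⟩
  · refine ((Magnetofluid.stringCKV hS hξ he).ricci_eq_p ⟨z, hz⟩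
      (Magnetofluid.along_H_ne_zero hH he hz) a b).trans ?_
    rw [hR, mul_div_cancel_left₀ _ two_ne_zero]
    rfl
  · exact (Magnetofluid.stringCKV hS hξ he).along_n_energy ⟨z, hz⟩
      (Magnetofluid.along_H_ne_zero hH he hz)
  · have C := Magnetofluid.stringCKV hS hξ he
    exact (C.conservation ⟨z, hz⟩ (C.factor_ne_zero ⟨z, hz⟩
      (Magnetofluid.along_H_ne_zero hH he hz))).2.2
  · rintro e he _ rfl z hz
    exact (Magnetofluid.stringCKV hS hξ he).reduced ⟨z, hz⟩ (Magnetofluid.along_H_ne_zero hH he hz)
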